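/- **Conventions.** Let $n\ge 1$, $p\in(n,\infty)$, $\alpha=(p-n)/(p-1)\in(0,1]$, and let $\Omega\subset\mathbb R^n$ be a domain (open, connected, non-empty). Write $\|x\|=\max_i|x_i|$; the distances $\operatorname{dist}$ (between points and sets, or between sets) and $\operatorname{diam}$ are taken in this uniform norm. A cube is $Q=Q(x_Q,r_Q)=\{y:\|y-x_Q\|\le r_Q\}$, $r_Q>0$, and $\eta Q=Q(x_Q,\eta r_Q)$. For $\varepsilon>0$ put $\mathcal O_\varepsilon(\partial\Omega)=\{x\in\Omega:\operatorname{dist}(x,\partial\Omega)<\varepsilon\}$. **The $\alpha$-boundary.** For $x,y\in\Omega$ let $d_{\alpha,\Omega}(x,y)=\inf_\gamma\int_\gamma\operatorname{dist}(z,\partial\Omega)^{\alpha-1}\,ds(z)$, the infimum over all rectifiable curves $\gamma\subset\Omega$ joining $x$ to $y$ ($ds$ is arc length), and $\delta_{\alpha,\Omega}(x,y)=d_{\alpha,\Omega}(x,y)+\|x-y\|^\alpha$. Let $\Omega^{*}_{\alpha}$ be the Cauchy completion of $(\Omega,\delta_{\alpha,\Omega})$, i.e. the set of classes $[(x_i)]_\alpha$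 of $\delta_{\alpha,\Omega}$-Cauchy sequences in $\Omega$ modulo $\delta_{\alpha,\Omega}(x_i,y_i)\to0$; identify $x\in\Omega$ with the class of the constant sequence, and let $\partial_\alpha\Omega=\Omega^{*}_{\alpha}\setminus\Omega$. For $\omega\in\Omega^{*}_\alpha$ let $\ell(\omega)$ be the common limit in $\mathbb R^n$ of all sequences $(x_i)\in\omega$, and for $\omega_1,\omega_2\in\Omega^{*}_\alpha$ let $d_{\alpha,\overline\Omega}(\omega_1,\omega_2)=\lim_i d_{\alpha,\Omega}(x_i,y_i)$, where $(x_i)\in\omega_1$, $(y_i)\in\omega_2$. **Traces.** $W^1_p(\Omega)$ is normed by $\|F\|_{L_p(\Omega)}+\|\nabla F\|_{L_p(\Omega)}$. A function $f:\partial_\alpha\Omega\to\mathbb R$ is the trace of a continuous $F\in W^1_p(\Omega)$, $f=\operatorname{tr}F$, if $f(\omega)=\lim_iF(y_i)$ for every $\omega\in\partial_\alpha\Omega$ and every $(y_i)\in\omega$. Let $\operatorname{tr}(W^1_p(\Omega))$ be the set of all such $f$, with $\|f\|_{\operatorname{tr}(W^1_p(\Omega))}=\inf\{\|F\|_{W^1_p(\Omega)}: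 F\in W^1_p(\Omega)\text{ continuous},\ \operatorname{tr}F=f\}$. **Visibility and $T_{\mathcal Q}$.** Let $Q\subset\Omega$ be a cube. An element $\omega\in\partial_\alpha\Omega$ is $(\alpha,Q)$-visible if for every $y\in Q$ the semi-open segment $(\ell(\omega),y]$ lies in $\Omega$, and $\omega$ contains a sequence of points of $(\ell(\omega),x_Q]$. Let $a_Q\in\partial\Omega$ be a point nearest to $Q$ and let $\omega_{Q,\alpha}$ be the class of the sequence $a_Q+\frac1i(x_Q-a_Q)$, $i=1,2,\dots$. For a covering $\mathcal Q$ of $\Omega$ by non-overlapping cubes $Q\subset\Omega$, the map $T_{\mathcal Q}:\Omega\to\partial_\alpha\Omega$ is defined almost everywhere by $T_{\mathcal Q}=\omega_{Q,\alpha}$ on the interior of $Q$, $Q\in\mathcal Q$. **Theorem.** Fix $\varepsilon>0$, $\theta>1$, $\eta\ge22\theta^2$, and a covering $\mathcal Q$ of $\Omega$ by non-overlapping cubes $Q\subset\Omega$ with $\frac1\theta\operatorname{diam}Q\le\operatorname{dist}(Q,\partial\Omega)\le\theta\operatorname{diam}Q$. Then each $\omega_{Q,\alpha}$, $Q\in\mathcal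 Q$, belongs to $\partial_\alpha\Omega$, so that $T_{\mathcal Q}$ is well defined for every choice of the nearest points $a_Q$. A function $f:\partial_\alpha\Omega\to\mathbb R$ belongs to $\operatorname{tr}(W^1_p(\Omega))$ if and only if 1. $f$ is continuous with respect to the metric $d_{\alpha,\overline\Omega}$; 2. $f\circ T_{\mathcal Q}\in L_p(\mathcal O_\varepsilon(\partial\Omega))$; 3. there is $\lambda>0$ such that for every finite family $Q_1,\dots,Q_m$ of pairwise disjoint cubes contained in $\mathcal O_\varepsilon(\partial\Omega)$ and all $(\alpha,Q_i)$-visible $\omega_i^{(1)},\omega_i^{(2)}\in\partial_\alpha\Omega$ with $\ell(\omega_i^{(1)}),\ell(\omega_i^{(2)})\in(\eta Q_i)\cap\partial\Omega$, $$\sum_{i=1}^m\frac{|f(\omega_i^{(1)})-f(\omega_i^{(2)})|^p}{(\operatorname{diam}Q_i)^{p-n}}\le\lambda .$$ Moreover, for $f\in\operatorname{tr}(W^1_p(\Omega))$, $$\|f\|_{\operatorname{tr}(W^1_p(\Omega))}\sim\|f\circ T_{\mathcal Q}\|_{L_p(\mathcal O_\varepsilon(\partial\Omega))}+\inf\lambda^{1/p},$$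 the infimum over all $\lambda$ as in 3, with constants of equivalence depending only on $n,p,\varepsilon,\theta$ and $\eta$. -/

import Mathlib

open MeasureTheory Filter Topology
open scoped ENNReal

noncomputable section

namespace SobolevTrace

/-! Points of `ℝⁿ` are `Fin n → ℝ`. All distances, diameters and cubes refer to the uniform norm
`‖x‖ = max |xᵢ|`, which is the norm of this type. -/

/-- A closed cube `Q(x, r)` with sides parallel to the axes, centre `x` and side length `2r > 0`. -/
structure Cube (n : ℕ) where
  center : Fin n → ℝ
  radius : ℝ
  radius_pos : 0 < radius

/-- The cube as a set of points. -/
def Cube.toSet {n : ℕ} (Q : Cube n) : Set (Fin n → ℝ) :=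
  Metric.closedBall Q.center Q.radius

/-- The dilated cube `ηQ`, as a set of points. -/
def Cube.dilate {n : ℕ} (η : ℝ) (Q : Cube n) : Set (Fin n → ℝ) :=
  Metric.closedBall Q.center (η * Q.radius)

/-- The diameter of a cube. -/
def Cube.diam {n : ℕ} (Q : Cube n) : ℝ := Metric.diam Q.toSet

/-- `dist(A, B) = inf {‖a - b‖ : a ∈ A, b ∈ B}`. -/
def setDist {n : ℕ} (A B : Set (Fin n → ℝ)) : ℝ := sInf (Set.image2 dist A B)

/-- `𝒪_ε(∂Ω) = {x ∈ Ω : dist(x, ∂Ω) < ε}`. -/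
def boundaryNhd {n : ℕ} (Ω : Set (Fin n → ℝ)) (ε : ℝ) : Set (Fin n → ℝ) :=
  {x ∈ Ω | Metric.infDist x (frontier Ω) < ε}

/-! ### The subhyperbolic metric -/

/-- `γ` restricted to `[0, 1]` is a (Lipschitz parametrization of a) rectifiable curve in `Ω`
joining `x` to `y`. Every rectifiable curve has such a parametrization, for instance the one
proportional to arc length. -/
def IsCurveJoining {n : ℕ} (Ω : Set (Fin n → ℝ)) (x y : Fin n → ℝ)
    (γ : ℝ → Fin n → ℝ) : Prop :=
  (∃ K, LipschitzOnWith K γ (Set.Icc 0 1)) ∧ (∀ t ∈ Set.Icc (0 : ℝ) 1, γ t ∈ Ω) ∧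
    γ 0 = x ∧ γ 1 = y

/-- The subhyperbolic length `∫_γ dist(z, ∂Ω)^(α-1) ds(z)`, where `ds = |γ'(t)| dt` is the usual
(Euclidean) arc length. -/
def subhypLength {n : ℕ} (Ω : Set (Fin n → ℝ)) (α : ℝ) (γ : ℝ → Fin n → ℝ) : ℝ≥0∞ :=
  ∫⁻ t in Set.Icc (0 : ℝ) 1,
    ENNReal.ofReal (Metric.infDist (γ t) (frontier Ω) ^ (α - 1) *
      Real.sqrt (∑ i, (deriv γ t i) ^ 2))

/-- The subhyperbolic metric `d_{α,Ω}(x, y)`, the infimum of the subhyperbolic lengths of the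
rectifiable curves in `Ω` joining `x` to `y`. -/
def subhypDist {n : ℕ} (Ω : Set (Fin n → ℝ)) (α : ℝ) (x y : Fin n → ℝ) : ℝ :=
  (⨅ (γ : ℝ → Fin n → ℝ) (_ : IsCurveJoining Ω x y γ), subhypLength Ω α γ).toReal

/-- The metric `δ_{α,Ω}(x, y) = d_{α,Ω}(x, y) + ‖x - y‖^α` on `Ω`. -/
def deltaDist {n : ℕ} (Ω : Set (Fin n → ℝ)) (α : ℝ) (x y : Fin n → ℝ) : ℝ :=
  subhypDist Ω α x y + ‖x - y‖ ^ α

/-! ### The Cauchy completion of `(Ω, δ_{α,Ω})` and the `α`-boundary -/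

/-- The Cauchy sequences of `(Ω, δ_{α,Ω})`. -/
def cauchySeqs {n : ℕ} (Ω : Set (Fin n → ℝ)) (α : ℝ) : Set (ℕ → Fin n → ℝ) :=
  {x | (∀ i, x i ∈ Ω) ∧
    Tendsto (fun ij : ℕ × ℕ => deltaDist Ω α (x ij.1) (x ij.2)) atTop (𝓝 0)}

/-- The class `[(xᵢ)]_α` of the Cauchy sequences `(yᵢ)` with `δ_{α,Ω}(xᵢ, yᵢ) → 0`. -/
def seqClass {n : ℕ} (Ω : Set (Fin n → ℝ)) (α : ℝ) (x : ℕ → Fin n → ℝ) :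
    Set (ℕ → Fin n → ℝ) :=
  {y ∈ cauchySeqs Ω α | Tendsto (fun i => deltaDist Ω α (x i) (y i)) atTop (𝓝 0)}

/-- The Cauchy completion of `(Ω, δ_{α,Ω})`: the set of all equivalence classes of Cauchy
sequences. -/
def completion {n : ℕ} (Ω : Set (Fin n → ℝ)) (α : ℝ) : Set (Set (ℕ → Fin n → ℝ)) :=
  {ω | ∃ x ∈ cauchySeqs Ω α, ω = seqClass Ω α x}

/-- The `α`-boundary `∂_αΩ`: the elements of the completion that are not points of `Ω`, where
`x ∈ Ω` is identified with the class of the constant sequence `(x, x, …)`. -/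
def alphaBoundary {n : ℕ} (Ω : Set (Fin n → ℝ)) (α : ℝ) : Set (Set (ℕ → Fin n → ℝ)) :=
  completion Ω α \ {ω | ∃ x ∈ Ω, ω = seqClass Ω α (fun _ => x)}

/-- `ℓ(ω)`: the common limit in `ℝⁿ` of all sequences in the class `ω`. -/
def ell {n : ℕ} (ω : Set (ℕ → Fin n → ℝ)) : Fin n → ℝ :=
  Classical.epsilon fun z => ∀ y ∈ ω, Tendsto y atTop (𝓝 z)

/-- The extended metric `d_{α,Ω̄}(ω₁, ω₂) = lim d_{α,Ω}(xᵢ, yᵢ)`, with arbitrary `(xᵢ) ∈ ω₁`,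
`(yᵢ) ∈ ω₂`. -/
def closureDist {n : ℕ} (Ω : Set (Fin n → ℝ)) (α : ℝ) (ω₁ ω₂ : Set (ℕ → Fin n → ℝ)) : ℝ :=
  Classical.epsilon fun d : ℝ =>
    ∀ x ∈ ω₁, ∀ y ∈ ω₂, Tendsto (fun i => subhypDist Ω α (x i) (y i)) atTop (𝓝 d)

/-- Continuity of a function on `∂_αΩ` with respect to the metric `d_{α,Ω̄}`. -/
def ContinuousForClosureDist {n : ℕ} (Ω : Set (Fin n → ℝ)) (α : ℝ)
    (f : alphaBoundary Ω α → ℝ) : Prop :=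
  ∀ ω : alphaBoundary Ω α, ∀ τ : ℝ, 0 < τ → ∃ δ : ℝ, 0 < δ ∧
    ∀ ω' : alphaBoundary Ω α, closureDist Ω α ω ω' < δ → |f ω' - f ω| < τ

/-! ### Visibility and the projection onto the boundary -/

/-- `x` is `Q`-visible in `Ω`: for each `y ∈ Q` the semi-open segment `(x, y]` lies in `Ω`. -/
def QVisible {n : ℕ} (Ω : Set (Fin n → ℝ)) (Q : Cube n) (x : Fin n → ℝ) : Prop :=
  x ∈ closure Ω ∧ ∀ y ∈ Q.toSet, ∀ t ∈ Set.Ioc (0 : ℝ) 1, AffineMap.lineMap x y t ∈ Ω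

/-- `ω` is `(α, Q)`-visible in `Ω`: the point `ℓ(ω)` is `Q`-visible and the class `ω` contains a
sequence of points of the segment `(ℓ(ω), x_Q]`, with `x_Q` the centre of `Q`. -/
def AlphaVisible {n : ℕ} (Ω : Set (Fin n → ℝ)) (Q : Cube n)
    (ω : Set (ℕ → Fin n → ℝ)) : Prop :=
  QVisible Ω Q (ell ω) ∧
    ∃ y ∈ ω, ∀ i, ∃ t ∈ Set.Ioc (0 : ℝ) 1, y i = AffineMap.lineMap (ell ω) Q.center t

/-- `a` is a point of `∂Ω` nearest to the cube `Q`. -/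
def IsNearestBoundaryPoint {n : ℕ} (Ω : Set (Fin n → ℝ)) (Q : Cube n) (a : Fin n → ℝ) : Prop :=
  a ∈ frontier Ω ∧ Metric.infDist a Q.toSet = setDist Q.toSet (frontier Ω)

/-- `ω_{Q,α}`: the class of the sequence `a + (x_Q - a) / i`, `i = 1, 2, …`, where `a` is a point
of `∂Ω` nearest to `Q`. -/
def visibleElement {n : ℕ} (Ω : Set (Fin n → ℝ)) (α : ℝ) (Q : Cube n) (a : Fin n → ℝ) :
    Set (ℕ → Fin n → ℝ) :=
  seqClass Ω α fun i => a + (1 / ((i : ℝ) + 1)) • (Q.center - a)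

/-- `𝒬` is a covering of `Ω` by non-overlapping cubes `Q ⊆ Ω` with
`θ⁻¹ diam Q ≤ dist(Q, ∂Ω) ≤ θ diam Q`. -/
def IsWhitneyCovering {n : ℕ} (Ω : Set (Fin n → ℝ)) (θ : ℝ) (𝒬 : Set (Cube n)) : Prop :=
  (∀ Q ∈ 𝒬, Q.toSet ⊆ Ω) ∧ (Ω ⊆ ⋃ Q ∈ 𝒬, Q.toSet) ∧
  (𝒬.Pairwise fun Q Q' => Disjoint (interior Q.toSet) (interior Q'.toSet)) ∧
  ∀ Q ∈ 𝒬, (1 / θ) * Q.diam ≤ setDist Q.toSet (frontier Ω) ∧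
    setDist Q.toSet (frontier Ω) ≤ θ * Q.diam

/-- `T` is a mapping `T_𝒬`: on the interior of each `Q ∈ 𝒬` (so almost everywhere on `Ω`) it
equals `ω_{Q,α}`, for some choice of the nearest boundary points. -/
def IsBoundaryProjection {n : ℕ} (Ω : Set (Fin n → ℝ)) (α : ℝ) (𝒬 : Set (Cube n))
    (T : (Fin n → ℝ) → alphaBoundary Ω α) : Prop :=
  ∀ Q ∈ 𝒬, ∃ a, IsNearestBoundaryPoint Ω Q a ∧
    ∀ x ∈ interior Q.toSet, (T x : Set (ℕ → Fin n → ℝ)) = visibleElement Ω α Q a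

/-! ### Sobolev functions and their traces -/

/-- `G` is the distributional gradient of `F` on `Ω`. -/
def IsWeakGradient {n : ℕ} (Ω : Set (Fin n → ℝ)) (F : (Fin n → ℝ) → ℝ)
    (G : (Fin n → ℝ) → Fin n → ℝ) : Prop :=
  ∀ φ : (Fin n → ℝ) → ℝ, ContDiff ℝ ((⊤ : ℕ∞) : WithTop ℕ∞) φ → HasCompactSupport φ → tsupport φ ⊆ Ω →
    ∀ i, ∫ x in Ω, F x * fderiv ℝ φ x (Pi.single i 1) = - ∫ x in Ω, G x i * φ x

/-- `F` is a continuous function in `W¹_p(Ω)` with gradient `G`. -/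
def IsSobolev {n : ℕ} (Ω : Set (Fin n → ℝ)) (p : ℝ) (F : (Fin n → ℝ) → ℝ)
    (G : (Fin n → ℝ) → Fin n → ℝ) : Prop :=
  ContinuousOn F Ω ∧ MemLp F (ENNReal.ofReal p) (volume.restrict Ω) ∧
    MemLp G (ENNReal.ofReal p) (volume.restrict Ω) ∧ IsWeakGradient Ω F G

/-- `f = tr F`: for each `ω ∈ ∂_αΩ` and each `(yᵢ) ∈ ω`, `F(yᵢ) → f(ω)`. -/
def IsTrace {n : ℕ} (Ω : Set (Fin n → ℝ)) (α : ℝ) (F : (Fin n → ℝ) → ℝ)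
    (f : alphaBoundary Ω α → ℝ) : Prop :=
  ∀ ω : alphaBoundary Ω α, ∀ y ∈ (ω : Set (ℕ → Fin n → ℝ)),
    Tendsto (fun i => F (y i)) atTop (𝓝 (f ω))

/-- `α = (p - n) / (p - 1)`. -/
def sobolevExponent (n : ℕ) (p : ℝ) : ℝ := (p - n) / (p - 1)

/-- The Sobolev `W¹_p`-boundary of `Ω`: the `α`-boundary for `α = (p - n) / (p - 1)`. -/
abbrev SobolevBoundary {n : ℕ} (Ω : Set (Fin n → ℝ)) (p : ℝ) : Type :=
  alphaBoundary Ω (sobolevExponent n p)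

/-- `f ∈ tr(W¹_p(Ω))`. -/
def MemTraceSpace {n : ℕ} (Ω : Set (Fin n → ℝ)) (p : ℝ) (f : SobolevBoundary Ω p → ℝ) : Prop :=
  ∃ F G, IsSobolev Ω p F G ∧ IsTrace Ω (sobolevExponent n p) F f

/-- The norm of `tr(W¹_p(Ω))`: the infimum of `‖F‖_{L_p(Ω)} + ‖∇F‖_{L_p(Ω)}` over the continuous
`F ∈ W¹_p(Ω)` with `tr F = f`. -/
def traceNorm {n : ℕ} (Ω : Set (Fin n → ℝ)) (p : ℝ) (f : SobolevBoundary Ω p → ℝ) : ℝ≥0∞ :=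
  ⨅ (F : (Fin n → ℝ) → ℝ) (G : (Fin n → ℝ) → Fin n → ℝ)
    (_ : IsSobolev Ω p F G ∧ IsTrace Ω (sobolevExponent n p) F f),
    eLpNorm F (ENNReal.ofReal p) (volume.restrict Ω) +
      eLpNorm G (ENNReal.ofReal p) (volume.restrict Ω)

/-- The variational inequality with constant `lam`, for all finite families of pairwise disjoint
cubes contained in `𝒪_ε(∂Ω)`. -/
def VariationalBound {n : ℕ} (Ω : Set (Fin n → ℝ)) (p ε η : ℝ) (f : SobolevBoundary Ω p → ℝ)
    (lam : ℝ) : Prop :=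
  ∀ (m : ℕ) (Q : Fin m → Cube n) (ω₁ ω₂ : Fin m → SobolevBoundary Ω p),
    (∀ i, (Q i).toSet ⊆ boundaryNhd Ω ε) →
    (Pairwise fun i j => Disjoint (Q i).toSet (Q j).toSet) →
    (∀ i, AlphaVisible Ω (Q i) (ω₁ i) ∧ AlphaVisible Ω (Q i) (ω₂ i)) →
    (∀ i, ell (ω₁ i : Set (ℕ → Fin n → ℝ)) ∈ (Q i).dilate η ∩ frontier Ω ∧
      ell (ω₂ i : Set (ℕ → Fin n → ℝ)) ∈ (Q i).dilate η ∩ frontier Ω) →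
    ∑ i, |f (ω₁ i) - f (ω₂ i)| ^ p / (Q i).diam ^ (p - n) ≤ lam

/-- `inf λ^(1/p)` over all constants `λ > 0` in the variational inequality. -/
def variationalNorm {n : ℕ} (Ω : Set (Fin n → ℝ)) (p ε η : ℝ)
    (f : SobolevBoundary Ω p → ℝ) : ℝ≥0∞ :=
  ⨅ (lam : ℝ) (_ : 0 < lam ∧ VariationalBound Ω p ε η f lam), ENNReal.ofReal (lam ^ (1 / p))

end SobolevTrace

end

/-! The proof compares boundary values with averages of `F` against a smooth bump scaled to cubes.
When the averaging cube is moved and rescaled affinely, the time derivative of the kernel is a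
divergence. The weak gradient then expresses the change of the average as an integral of the
gradient over the region swept out (`IsWeakGradient.enorm_bumpAverage_sub_le`). Necessity comes from
two such motions.

The first motion shrinks a cube `Q` to a boundary element that it sees, through the cone over `Q`.
The averages tend to the trace, because all sequences in a smaller cone that converge to the vertex
belong to one class of the completion. Hölder's inequality with a power of the time as weight bounds
the `p`-th power of the difference between trace and average, multiplied by `r ^ (n - p)`. The bound
is the integral of `|∇F| ^ p` against `(d(z) / r) ^ σ`, where `r` is the radius of `Q` and `d` the
distance to the boundary. It needs `σ < p - n`. For `σ > 0` these weights have a bounded sum over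
any disjoint family of cubes (`exists_packing_bound`), and `exists_cone_estimate` follows. Used
twice on the cubes of condition 3 it gives the variational inequality. Used on the covering itself
it controls `f ∘ T` in `L_p`.

The second motion follows a curve of almost minimal subhyperbolic length through a chain of cubes of
radius `d / 8` with bounded overlap (`exists_chain`). Each step away from the end of the chain costs
subhyperbolic length comparable to `d ^ α`, and `α (p - 1) = p - n` is exactly the relation that
makes the discrete Hölder inequality close (`exists_chain_estimate`). This gives continuity of the
trace.

For sufficiency, `f ∘ T` is a step function, constant on the interior of each covering cube. It is
averaged at a scale proportional to the distance to the boundary and cut off away from the boundary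
(`whitneyExtension`). Two nearby covering cubes `Q` and `K` have projections that are both visible
from one cube inside `Q` (`exists_common_cube`). One such cube per `Q` forms a disjoint family, so
condition 3 bounds the sum of the oscillations `M Q` in the required weighted norm
(`VariationalBound.exists_oscillation`). On `Q` the extension and its gradient are at most a
constant times `M Q / r + |f (T Q)|`, which is summable to the power `p` near the boundary, by
conditions 2 and 3. The trace is correct because `M Q` tends to zero near the boundary and because
the projections of cubes containing points of a sequence of `ω` approach `ω`, where condition 1
applies. -/

namespace SobolevTrace

/-! ### Subhyperbolic length and distance: reversal, concatenation, segments. -/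

/-- The extended-real-valued version of `subhypDist`. -/
noncomputable def subhypEDist {n : ℕ} (Ω : Set (Fin n → ℝ)) (α : ℝ) (x y : Fin n → ℝ) : ℝ≥0∞ :=
  ⨅ (γ : ℝ → Fin n → ℝ) (_ : IsCurveJoining Ω x y γ), subhypLength Ω α γ

/-- The subhyperbolic length of the part of `γ` over `s`. -/
noncomputable def subhypLengthOn {n : ℕ} (Ω : Set (Fin n → ℝ)) (α : ℝ) (γ : ℝ → Fin n → ℝ)
    (s : Set ℝ) : ℝ≥0∞ :=
  ∫⁻ t in s, ENNReal.ofReal (Metric.infDist (γ t) (frontier Ω) ^ (α - 1) *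
      Real.sqrt (∑ i, (deriv γ t i) ^ 2))

section Curves

variable {n : ℕ} {Ω : Set (Fin n → ℝ)} {α : ℝ}

/-- Change of variables in the length integral. No differentiability is needed: the chain rule for
an affine inner map also holds for the default value of `deriv`. -/
lemma subhypLengthOn_comp_affine (γ : ℝ → Fin n → ℝ) {a : ℝ} (ha : a ≠ 0) (b : ℝ) {s : Set ℝ}
    (hs : MeasurableSet s) :
    subhypLengthOn Ω α (fun t => γ (a * t + b)) s =
      subhypLengthOn Ω α γ ((fun t => a * t + b) '' s) := by
  unfold subhypLengthOn
  have hinj : Set.InjOn (fun t : ℝ => a * t + b) s := by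
    intro x _ y _ h
    simpa [ha] using h
  rw [lintegral_image_eq_lintegral_abs_deriv_mul hs (f' := fun _ => a) ?_ hinj]
  · refine lintegral_congr fun t => ?_
    rw [← ENNReal.ofReal_mul (abs_nonneg _)]
    congr 1
    have hd : deriv (fun t => γ (a * t + b)) t = a • deriv γ (a * t + b) := by
      have := deriv_comp_mul_left a (fun u => γ (u + b)) t
      rw [this, deriv_comp_add_const]
    rw [hd]
    have : ∑ i, ((a • deriv γ (a * t + b)) i) ^ 2 = a ^ 2 * ∑ i, (deriv γ (a * t + b) i) ^ 2 := by
      rw [Finset.mul_sum]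
      refine Finset.sum_congr rfl fun i _ => ?_
      simp [mul_pow]
    rw [this, Real.sqrt_mul (sq_nonneg a), Real.sqrt_sq_eq_abs]
    ring
  · intro t _
    have := ((hasDerivAt_id t).const_mul a).add_const b
    simpa using this.hasDerivWithinAt

lemma subhypLengthOn_Icc (γ : ℝ → Fin n → ℝ) :
    subhypLengthOn Ω α γ (Set.Icc 0 1) = subhypLength Ω α γ := rfl

lemma IsCurveJoining.reverse {x y : Fin n → ℝ} {γ : ℝ → Fin n → ℝ}
    (h : IsCurveJoining Ω x y γ) : IsCurveJoining Ω y x (fun t => γ (-1 * t + 1)) := by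
  obtain ⟨⟨K, hK⟩, hm, h0, h1⟩ := h
  have hmem : ∀ t ∈ Set.Icc (0 : ℝ) 1, -1 * t + 1 ∈ Set.Icc (0 : ℝ) 1 := by
    intro t ht
    constructor <;> linarith [ht.1, ht.2]
  refine ⟨⟨K, ?_⟩, fun t ht => hm _ (hmem t ht), by simpa using h1, by simpa using h0⟩
  refine LipschitzOnWith.of_dist_le_mul fun s hs t ht => ?_
  refine (hK.dist_le_mul _ (hmem s hs) _ (hmem t ht)).trans_eq ?_
  congr 1
  rw [Real.dist_eq, Real.dist_eq, abs_sub_comm s t]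
  congr 1
  ring

lemma subhypEDist_le_of_curve {x y : Fin n → ℝ} {γ : ℝ → Fin n → ℝ}
    (h : IsCurveJoining Ω x y γ) : subhypEDist Ω α x y ≤ subhypLength Ω α γ :=
  iInf₂_le γ h

lemma subhypEDist_comm (x y : Fin n → ℝ) : subhypEDist Ω α x y = subhypEDist Ω α y x := by
  have key : ∀ x y : Fin n → ℝ, subhypEDist Ω α x y ≤ subhypEDist Ω α y x := by
    intro x y
    refine le_iInf₂ fun γ hγ => ?_
    refine (subhypEDist_le_of_curve hγ.reverse).trans_eq ?_
    rw [← subhypLengthOn_Icc, subhypLengthOn_comp_affine γ (by norm_num) 1 measurableSet_Icc,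
      ← subhypLengthOn_Icc]
    congr 1
    ext t
    simp only [Set.mem_image, Set.mem_Icc]
    constructor
    · rintro ⟨s, hs, rfl⟩
      constructor <;> linarith [hs.1, hs.2]
    · intro ht
      exact ⟨1 - t, ⟨by linarith [ht.2], by linarith [ht.1]⟩, by ring⟩
  exact le_antisymm (key x y) (key y x)

lemma subhypEDist_triangle (x y z : Fin n → ℝ) :
    subhypEDist Ω α x z ≤ subhypEDist Ω α x y + subhypEDist Ω α y z := by
  unfold subhypEDist
  rw [ENNReal.iInf_add]
  refine le_iInf fun γ₁ => ?_
  rw [ENNReal.iInf_add]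
  refine le_iInf fun h₁ => ?_
  rw [ENNReal.add_iInf]
  refine le_iInf fun γ₂ => ?_
  rw [ENNReal.add_iInf]
  refine le_iInf fun h₂ => ?_
  set γ : ℝ → Fin n → ℝ := fun t => if t ≤ 1 / 2 then γ₁ (2 * t + 0) else γ₂ (2 * t + (-1))
    with hγ
  obtain ⟨⟨K₁, hK₁⟩, hm₁, h₁0, h₁1⟩ := h₁
  obtain ⟨⟨K₂, hK₂⟩, hm₂, h₂0, h₂1⟩ := h₂
  have hleft : ∀ t ≤ (1 / 2 : ℝ), γ t = γ₁ (2 * t + 0) := fun t ht => if_pos ht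
  have hright : ∀ t ≥ (1 / 2 : ℝ), γ t = γ₂ (2 * t + (-1)) := by
    intro t ht
    rcases eq_or_lt_of_le ht with h | h
    · subst h
      rw [hleft _ le_rfl]
      norm_num
      rw [h₁1, h₂0]
    · exact if_neg (not_le.2 h)
  have hlip : ∀ s ∈ Set.Icc (0 : ℝ) 1, ∀ t ∈ Set.Icc (0 : ℝ) 1, s ≤ t →
      dist (γ s) (γ t) ≤ (2 * K₁ + 2 * K₂ : ℝ) * (t - s) := by
    have hA : ∀ s t, 0 ≤ s → s ≤ t → t ≤ (1 / 2 : ℝ) →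
        dist (γ s) (γ t) ≤ (2 * K₁ : ℝ) * (t - s) := by
      intro s t h0 hst ht
      rw [hleft s (hst.trans ht), hleft t ht]
      refine (hK₁.dist_le_mul _ ⟨by linarith, by linarith⟩ _ ⟨by linarith, by linarith⟩).trans_eq ?_
      rw [Real.dist_eq, abs_of_nonpos (by linarith)]
      ring
    have hB : ∀ s t, (1 / 2 : ℝ) ≤ s → s ≤ t → t ≤ 1 →
        dist (γ s) (γ t) ≤ (2 * K₂ : ℝ) * (t - s) := by
      intro s t h0 hst ht
      rw [hright s h0, hright t (h0.trans hst)]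
      refine (hK₂.dist_le_mul _ ⟨by linarith, by linarith⟩ _ ⟨by linarith, by linarith⟩).trans_eq ?_
      rw [Real.dist_eq, abs_of_nonpos (by linarith)]
      ring
    intro s hs t ht hst
    have k1 : (0 : ℝ) ≤ K₁ := K₁.2
    have k2 : (0 : ℝ) ≤ K₂ := K₂.2
    rcases le_total t (1 / 2) with h | h
    · refine (hA s t hs.1 hst h).trans ?_
      gcongr; linarith
    rcases le_total s (1 / 2) with h' | h'
    · refine (dist_triangle _ (γ (1 / 2)) _).trans ?_
      have e1 := hA s (1 / 2) hs.1 h' le_rfl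
      have e2 := hB (1 / 2) t le_rfl h ht.2
      nlinarith [mul_nonneg k1 (sub_nonneg.2 h), mul_nonneg k2 (sub_nonneg.2 h')]
    · refine (hB s t h' hst ht.2).trans ?_
      gcongr; linarith
  have hjoin : IsCurveJoining Ω x z γ := by
    refine ⟨⟨2 * K₁ + 2 * K₂, LipschitzOnWith.of_dist_le_mul fun s hs t ht => ?_⟩, ?_, ?_, ?_⟩
    · rcases le_total s t with h | h
      · rw [Real.dist_eq, abs_of_nonpos (by linarith), neg_sub]
        exact hlip s hs t ht h
      · rw [Real.dist_eq, abs_of_nonneg (by linarith), dist_comm]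
        exact hlip t ht s hs h
    · intro t ht
      rcases le_total t (1 / 2) with h | h
      · rw [hleft t h]; exact hm₁ _ ⟨by linarith [ht.1], by linarith⟩
      · rw [hright t h]; exact hm₂ _ ⟨by linarith, by linarith [ht.2]⟩
    · rw [hleft 0 (by norm_num)]; simpa using h₁0
    · rw [hright 1 (by norm_num)]; norm_num; exact h₂1
  refine (iInf₂_le γ hjoin).trans ?_
  -- Derivatives agree only where the curves agree on a neighbourhood, so the two halves are
  -- compared over open intervals. The end points and the junction form a null set.
  have hcongr : ∀ (g h : ℝ → Fin n → ℝ) (s : Set ℝ), IsOpen s → Set.EqOn g h s →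
      subhypLengthOn Ω α g s = subhypLengthOn Ω α h s := by
    intro g h s hs heq
    refine setLIntegral_congr_fun hs.measurableSet fun t ht => ?_
    have : g =ᶠ[𝓝 t] h := heq.eventuallyEq_of_mem (hs.mem_nhds ht)
    simp only [heq ht, this.deriv_eq]
  have hsplit : subhypLength Ω α γ ≤ subhypLengthOn Ω α γ (Set.Ioo 0 (1 / 2)) +
      subhypLengthOn Ω α γ (Set.Ioo (1 / 2) 1) := by
    rw [← subhypLengthOn_Icc]
    have hae : (Set.Icc (0 : ℝ) 1 : Set ℝ) ≤ᵐ[volume]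
        (Set.Ioo (0 : ℝ) (1 / 2) ∪ Set.Ioo (1 / 2) 1 : Set ℝ) := by
      have hfin : volume ({0, 1 / 2, 1} : Set ℝ) = 0 :=
        (Set.toFinite _).measure_zero _
      rw [ae_le_set]
      refine measure_mono_null ?_ hfin
      rintro t ⟨⟨h0, h1⟩, ht⟩
      simp only [Set.mem_union, Set.mem_Ioo, not_or, not_and, not_lt] at ht
      simp only [Set.mem_insert_iff, Set.mem_singleton_iff]
      by_contra! hne
      rcases lt_or_gt_of_ne hne.2.1 with h | h
      · exact absurd (ht.1 (lt_of_le_of_ne h0 (Ne.symm hne.1))) (not_le.2 h)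
      · exact absurd (ht.2 h) (not_le.2 (lt_of_le_of_ne h1 hne.2.2))
    refine (lintegral_mono_set' hae).trans ?_
    exact lintegral_union_le _ _ _
  refine hsplit.trans (add_le_add ?_ ?_)
  · rw [hcongr γ (fun t => γ₁ (2 * t + 0)) _ isOpen_Ioo (fun t ht => hleft t ht.2.le),
      subhypLengthOn_comp_affine γ₁ two_ne_zero 0 measurableSet_Ioo]
    refine lintegral_mono_set ?_
    rintro _ ⟨t, ht, rfl⟩
    constructor <;> simp <;> linarith [ht.1, ht.2]
  · rw [hcongr γ (fun t => γ₂ (2 * t + (-1))) _ isOpen_Ioo (fun t ht => hright t ht.1.le),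
      subhypLengthOn_comp_affine γ₂ two_ne_zero (-1) measurableSet_Ioo]
    refine lintegral_mono_set ?_
    rintro _ ⟨t, ht, rfl⟩
    constructor <;> simp <;> linarith [ht.1, ht.2]

lemma sqrt_sum_sq_le (v : Fin n → ℝ) : Real.sqrt (∑ i, v i ^ 2) ≤ Real.sqrt n * ‖v‖ := by
  rw [← Real.sqrt_sq (norm_nonneg v), ← Real.sqrt_mul (Nat.cast_nonneg n)]
  refine Real.sqrt_le_sqrt ?_
  calc ∑ i, v i ^ 2 ≤ ∑ _i : Fin n, ‖v‖ ^ 2 := by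
        refine Finset.sum_le_sum fun i _ => ?_
        rw [← sq_abs]
        exact pow_le_pow_left₀ (abs_nonneg _) (norm_le_pi_norm v i) 2
    _ = n * ‖v‖ ^ 2 := by simp

lemma norm_le_sqrt_sum_sq (v : Fin n → ℝ) : ‖v‖ ≤ Real.sqrt (∑ i, v i ^ 2) := by
  refine (pi_norm_le_iff_of_nonneg (Real.sqrt_nonneg _)).2 fun i => ?_
  rw [Real.norm_eq_abs]
  refine Real.abs_le_sqrt ?_
  exact Finset.single_le_sum (f := fun i => v i ^ 2) (fun j _ => sq_nonneg _) (Finset.mem_univ i)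

/-- The subhyperbolic distance along a segment on which the distance to the boundary grows at
least linearly. -/
lemma subhypEDist_le_of_segment (hα : 0 < α) (hα1 : α ≤ 1) {x y : Fin n → ℝ} {m : ℝ} (hm : 0 < m)
    (hΩ : ∀ t ∈ Set.Icc (0 : ℝ) 1, AffineMap.lineMap x y t ∈ Ω)
    (hd : ∀ t ∈ Set.Ioc (0 : ℝ) 1,
      m * t ≤ Metric.infDist (AffineMap.lineMap x y t) (frontier Ω)) :
    subhypEDist Ω α x y ≤ ENNReal.ofReal (Real.sqrt n / α * ‖y - x‖ * m ^ (α - 1)) := by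
  have hderiv : ∀ t : ℝ, deriv (fun t : ℝ => (AffineMap.lineMap x y t : Fin n → ℝ)) t = y - x :=
    fun t => AffineMap.hasDerivAt_lineMap.deriv
  have hjoin : IsCurveJoining Ω x y (fun t => AffineMap.lineMap x y t) := by
    refine ⟨⟨nndist x y, (lipschitzWith_lineMap x y).lipschitzOnWith⟩, hΩ, by simp, by simp⟩
  refine (subhypEDist_le_of_curve hjoin).trans ?_
  unfold subhypLength
  have hInt : IntervalIntegrable (fun t : ℝ => t ^ (α - 1)) volume 0 1 :=
    intervalIntegral.intervalIntegrable_rpow' (by linarith)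
  calc _ ≤ ∫⁻ t in Set.Icc (0 : ℝ) 1,
        ENNReal.ofReal (Real.sqrt n * ‖y - x‖ * m ^ (α - 1) * t ^ (α - 1)) := by
        -- The time `0` is discarded: the linear lower bound vanishes there, and it is assumed only
        -- for positive times.
        rw [setLIntegral_congr (Ioc_ae_eq_Icc (μ := volume)).symm,
          setLIntegral_congr (Ioc_ae_eq_Icc (μ := volume)).symm]
        refine setLIntegral_mono' measurableSet_Ioc fun t ht => ?_
        refine ENNReal.ofReal_le_ofReal ?_
        rw [hderiv]
        have h1 : Metric.infDist (AffineMap.lineMap x y t) (frontier Ω) ^ (α - 1) ≤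
            m ^ (α - 1) * t ^ (α - 1) := by
          rw [← Real.mul_rpow hm.le ht.1.le]
          exact Real.rpow_le_rpow_of_nonpos (mul_pos hm ht.1) (hd t ht) (by linarith)
        calc _ ≤ (m ^ (α - 1) * t ^ (α - 1)) * (Real.sqrt n * ‖y - x‖) := by
              refine mul_le_mul h1 (sqrt_sum_sq_le _) (Real.sqrt_nonneg _) ?_
              have := ht.1
              positivity
          _ = _ := by ring
    _ = ENNReal.ofReal (Real.sqrt n * ‖y - x‖ * m ^ (α - 1)) *
          ∫⁻ t in Set.Ioc (0 : ℝ) 1, ENNReal.ofReal (t ^ (α - 1)) := by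
        rw [setLIntegral_congr (Ioc_ae_eq_Icc (μ := volume)).symm,
          ← lintegral_const_mul' _ _ ENNReal.ofReal_ne_top]
        refine lintegral_congr fun t => ?_
        rw [ENNReal.ofReal_mul (by positivity)]
    _ = _ := by
        rw [← ofReal_integral_eq_lintegral_ofReal, ← intervalIntegral.integral_of_le zero_le_one,
          integral_rpow (Or.inl (by linarith)), ← ENNReal.ofReal_mul (by positivity)]
        · congr 1
          simp [hα.ne']
          field_simp
        · exact (intervalIntegrable_iff_integrableOn_Ioc_of_le zero_le_one).1 hInt
        · refine (ae_restrict_iff' measurableSet_Ioc).2 (Eventually.of_forall fun t ht => ?_)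
          exact Real.rpow_nonneg ht.1.le _

end Curves

/-! ### Distance to the boundary and connectedness. -/

section Domain

variable {n : ℕ} {Ω : Set (Fin n → ℝ)} {α : ℝ}

lemma infDist_frontier_pos (hΩ : IsOpen Ω) (hne : (frontier Ω).Nonempty) {x : Fin n → ℝ}
    (hx : x ∈ Ω) : 0 < Metric.infDist x (frontier Ω) := by
  refine (isClosed_frontier.notMem_iff_infDist_pos hne).1 fun h => ?_
  rw [hΩ.frontier_eq] at h
  exact h.2 hx

/-- A convex set missing the frontier is covered by the disjoint open sets `interior Ω` and
`(closure Ω)ᶜ`. Being connected, it lies in one of them. -/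
lemma subset_of_convex_of_disjoint_frontier {B : Set (Fin n → ℝ)} (hB : Convex ℝ B)
    {x : Fin n → ℝ} (hxB : x ∈ B) (hx : x ∈ Ω) (hd : ∀ z ∈ B, z ∉ frontier Ω) : B ⊆ Ω := by
  intro y hy
  by_contra hyΩ
  have hcov : ∀ z ∈ B, z ∈ interior Ω ∨ z ∉ closure Ω := by
    intro z hz
    by_contra! h
    exact hd z hz ⟨h.2, h.1⟩
  obtain ⟨z, -, hz1, hz2⟩ := hB.isPreconnected (interior Ω) (closure Ω)ᶜ isOpen_interior
    isClosed_closure.isOpen_compl hcov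
    ⟨x, hxB, (hcov x hxB).resolve_right fun h => h (subset_closure hx)⟩
    ⟨y, hy, (hcov y hy).resolve_left fun h => hyΩ (interior_subset h)⟩
  exact hz2 (subset_closure (interior_subset hz1))

lemma ball_infDist_subset {x : Fin n → ℝ} (hx : x ∈ Ω) (hpos : 0 < Metric.infDist x (frontier Ω)) :
    Metric.ball x (Metric.infDist x (frontier Ω)) ⊆ Ω := by
  refine subset_of_convex_of_disjoint_frontier (convex_ball _ _) (Metric.mem_ball_self hpos) hx ?_
  intro z hz hzf
  have := Metric.infDist_le_dist_of_mem (x := x) hzf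
  rw [Metric.mem_ball, dist_comm] at hz
  linarith

lemma mem_of_dist_lt_infDist (hΩ : IsOpen Ω) (hne : (frontier Ω).Nonempty) {x y : Fin n → ℝ}
    (hx : x ∈ Ω) (h : dist y x < Metric.infDist x (frontier Ω)) : y ∈ Ω :=
  ball_infDist_subset hx (infDist_frontier_pos hΩ hne hx) h

lemma le_infDist_frontier_of_ball_subset (hΩ : IsOpen Ω) (hne : (frontier Ω).Nonempty)
    {x : Fin n → ℝ} {r : ℝ} (h : Metric.ball x r ⊆ Ω) : r ≤ Metric.infDist x (frontier Ω) := by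
  refine (Metric.le_infDist hne).2 fun {z} hz => ?_
  by_contra hlt
  rw [hΩ.frontier_eq] at hz
  exact hz.2 (h (by rw [Metric.mem_ball, dist_comm]; linarith))

/-- The segment stays at distance at least half of the initial one from the boundary, so the linear
lower bound of `subhypEDist_le_of_segment` holds with that half as slope. -/
lemma subhypEDist_le_of_close (hΩ : IsOpen Ω) (hne : (frontier Ω).Nonempty) (hα : 0 < α)
    (hα1 : α ≤ 1) {x y : Fin n → ℝ} (hx : x ∈ Ω)
    (h : dist y x ≤ Metric.infDist x (frontier Ω) / 2) :
    subhypEDist Ω α x y ≤ ENNReal.ofReal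
      (Real.sqrt n / α * ‖y - x‖ * (Metric.infDist x (frontier Ω) / 2) ^ (α - 1)) := by
  have hpos := infDist_frontier_pos hΩ hne hx
  have hdl : ∀ t ∈ Set.Icc (0 : ℝ) 1, dist (AffineMap.lineMap x y t : Fin n → ℝ) x ≤
      Metric.infDist x (frontier Ω) / 2 := by
    intro t ht
    rw [dist_lineMap_left, Real.norm_eq_abs, abs_of_nonneg ht.1, dist_comm x y]
    exact (mul_le_of_le_one_left dist_nonneg ht.2).trans h
  refine subhypEDist_le_of_segment hα hα1 (by linarith) (fun t ht => ?_) fun t ht => ?_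
  · exact mem_of_dist_lt_infDist hΩ hne hx (by linarith [hdl t ht])
  · have h1 := Metric.infDist_le_infDist_add_dist (s := frontier Ω) (x := x)
      (y := (AffineMap.lineMap x y t : Fin n → ℝ))
    rw [dist_comm] at h1
    have h2 := hdl t ⟨ht.1.le, ht.2⟩
    nlinarith [ht.2]

/-- Points at finite distance from `x`, and points at infinite distance, both form open sets, by the
local bound and the triangle inequality. Finiteness lets the triangle inequality pass to the
real-valued `subhypDist`, where `toReal` would send an infinite distance to zero. -/
lemma subhypEDist_lt_top (hΩ : IsOpen Ω) (hc : IsConnected Ω) (hne : (frontier Ω).Nonempty)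
    (hα : 0 < α) (hα1 : α ≤ 1) {x y : Fin n → ℝ} (hx : x ∈ Ω) (hy : y ∈ Ω) :
    subhypEDist Ω α x y < ⊤ := by
  have hloc : ∀ z ∈ Ω, ∀ w ∈ Metric.ball z (Metric.infDist z (frontier Ω) / 2),
      subhypEDist Ω α z w < ⊤ := fun z hz w hw =>
    (subhypEDist_le_of_close hΩ hne hα hα1 hz (Metric.mem_ball.1 hw).le).trans_lt
      ENNReal.ofReal_lt_top
  have hnb : ∀ z ∈ Ω, Ω ∩ Metric.ball z (Metric.infDist z (frontier Ω) / 2) ∈ 𝓝 z := fun z hz =>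
    inter_mem (hΩ.mem_nhds hz) (Metric.ball_mem_nhds _ (by
      linarith [infDist_frontier_pos hΩ hne hz]))
  set U : Set (Fin n → ℝ) := {z ∈ Ω | subhypEDist Ω α x z < ⊤}
  set V : Set (Fin n → ℝ) := {z ∈ Ω | ¬ subhypEDist Ω α x z < ⊤}
  have hU : IsOpen U := by
    rw [isOpen_iff_mem_nhds]
    rintro z ⟨hz, hxz⟩
    filter_upwards [hnb z hz] with w hw
    exact ⟨hw.1, (subhypEDist_triangle x z w).trans_lt (ENNReal.add_lt_top.2 ⟨hxz, hloc z hz w hw.2⟩)⟩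
  have hV : IsOpen V := by
    rw [isOpen_iff_mem_nhds]
    rintro z ⟨hz, hxz⟩
    filter_upwards [hnb z hz] with w hw
    refine ⟨hw.1, fun hlt => hxz ?_⟩
    refine (subhypEDist_triangle x w z).trans_lt (ENNReal.add_lt_top.2 ⟨hlt, ?_⟩)
    rw [subhypEDist_comm]
    exact hloc z hz w hw.2
  have hxx : subhypEDist Ω α x x < ⊤ :=
    hloc x hx x (Metric.mem_ball_self (by linarith [infDist_frontier_pos hΩ hne hx]))
  by_contra hny
  obtain ⟨z, _, hz1, hz2⟩ := hc.isPreconnected U V hU hV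
    (fun z hz => by
      by_cases h : subhypEDist Ω α x z < ⊤
      · exact Or.inl ⟨hz, h⟩
      · exact Or.inr ⟨hz, h⟩) ⟨x, hx, hx, hxx⟩ ⟨y, hy, hy, hny⟩
  exact hz2.2 hz1.2

end Domain

end SobolevTrace

/-! ### The metric on a proper domain. -/

namespace SobolevTrace

/-- The standing assumptions on a domain and an exponent: `Ω` is open, connected and different from
`∅` and `ℝⁿ`, and `0 < α ≤ 1`. -/
structure IsProperDomain {n : ℕ} (Ω : Set (Fin n → ℝ)) (α : ℝ) : Prop where
  isOpen : IsOpen Ω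
  isConnected : IsConnected Ω
  frontier_nonempty : (frontier Ω).Nonempty
  pos : 0 < α
  le_one : α ≤ 1

section Metric

variable {n : ℕ} {Ω : Set (Fin n → ℝ)} {α : ℝ}

lemma subhypDist_nonneg (x y : Fin n → ℝ) : 0 ≤ subhypDist Ω α x y := ENNReal.toReal_nonneg

lemma subhypDist_comm (x y : Fin n → ℝ) : subhypDist Ω α x y = subhypDist Ω α y x :=
  congrArg ENNReal.toReal (subhypEDist_comm x y)

lemma subhypDist_le_of_le {x y : Fin n → ℝ} {C : ℝ} (hC : 0 ≤ C)
    (h : subhypEDist Ω α x y ≤ ENNReal.ofReal C) : subhypDist Ω α x y ≤ C :=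
  ENNReal.toReal_le_of_le_ofReal hC h

lemma deltaDist_nonneg (x y : Fin n → ℝ) : 0 ≤ deltaDist Ω α x y :=
  add_nonneg (subhypDist_nonneg x y) (Real.rpow_nonneg (norm_nonneg _) _)

lemma deltaDist_comm (x y : Fin n → ℝ) : deltaDist Ω α x y = deltaDist Ω α y x := by
  unfold deltaDist
  rw [subhypDist_comm, norm_sub_rev]

lemma subhypDist_le_deltaDist (x y : Fin n → ℝ) : subhypDist Ω α x y ≤ deltaDist Ω α x y :=
  le_add_of_nonneg_right (Real.rpow_nonneg (norm_nonneg _) _)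

lemma norm_rpow_le_deltaDist (x y : Fin n → ℝ) : ‖x - y‖ ^ α ≤ deltaDist Ω α x y :=
  le_add_of_nonneg_left (subhypDist_nonneg x y)

namespace IsProperDomain

lemma infDist_pos (h : IsProperDomain Ω α)
    {x : Fin n → ℝ} (hx : x ∈ Ω) : 0 < Metric.infDist x (frontier Ω) :=
  infDist_frontier_pos h.isOpen h.frontier_nonempty hx

lemma notMem_of_mem_frontier (h : IsProperDomain Ω α)
    {x : Fin n → ℝ} (hx : x ∈ frontier Ω) : x ∉ Ω := by
  rw [h.isOpen.frontier_eq] at hx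
  exact hx.2

lemma mem_of_dist_lt (h : IsProperDomain Ω α) {x y : Fin n → ℝ} (hx : x ∈ Ω)
    (hd : dist y x < Metric.infDist x (frontier Ω)) : y ∈ Ω :=
  mem_of_dist_lt_infDist h.isOpen h.frontier_nonempty hx hd

lemma subhypDist_triangle (h : IsProperDomain Ω α)
    {x y z : Fin n → ℝ} (hx : x ∈ Ω) (hy : y ∈ Ω) (hz : z ∈ Ω) :
    subhypDist Ω α x z ≤ subhypDist Ω α x y + subhypDist Ω α y z := by
  have h1 := subhypEDist_lt_top h.isOpen h.isConnected h.frontier_nonempty h.pos h.le_one hx hy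
  have h2 := subhypEDist_lt_top h.isOpen h.isConnected h.frontier_nonempty h.pos h.le_one hy hz
  refine (ENNReal.toReal_mono (ENNReal.add_lt_top.2 ⟨h1, h2⟩).ne
    (subhypEDist_triangle x y z)).trans_eq ?_
  exact ENNReal.toReal_add h1.ne h2.ne

lemma subhypDist_le_of_segment (h : IsProperDomain Ω α) {x y : Fin n → ℝ} {m : ℝ} (hm : 0 < m)
    (hΩ : ∀ t ∈ Set.Icc (0 : ℝ) 1, AffineMap.lineMap x y t ∈ Ω)
    (hd : ∀ t ∈ Set.Ioc (0 : ℝ) 1,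
      m * t ≤ Metric.infDist (AffineMap.lineMap x y t) (frontier Ω)) :
    subhypDist Ω α x y ≤ Real.sqrt n / α * ‖y - x‖ * m ^ (α - 1) := by
  have := h.pos
  exact subhypDist_le_of_le (by positivity) (subhypEDist_le_of_segment h.pos h.le_one hm hΩ hd)

lemma subhypDist_le_of_dist_le (h : IsProperDomain Ω α) {x y : Fin n → ℝ} (hx : x ∈ Ω)
    (hd : dist y x ≤ Metric.infDist x (frontier Ω) / 2) :
    subhypDist Ω α x y ≤
      Real.sqrt n / α * ‖y - x‖ * (Metric.infDist x (frontier Ω) / 2) ^ (α - 1) := by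
  have h1 := h.infDist_pos hx
  have := h.pos
  exact subhypDist_le_of_le (by positivity)
    (subhypEDist_le_of_close h.isOpen h.frontier_nonempty h.pos h.le_one hx hd)

/-- A Whitney-size displacement costs at most a multiple of `d ^ α`, which tends to zero along any
sequence approaching the boundary. -/
lemma subhypDist_le_infDist_rpow (h : IsProperDomain Ω α) {x y : Fin n → ℝ} (hx : x ∈ Ω)
    (hd : dist y x ≤ Metric.infDist x (frontier Ω) / 2) :
    subhypDist Ω α x y ≤ Real.sqrt n / α * Metric.infDist x (frontier Ω) ^ α := by
  refine (h.subhypDist_le_of_dist_le hx hd).trans ?_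
  have h1 := h.infDist_pos hx
  have := h.pos
  rw [mul_assoc]
  refine mul_le_mul_of_nonneg_left ?_ (by positivity)
  rw [← dist_eq_norm]
  calc _ ≤ (Metric.infDist x (frontier Ω) / 2) * (Metric.infDist x (frontier Ω) / 2) ^ (α - 1) := by
        gcongr
    _ = (Metric.infDist x (frontier Ω) / 2) ^ α := by
        rw [Real.rpow_sub_one (by positivity)]
        field_simp
    _ ≤ _ := Real.rpow_le_rpow (by positivity) (by linarith) h.pos.le

lemma subhypDist_self (h : IsProperDomain Ω α)
    {x : Fin n → ℝ} (hx : x ∈ Ω) : subhypDist Ω α x x = 0 := by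
  refine le_antisymm ?_ (subhypDist_nonneg _ _)
  have := h.subhypDist_le_of_dist_le (x := x) (y := x) hx (by
    rw [dist_self]; linarith [h.infDist_pos hx])
  simpa using this

lemma deltaDist_self (h : IsProperDomain Ω α)
    {x : Fin n → ℝ} (hx : x ∈ Ω) : deltaDist Ω α x x = 0 := by
  simp [deltaDist, h.subhypDist_self hx, Real.zero_rpow h.pos.ne']

lemma deltaDist_triangle (h : IsProperDomain Ω α)
    {x y z : Fin n → ℝ} (hx : x ∈ Ω) (hy : y ∈ Ω) (hz : z ∈ Ω) :
    deltaDist Ω α x z ≤ deltaDist Ω α x y + deltaDist Ω α y z := by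
  have h1 := h.subhypDist_triangle hx hy hz
  have h2 : ‖x - z‖ ^ α ≤ ‖x - y‖ ^ α + ‖y - z‖ ^ α := by
    refine (Real.rpow_le_rpow (norm_nonneg _) (norm_sub_le_norm_sub_add_norm_sub x y z)
      h.pos.le).trans ?_
    exact Real.rpow_add_le_add_rpow (norm_nonneg _) (norm_nonneg _) h.pos.le h.le_one
  unfold deltaDist
  linarith

/-- Near an interior point the weight is bounded, so both terms of the metric are controlled by the
Euclidean displacement. -/
lemma tendsto_deltaDist_of_mem (h : IsProperDomain Ω α)
    {x : Fin n → ℝ} (hx : x ∈ Ω) {y : ℕ → Fin n → ℝ}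
    (hy : Tendsto y atTop (𝓝 x)) : Tendsto (fun i => deltaDist Ω α x (y i)) atTop (𝓝 0) := by
  have hn : Tendsto (fun i => ‖y i - x‖) atTop (𝓝 0) := tendsto_iff_norm_sub_tendsto_zero.1 hy
  have h1 : Tendsto (fun i => Real.sqrt n / α * ‖y i - x‖ *
      (Metric.infDist x (frontier Ω) / 2) ^ (α - 1) + ‖y i - x‖ ^ α) atTop (𝓝 0) := by
    have := ((hn.const_mul (Real.sqrt n / α)).mul_const
      ((Metric.infDist x (frontier Ω) / 2) ^ (α - 1))).add (hn.rpow_const (Or.inr h.pos.le))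
    simpa [Real.zero_rpow h.pos.ne'] using this
  refine tendsto_of_tendsto_of_tendsto_of_le_of_le' tendsto_const_nhds h1
    (Eventually.of_forall fun i => deltaDist_nonneg _ _) ?_
  have hp := h.infDist_pos hx
  filter_upwards [hn.eventually (gt_mem_nhds (half_pos hp))] with i hi
  unfold deltaDist
  rw [norm_sub_rev x]
  gcongr
  exact h.subhypDist_le_of_dist_le hx (by rw [dist_eq_norm]; exact hi.le)

end IsProperDomain

end Metric

/-! ### The completion, the limit point of a class and the extended metric. -/

section Completion

variable {n : ℕ} {Ω : Set (Fin n → ℝ)} {α : ℝ}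

lemma mem_cauchySeqs {ω : Set (ℕ → Fin n → ℝ)} (hω : ω ∈ completion Ω α) {x : ℕ → Fin n → ℝ}
    (hx : x ∈ ω) : x ∈ cauchySeqs Ω α := by
  obtain ⟨z, _, rfl⟩ := hω
  exact hx.1

namespace IsProperDomain

lemma tendsto_deltaDist_trans (h : IsProperDomain Ω α)
    {x y z : ℕ → Fin n → ℝ} (hx : ∀ i, x i ∈ Ω) (hy : ∀ i, y i ∈ Ω)
    (hz : ∀ i, z i ∈ Ω) (h1 : Tendsto (fun i => deltaDist Ω α (x i) (y i)) atTop (𝓝 0))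
    (h2 : Tendsto (fun i => deltaDist Ω α (y i) (z i)) atTop (𝓝 0)) :
    Tendsto (fun i => deltaDist Ω α (x i) (z i)) atTop (𝓝 0) := by
  refine squeeze_zero (fun i => deltaDist_nonneg _ _)
    (fun i => h.deltaDist_triangle (hx i) (hy i) (hz i)) ?_
  simpa using h1.add h2

lemma cauchySeqs_of_tendsto (h : IsProperDomain Ω α)
    {x y : ℕ → Fin n → ℝ} (hx : x ∈ cauchySeqs Ω α) (hy : ∀ i, y i ∈ Ω)
    (hxy : Tendsto (fun i => deltaDist Ω α (x i) (y i)) atTop (𝓝 0)) : y ∈ cauchySeqs Ω α := by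
  refine ⟨hy, ?_⟩
  have h1 : Tendsto (fun ij : ℕ × ℕ => deltaDist Ω α (x ij.1) (y ij.1)) atTop (𝓝 0) :=
    hxy.comp (by rw [← prod_atTop_atTop_eq]; exact tendsto_fst)
  have h2 : Tendsto (fun ij : ℕ × ℕ => deltaDist Ω α (x ij.2) (y ij.2)) atTop (𝓝 0) :=
    hxy.comp (by rw [← prod_atTop_atTop_eq]; exact tendsto_snd)
  refine squeeze_zero (fun i => deltaDist_nonneg _ _) (fun ij => ?_)
    (by simpa using (h1.add hx.2).add h2)
  have e1 := h.deltaDist_triangle (hy ij.1) (hx.1 ij.1) (hy ij.2)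
  have e2 := h.deltaDist_triangle (hx.1 ij.1) (hx.1 ij.2) (hy ij.2)
  rw [deltaDist_comm (y ij.1) (x ij.1)] at e1
  linarith

lemma mem_seqClass_self (h : IsProperDomain Ω α)
    {x : ℕ → Fin n → ℝ} (hx : x ∈ cauchySeqs Ω α) : x ∈ seqClass Ω α x := by
  refine ⟨hx, ?_⟩
  simp only [h.deltaDist_self (hx.1 _)]
  exact tendsto_const_nhds

lemma seqClass_eq (h : IsProperDomain Ω α)
    {x y : ℕ → Fin n → ℝ} (hx : x ∈ cauchySeqs Ω α) (hy : y ∈ seqClass Ω α x) :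
    seqClass Ω α y = seqClass Ω α x := by
  ext z
  constructor
  · rintro ⟨hz, hyz⟩
    exact ⟨hz, h.tendsto_deltaDist_trans hx.1 hy.1.1 hz.1 hy.2 hyz⟩
  · rintro ⟨hz, hxz⟩
    refine ⟨hz, h.tendsto_deltaDist_trans hy.1.1 hx.1 hz.1 ?_ hxz⟩
    simpa only [deltaDist_comm] using hy.2

lemma nonempty_of_mem (h : IsProperDomain Ω α)
    {ω : Set (ℕ → Fin n → ℝ)} (hω : ω ∈ completion Ω α) : ω.Nonempty := by
  obtain ⟨z, hz, rfl⟩ := hω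
  exact ⟨z, h.mem_seqClass_self hz⟩

lemma eq_seqClass (h : IsProperDomain Ω α)
    {ω : Set (ℕ → Fin n → ℝ)} (hω : ω ∈ completion Ω α) {x : ℕ → Fin n → ℝ}
    (hx : x ∈ ω) : ω = seqClass Ω α x := by
  obtain ⟨z, hz, rfl⟩ := hω
  exact (h.seqClass_eq hz hx).symm

lemma mem_of_tendsto_deltaDist (h : IsProperDomain Ω α)
    {ω : Set (ℕ → Fin n → ℝ)} (hω : ω ∈ completion Ω α)
    {x y : ℕ → Fin n → ℝ} (hx : x ∈ ω) (hy : ∀ i, y i ∈ Ω)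
    (hxy : Tendsto (fun i => deltaDist Ω α (x i) (y i)) atTop (𝓝 0)) : y ∈ ω := by
  have hx' := mem_cauchySeqs hω hx
  rw [h.eq_seqClass hω hx]
  exact ⟨h.cauchySeqs_of_tendsto hx' hy hxy, hxy⟩

lemma tendsto_deltaDist (h : IsProperDomain Ω α) {ω : Set (ℕ → Fin n → ℝ)} (hω : ω ∈ completion Ω α)
    {x y : ℕ → Fin n → ℝ} (hx : x ∈ ω) (hy : y ∈ ω) :
    Tendsto (fun i => deltaDist Ω α (x i) (y i)) atTop (𝓝 0) := by
  rw [h.eq_seqClass hω hx] at hy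
  exact hy.2

/-- The summand `‖x - y‖ ^ α` of the metric forces convergence in `ℝⁿ`. Without it the limit point
of a class would not be available. -/
lemma tendsto_norm_sub_of_deltaDist (h : IsProperDomain Ω α)
    {ι : Type*} {l : Filter ι} {x y : ι → Fin n → ℝ}
    (hxy : Tendsto (fun i => deltaDist Ω α (x i) (y i)) l (𝓝 0)) :
    Tendsto (fun i => ‖x i - y i‖) l (𝓝 0) := by
  have h1 : Tendsto (fun i => ‖x i - y i‖ ^ α) l (𝓝 0) :=
    squeeze_zero (fun i => Real.rpow_nonneg (norm_nonneg _) _)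
      (fun i => norm_rpow_le_deltaDist _ _) hxy
  have h2 := h1.rpow_const (p := 1 / α) (Or.inr (by have := h.pos; positivity))
  rw [Real.zero_rpow (by have := h.pos; positivity)] at h2
  refine h2.congr fun i => ?_
  rw [← Real.rpow_mul (norm_nonneg _), mul_one_div_cancel h.pos.ne', Real.rpow_one]

lemma exists_tendsto (h : IsProperDomain Ω α) {x : ℕ → Fin n → ℝ} (hx : x ∈ cauchySeqs Ω α) :
    ∃ z, Tendsto x atTop (𝓝 z) := by
  refine cauchySeq_tendsto_of_complete ?_
  have h1 := h.tendsto_norm_sub_of_deltaDist (x := fun ij : ℕ × ℕ => x ij.1)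
    (y := fun ij : ℕ × ℕ => x ij.2) hx.2
  rw [cauchySeq_iff_tendsto_dist_atTop_0]
  simpa only [dist_eq_norm] using h1

lemma tendsto_ell (h : IsProperDomain Ω α)
    {ω : Set (ℕ → Fin n → ℝ)} (hω : ω ∈ completion Ω α) {x : ℕ → Fin n → ℝ}
    (hx : x ∈ ω) : Tendsto x atTop (𝓝 (ell ω)) := by
  have hex : ∃ z, ∀ y ∈ ω, Tendsto y atTop (𝓝 z) := by
    obtain ⟨z, hz⟩ := h.exists_tendsto (mem_cauchySeqs hω hx)
    refine ⟨z, fun y hy => ?_⟩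
    have := h.tendsto_norm_sub_of_deltaDist (h.tendsto_deltaDist hω hy hx)
    have h2 := (tendsto_zero_iff_norm_tendsto_zero.2 this).add hz
    simpa using h2
  exact Classical.epsilon_spec hex x hx

lemma ell_eq (h : IsProperDomain Ω α)
    {ω : Set (ℕ → Fin n → ℝ)} (hω : ω ∈ completion Ω α) {x : ℕ → Fin n → ℝ}
    (hx : x ∈ ω) {z : Fin n → ℝ} (hz : Tendsto x atTop (𝓝 z)) : ell ω = z :=
  tendsto_nhds_unique (h.tendsto_ell hω hx) hz

/-- If the limit were in the open set `Ω`, the constant sequence there would lie in the class, since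
convergence in `ℝⁿ` to a point of `Ω` implies convergence in the metric. The class would then be a
point of `Ω`. -/
lemma ell_mem_frontier (h : IsProperDomain Ω α)
    {ω : Set (ℕ → Fin n → ℝ)} (hω : ω ∈ alphaBoundary Ω α) :
    ell ω ∈ frontier Ω := by
  obtain ⟨x, hx⟩ := h.nonempty_of_mem hω.1
  have hxc := mem_cauchySeqs hω.1 hx
  have hlim := h.tendsto_ell hω.1 hx
  rw [h.isOpen.frontier_eq]
  refine ⟨mem_closure_of_tendsto hlim (Eventually.of_forall hxc.1), fun hmem => hω.2 ?_⟩
  refine ⟨ell ω, hmem, ?_⟩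
  have h1 := h.tendsto_deltaDist_of_mem hmem hlim
  have h2 : (fun _ : ℕ => ell ω) ∈ ω :=
    h.mem_of_tendsto_deltaDist hω.1 hx (fun _ => hmem) (by simpa only [deltaDist_comm] using h1)
  exact h.eq_seqClass hω.1 h2

lemma seqClass_mem_alphaBoundary (h : IsProperDomain Ω α)
    {x : ℕ → Fin n → ℝ} (hx : x ∈ cauchySeqs Ω α) {a : Fin n → ℝ}
    (ha : a ∉ Ω) (hlim : Tendsto x atTop (𝓝 a)) : seqClass Ω α x ∈ alphaBoundary Ω α := by
  refine ⟨⟨x, hx, rfl⟩, ?_⟩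
  rintro ⟨z, hz, heq⟩
  have hx' := h.mem_seqClass_self hx
  rw [heq] at hx'
  have h1 := h.tendsto_norm_sub_of_deltaDist hx'.2
  have h2 : Tendsto x atTop (𝓝 z) := by
    rw [tendsto_iff_norm_sub_tendsto_zero]
    simpa only [norm_sub_rev] using h1
  exact ha (tendsto_nhds_unique hlim h2 ▸ hz)

lemma abs_subhypDist_sub_le (h : IsProperDomain Ω α)
    {x y x' y' : Fin n → ℝ} (hx : x ∈ Ω) (hy : y ∈ Ω) (hx' : x' ∈ Ω)
    (hy' : y' ∈ Ω) : |subhypDist Ω α x y - subhypDist Ω α x' y'| ≤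
      deltaDist Ω α x x' + deltaDist Ω α y y' := by
  have a1 := h.subhypDist_triangle hx hx' hy
  have a2 := h.subhypDist_triangle hx' hy' hy
  have a3 := h.subhypDist_triangle hx' hx hy'
  have a4 := h.subhypDist_triangle hx hy hy'
  have b1 := subhypDist_le_deltaDist (Ω := Ω) (α := α) x x'
  have b2 := subhypDist_le_deltaDist (Ω := Ω) (α := α) y y'
  rw [subhypDist_comm y' y] at a2
  rw [subhypDist_comm x' x] at a3
  rw [abs_le]
  constructor <;> linarith

/-- The distance is Lipschitz in its two arguments for the metric of the completion. So the limit
exists and is independent of the representatives, which is what the choice operator in `closureDist`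
requires. -/
lemma tendsto_closureDist (h : IsProperDomain Ω α)
    {ω₁ ω₂ : Set (ℕ → Fin n → ℝ)} (h₁ : ω₁ ∈ completion Ω α)
    (h₂ : ω₂ ∈ completion Ω α) {x y : ℕ → Fin n → ℝ} (hx : x ∈ ω₁) (hy : y ∈ ω₂) :
    Tendsto (fun i => subhypDist Ω α (x i) (y i)) atTop (𝓝 (closureDist Ω α ω₁ ω₂)) := by
  have hex : ∃ d : ℝ, ∀ x ∈ ω₁, ∀ y ∈ ω₂,
      Tendsto (fun i => subhypDist Ω α (x i) (y i)) atTop (𝓝 d) := by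
    have hxc := mem_cauchySeqs h₁ hx
    have hyc := mem_cauchySeqs h₂ hy
    have hc : CauchySeq fun i => subhypDist Ω α (x i) (y i) := by
      rw [cauchySeq_iff_tendsto_dist_atTop_0]
      refine squeeze_zero (fun _ => dist_nonneg) (fun ij => ?_)
        (by simpa using hxc.2.add hyc.2)
      rw [Real.dist_eq]
      exact h.abs_subhypDist_sub_le (hxc.1 _) (hyc.1 _) (hxc.1 _) (hyc.1 _)
    obtain ⟨d, hd⟩ := cauchySeq_tendsto_of_complete hc
    refine ⟨d, fun x' hx' y' hy' => ?_⟩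
    have hxc' := mem_cauchySeqs h₁ hx'
    have hyc' := mem_cauchySeqs h₂ hy'
    have hdiff : Tendsto (fun i => subhypDist Ω α (x' i) (y' i) - subhypDist Ω α (x i) (y i))
        atTop (𝓝 0) := by
      rw [tendsto_zero_iff_norm_tendsto_zero]
      refine squeeze_zero (fun _ => norm_nonneg _)
        (fun i => h.abs_subhypDist_sub_le (hxc'.1 i) (hyc'.1 i) (hxc.1 i) (hyc.1 i)) ?_
      simpa using (h.tendsto_deltaDist h₁ hx' hx).add (h.tendsto_deltaDist h₂ hy' hy)
    simpa using hdiff.add hd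
  exact Classical.epsilon_spec hex x hx y hy

lemma tendsto_infDist_of_mem (h : IsProperDomain Ω α)
    {ω : Set (ℕ → Fin n → ℝ)} (hω : ω ∈ alphaBoundary Ω α)
    {x : ℕ → Fin n → ℝ} (hx : x ∈ ω) :
    Tendsto (fun i => Metric.infDist (x i) (frontier Ω)) atTop (𝓝 0) := by
  have h1 := ((Metric.continuous_infDist_pt (frontier Ω)).tendsto _).comp (h.tendsto_ell hω.1 hx)
  rwa [Metric.infDist_zero_of_mem (h.ell_mem_frontier hω)] at h1

/-- Perturbing each point by at most half its distance to the boundary moves it by `O(d ^ α)` in the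
metric, and `d` tends to zero along a boundary class. -/
lemma mem_of_dist_le_half_infDist (h : IsProperDomain Ω α)
    {ω : Set (ℕ → Fin n → ℝ)} (hω : ω ∈ alphaBoundary Ω α)
    {x y : ℕ → Fin n → ℝ} (hx : x ∈ ω)
    (hy : ∀ i, dist (y i) (x i) ≤ Metric.infDist (x i) (frontier Ω) / 2) : y ∈ ω := by
  have hxc := mem_cauchySeqs hω.1 hx
  have hd := h.tendsto_infDist_of_mem hω hx
  have hdα := hd.rpow_const (p := α) (Or.inr h.pos.le)
  rw [Real.zero_rpow h.pos.ne'] at hdα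
  have hyΩ : ∀ i, y i ∈ Ω := fun i =>
    h.mem_of_dist_lt (hxc.1 i) (by linarith [hy i, h.infDist_pos (hxc.1 i)])
  refine h.mem_of_tendsto_deltaDist hω.1 hx hyΩ ?_
  refine squeeze_zero (fun _ => deltaDist_nonneg _ _) (fun i => ?_)
    (by simpa using (hdα.const_mul (Real.sqrt n / α)).add hdα)
  refine add_le_add (h.subhypDist_le_infDist_rpow (hxc.1 i) (hy i)) ?_
  refine Real.rpow_le_rpow (norm_nonneg _) ?_ h.pos.le
  rw [← dist_eq_norm, dist_comm]
  linarith [hy i, h.infDist_pos (hxc.1 i)]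

end IsProperDomain

end Completion

end SobolevTrace

/-! ### Cones with vertex on the boundary. -/

namespace SobolevTrace

/-- Every point of the open cube `ball x R` is seen from `a` inside `Ω`. -/
def IsStarBall {n : ℕ} (Ω : Set (Fin n → ℝ)) (a x : Fin n → ℝ) (R : ℝ) : Prop :=
  ∀ y ∈ Metric.ball x R, ∀ t ∈ Set.Ioc (0 : ℝ) 1, AffineMap.lineMap a y t ∈ Ω

section StarBall

variable {n : ℕ} {Ω : Set (Fin n → ℝ)} {α : ℝ}

lemma QVisible.isStarBall {Q : Cube n} {a : Fin n → ℝ} (h : QVisible Ω Q a) :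
    IsStarBall Ω a Q.center Q.radius :=
  fun y hy t ht => h.2 y (Metric.ball_subset_closedBall hy) t ht

lemma tendsto_lineMap_vertex {a x : Fin n → ℝ} {R : ℝ} {y : ℕ → Fin n → ℝ} {s : ℕ → ℝ}
    (hy : ∀ i, dist (y i) x ≤ R) (hs0 : Tendsto s atTop (𝓝 0)) :
    Tendsto (fun i => (AffineMap.lineMap a (y i) (s i) : Fin n → ℝ)) atTop (𝓝 a) := by
  rw [tendsto_iff_dist_tendsto_zero]
  have : Tendsto (fun i => |s i| * (dist a x + R)) atTop (𝓝 0) := by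
    simpa using (hs0.abs.mul_const (dist a x + R))
  refine squeeze_zero (fun _ => dist_nonneg) (fun i => ?_) this
  rw [dist_lineMap_left, Real.norm_eq_abs]
  refine mul_le_mul_of_nonneg_left ?_ (abs_nonneg _)
  have := dist_triangle a x (y i)
  rw [dist_comm x] at this
  linarith [hy i]

namespace IsProperDomain

/-- The homothety with centre `a` and ratio `t` carries the ball of radius `R - dist y x` around `y`
into `Ω`. -/
lemma mul_le_infDist_lineMap (h : IsProperDomain Ω α)
    {a x y : Fin n → ℝ} {R t : ℝ} (hs : IsStarBall Ω a x R)
    (ht : t ∈ Set.Ioc (0 : ℝ) 1) :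
    t * (R - dist y x) ≤ Metric.infDist (AffineMap.lineMap a y t) (frontier Ω) := by
  refine le_infDist_frontier_of_ball_subset h.isOpen h.frontier_nonempty fun z hz => ?_
  have ht0 : t ≠ 0 := ht.1.ne'
  set w : Fin n → ℝ := a + t⁻¹ • (z - a) with hw
  have hzw : z = AffineMap.lineMap a w t := by
    simp [AffineMap.lineMap_apply, hw, smul_smul, ht0]
  rw [hzw]
  refine hs w ?_ t ht
  have h1 : dist z (AffineMap.lineMap a y t) = t * dist w y := by
    rw [hzw, dist_eq_norm, dist_eq_norm, AffineMap.lineMap_apply, AffineMap.lineMap_apply]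
    have : (t • (w -ᵥ a) +ᵥ a : Fin n → ℝ) - (t • (y -ᵥ a) +ᵥ a) = t • (w - y) := by
      simp only [vsub_eq_sub, vadd_eq_add]
      rw [add_sub_add_right_eq_sub, ← smul_sub, sub_sub_sub_cancel_right]
    rw [this, norm_smul, Real.norm_eq_abs, abs_of_pos ht.1]
  rw [Metric.mem_ball, h1] at hz
  have h2 := lt_of_mul_lt_mul_left hz ht.1.le
  rw [Metric.mem_ball]
  linarith [dist_triangle w y x]

/-- Along a ray of the cone the distance to the boundary grows at least linearly from the vertex.
The integral of `τ ^ (α - 1)` over `(0, t)` then gives the factor `t ^ α`. -/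
lemma subhypDist_lineMap_le_of_le (h : IsProperDomain Ω α)
    {a x y : Fin n → ℝ} {R ρ L s t : ℝ} (hs : IsStarBall Ω a x R)
    (hρ : 0 < ρ) (hy : dist y x ≤ R - ρ) (hL : dist a x + R ≤ L) (hs0 : 0 < s) (hst : s ≤ t)
    (ht1 : t ≤ 1) :
    subhypDist Ω α (AffineMap.lineMap a y s) (AffineMap.lineMap a y t) ≤
      Real.sqrt n / α * (L * ρ ^ (α - 1)) * t ^ α := by
  have hα := h.pos
  have ht0 : 0 < t := hs0.trans_le hst
  have hcomb : ∀ τ : ℝ, (AffineMap.lineMap (AffineMap.lineMap a y s : Fin n → ℝ)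
      (AffineMap.lineMap a y t) τ : Fin n → ℝ) = AffineMap.lineMap a y (s + τ * (t - s)) := by
    intro τ
    ext i
    simp [AffineMap.lineMap_apply]
    ring
  have hmem : ∀ τ ∈ Set.Icc (0 : ℝ) 1, s + τ * (t - s) ∈ Set.Ioc (0 : ℝ) 1 := by
    intro τ hτ
    constructor
    · nlinarith [hτ.1, hτ.2]
    · nlinarith [hτ.1, hτ.2]
  have hyball : y ∈ Metric.ball x R := by
    rw [Metric.mem_ball]; linarith
  refine (h.subhypDist_le_of_segment (m := ρ * t) (by positivity) (fun τ hτ => ?_)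
    (fun τ hτ => ?_)).trans ?_
  · rw [hcomb]
    exact hs y hyball _ (hmem τ hτ)
  · rw [hcomb]
    have hm := hmem τ ⟨hτ.1.le, hτ.2⟩
    refine le_trans ?_ (h.mul_le_infDist_lineMap hs hm)
    -- The ray parameter dominates `t * τ`, so the slope `ρ * t` works uniformly in `s`, and the
    -- bound does not degenerate as `s` tends to `0`.
    have h1 : t * τ ≤ s + τ * (t - s) := by nlinarith [hτ.2]
    have h2 : ρ ≤ R - dist y x := by linarith
    calc ρ * t * τ = (t * τ) * ρ := by ring
      _ ≤ (s + τ * (t - s)) * (R - dist y x) := by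
        refine mul_le_mul h1 h2 hρ.le ?_
        linarith [hm.1]
  · have hn : ‖(AffineMap.lineMap a y t : Fin n → ℝ) - AffineMap.lineMap a y s‖ ≤ t * L := by
      rw [← dist_eq_norm, dist_lineMap_lineMap, Real.dist_eq, abs_of_nonneg (by linarith)]
      refine mul_le_mul (by linarith) ?_ dist_nonneg ht0.le
      have := dist_triangle a x y
      rw [dist_comm x y] at this
      linarith
    calc _ ≤ Real.sqrt n / α * (t * L) * (ρ * t) ^ (α - 1) := by gcongr
      _ = _ := by
        rw [Real.mul_rpow hρ.le ht0.le, Real.rpow_sub_one ht0.ne']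
        field_simp

/-- A cross-section of the cone at level `t` has diameter `O(t)` and stays at distance at least `ρ *
t` from the boundary, so crossing it costs `O(t ^ α)`. -/
lemma subhypDist_lineMap_lineMap_le (h : IsProperDomain Ω α) {a x y z : Fin n → ℝ} {R ρ L t : ℝ}
    (hs : IsStarBall Ω a x R) (hρ : 0 < ρ) (hy : dist y x ≤ R - ρ) (hz : dist z x ≤ R - ρ)
    (hL : 2 * R ≤ L) (ht : t ∈ Set.Ioc (0 : ℝ) 1) :
    subhypDist Ω α (AffineMap.lineMap a y t) (AffineMap.lineMap a z t) ≤
      Real.sqrt n / α * (L * ρ ^ (α - 1)) * t ^ α := by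
  have hα := h.pos
  have hcomb : ∀ τ : ℝ, (AffineMap.lineMap (AffineMap.lineMap a y t : Fin n → ℝ)
      (AffineMap.lineMap a z t) τ : Fin n → ℝ) =
        AffineMap.lineMap a (AffineMap.lineMap y z τ : Fin n → ℝ) t := by
    intro τ
    ext i
    simp [AffineMap.lineMap_apply]
    ring
  have hball : ∀ τ ∈ Set.Icc (0 : ℝ) 1,
      dist (AffineMap.lineMap y z τ : Fin n → ℝ) x ≤ R - ρ := fun τ hτ =>
    Metric.mem_closedBall.1 ((convex_closedBall x (R - ρ)).lineMap_mem hy hz hτ)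
  refine (h.subhypDist_le_of_segment (m := ρ * t) (mul_pos hρ ht.1) (fun τ hτ => ?_)
    (fun τ hτ => ?_)).trans ?_
  · rw [hcomb]
    refine hs _ ?_ t ht
    rw [Metric.mem_ball]
    linarith [hball τ hτ]
  · rw [hcomb]
    refine le_trans ?_ (h.mul_le_infDist_lineMap hs ht)
    have h2 : ρ ≤ R - dist (AffineMap.lineMap y z τ : Fin n → ℝ) x := by
      linarith [hball τ ⟨hτ.1.le, hτ.2⟩]
    calc ρ * t * τ ≤ ρ * t * 1 := by
          refine mul_le_mul_of_nonneg_left hτ.2 (mul_nonneg hρ.le ht.1.le)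
      _ = t * ρ := by ring
      _ ≤ _ := mul_le_mul_of_nonneg_left h2 ht.1.le
  · have hn : ‖(AffineMap.lineMap a z t : Fin n → ℝ) - AffineMap.lineMap a y t‖ ≤ t * L := by
      have : (AffineMap.lineMap a z t : Fin n → ℝ) - AffineMap.lineMap a y t = t • (z - y) := by
        ext i
        simp [AffineMap.lineMap_apply]
        ring
      rw [this, norm_smul, Real.norm_eq_abs, abs_of_pos ht.1]
      refine mul_le_mul_of_nonneg_left ?_ ht.1.le
      rw [← dist_eq_norm]
      have := dist_triangle z x y
      rw [dist_comm x y] at this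
      linarith
    have ht0 := ht.1
    calc _ ≤ Real.sqrt n / α * (t * L) * (ρ * t) ^ (α - 1) := by gcongr
      _ = _ := by
        rw [Real.mul_rpow hρ.le ht0.le, Real.rpow_sub_one ht0.ne']
        field_simp

/-- Points of a cone with vertex `a` are close to each other near the vertex. -/
lemma subhypDist_cone_le (h : IsProperDomain Ω α)
    {a x y z : Fin n → ℝ} {R ρ L s t : ℝ} (hst : IsStarBall Ω a x R)
    (hρ : 0 < ρ) (hy : dist y x ≤ R - ρ) (hz : dist z x ≤ R - ρ) (hL : dist a x + R ≤ L)
    (hL' : 2 * R ≤ L) (hs : s ∈ Set.Ioc (0 : ℝ) 1) (ht : t ∈ Set.Ioc (0 : ℝ) 1) :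
    subhypDist Ω α (AffineMap.lineMap a y s) (AffineMap.lineMap a z t) ≤
      2 * (Real.sqrt n / α * (L * ρ ^ (α - 1))) * max s t ^ α := by
  have key : ∀ (y z : Fin n → ℝ) (s t : ℝ), dist y x ≤ R - ρ → dist z x ≤ R - ρ →
      s ∈ Set.Ioc (0 : ℝ) 1 → t ∈ Set.Ioc (0 : ℝ) 1 → s ≤ t →
      subhypDist Ω α (AffineMap.lineMap a y s) (AffineMap.lineMap a z t) ≤
      2 * (Real.sqrt n / α * (L * ρ ^ (α - 1))) * t ^ α := by
    intro y z s t hy hz hs ht hle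
    have hyb : y ∈ Metric.ball x R := by rw [Metric.mem_ball]; linarith
    have hzb : z ∈ Metric.ball x R := by rw [Metric.mem_ball]; linarith
    have h1 := h.subhypDist_triangle (hst y hyb s hs) (hst y hyb t ht) (hst z hzb t ht)
    have h2 := h.subhypDist_lineMap_le_of_le hst hρ hy hL hs.1 hle ht.2
    have h3 := h.subhypDist_lineMap_lineMap_le hst hρ hy hz hL' ht
    linarith
  rcases le_total s t with hle | hle
  · rw [max_eq_right hle]
    exact key y z s t hy hz hs ht hle
  · rw [max_eq_left hle, subhypDist_comm]
    exact key z y t s hz hy ht hs hle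

/-- The filter is arbitrary because the statement serves both for the Cauchy property, over pairs of
indices, and for the equivalence of two sequences. -/
lemma tendsto_deltaDist_cone (h : IsProperDomain Ω α)
    {ι : Type*} {l : Filter ι} {a x : Fin n → ℝ} {R ρ : ℝ}
    (hst : IsStarBall Ω a x R) (hρ : 0 < ρ) {y z : ι → Fin n → ℝ} {s t : ι → ℝ}
    (hy : ∀ i, dist (y i) x ≤ R - ρ) (hz : ∀ i, dist (z i) x ≤ R - ρ)
    (hs : ∀ i, s i ∈ Set.Ioc (0 : ℝ) 1) (ht : ∀ i, t i ∈ Set.Ioc (0 : ℝ) 1)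
    (hs0 : Tendsto s l (𝓝 0)) (ht0 : Tendsto t l (𝓝 0)) :
    Tendsto (fun i => deltaDist Ω α (AffineMap.lineMap a (y i) (s i))
      (AffineMap.lineMap a (z i) (t i))) l (𝓝 0) := by
  have hα := h.pos
  by_cases hne : Nonempty ι
  swap
  · rw [not_nonempty_iff] at hne
    have : l = ⊥ := Filter.filter_eq_bot_of_isEmpty l
    rw [this]
    exact tendsto_bot
  obtain ⟨i₀⟩ := hne
  have hR : 0 ≤ R := by linarith [hy i₀, dist_nonneg (x := y i₀) (y := x)]
  set L := dist a x + 2 * R with hL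
  have hmax : Tendsto (fun i => max (s i) (t i)) l (𝓝 0) := by simpa using hs0.max ht0
  have hmaxα := hmax.rpow_const (p := α) (Or.inr hα.le)
  rw [Real.zero_rpow hα.ne'] at hmaxα
  have hnorm : ∀ (u : Fin n → ℝ) (τ : ℝ), dist u x ≤ R - ρ → τ ∈ Set.Ioc (0 : ℝ) 1 →
      dist (AffineMap.lineMap a u τ : Fin n → ℝ) a ≤ τ * L := by
    intro u τ hu hτ
    rw [dist_lineMap_left, Real.norm_eq_abs, abs_of_pos hτ.1]
    refine mul_le_mul_of_nonneg_left ?_ hτ.1.le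
    have := dist_triangle a x u
    rw [dist_comm x u] at this
    linarith
  have hdist : Tendsto (fun i => (s i * L + t i * L) ^ α) l (𝓝 0) := by
    have := ((hs0.mul_const L).add (ht0.mul_const L)).rpow_const (p := α) (Or.inr hα.le)
    simpa [Real.zero_rpow hα.ne'] using this
  refine squeeze_zero (fun _ => deltaDist_nonneg _ _) (fun i => ?_)
    (by simpa using (hmaxα.const_mul (2 * (Real.sqrt n / α * (L * ρ ^ (α - 1))))).add hdist)
  refine add_le_add (h.subhypDist_cone_le hst hρ (hy i) (hz i) (by linarith)
    (by linarith [dist_nonneg (x := a) (y := x)]) (hs i) (ht i)) ?_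
  refine Real.rpow_le_rpow (norm_nonneg _) ?_ hα.le
  rw [← dist_eq_norm]
  refine (dist_triangle_right _ _ a).trans ?_
  exact add_le_add (hnorm _ _ (hy i) (hs i)) (hnorm _ _ (hz i) (ht i))

lemma cone_mem_cauchySeqs (h : IsProperDomain Ω α) {a x : Fin n → ℝ} {R ρ : ℝ}
    (hst : IsStarBall Ω a x R) (hρ : 0 < ρ) {y : ℕ → Fin n → ℝ} {s : ℕ → ℝ}
    (hy : ∀ i, dist (y i) x ≤ R - ρ) (hs : ∀ i, s i ∈ Set.Ioc (0 : ℝ) 1)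
    (hs0 : Tendsto s atTop (𝓝 0)) :
    (fun i => (AffineMap.lineMap a (y i) (s i) : Fin n → ℝ)) ∈ cauchySeqs Ω α := by
  refine ⟨fun i => hst _ ?_ _ (hs i), ?_⟩
  · rw [Metric.mem_ball]; linarith [hy i]
  · have h1 : Tendsto (fun ij : ℕ × ℕ => s ij.1) atTop (𝓝 0) :=
      hs0.comp (by rw [← prod_atTop_atTop_eq]; exact tendsto_fst)
    have h2 : Tendsto (fun ij : ℕ × ℕ => s ij.2) atTop (𝓝 0) :=
      hs0.comp (by rw [← prod_atTop_atTop_eq]; exact tendsto_snd)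
    exact h.tendsto_deltaDist_cone hst hρ (y := fun ij : ℕ × ℕ => y ij.1)
      (z := fun ij : ℕ × ℕ => y ij.2) (fun ij => hy ij.1) (fun ij => hy ij.2)
      (fun ij => hs ij.1) (fun ij => hs ij.2) h1 h2

/-- All sequences converging to the vertex of a cone inside the cone belong to the same class. -/
lemma cone_mem_of_cone_mem (h : IsProperDomain Ω α)
    {ω : Set (ℕ → Fin n → ℝ)} (hω : ω ∈ completion Ω α)
    {a x : Fin n → ℝ} {R ρ : ℝ} (hst : IsStarBall Ω a x R) (hρ : 0 < ρ)
    {y z : ℕ → Fin n → ℝ} {s t : ℕ → ℝ}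
    (hy : ∀ i, dist (y i) x ≤ R - ρ) (hz : ∀ i, dist (z i) x ≤ R - ρ)
    (hs : ∀ i, s i ∈ Set.Ioc (0 : ℝ) 1) (ht : ∀ i, t i ∈ Set.Ioc (0 : ℝ) 1)
    (hs0 : Tendsto s atTop (𝓝 0)) (ht0 : Tendsto t atTop (𝓝 0))
    (hmem : (fun i => (AffineMap.lineMap a (y i) (s i) : Fin n → ℝ)) ∈ ω) :
    (fun i => (AffineMap.lineMap a (z i) (t i) : Fin n → ℝ)) ∈ ω := by
  refine h.mem_of_tendsto_deltaDist hω hmem (fun i => hst _ ?_ _ (ht i))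
    (h.tendsto_deltaDist_cone hst hρ hy hz hs ht hs0 ht0)
  rw [Metric.mem_ball]; linarith [hz i]

/-- The sequences of points of the central half of the cone belong to a visible element. -/
lemma cone_mem_of_alphaVisible (h : IsProperDomain Ω α)
    {ω : Set (ℕ → Fin n → ℝ)} (hω : ω ∈ alphaBoundary Ω α)
    {Q : Cube n} (hv : AlphaVisible Ω Q ω) {z : ℕ → Fin n → ℝ} {t : ℕ → ℝ}
    (hz : ∀ i, dist (z i) Q.center ≤ Q.radius / 2)
    (ht : ∀ i, t i ∈ Set.Ioc (0 : ℝ) 1) (ht0 : Tendsto t atTop (𝓝 0)) :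
    (fun i => (AffineMap.lineMap (ell ω) (z i) (t i) : Fin n → ℝ)) ∈ ω := by
  obtain ⟨hq, y, hyω, hy⟩ := hv
  choose s hs hys using hy
  have hr := Q.radius_pos
  have hdpos : 0 < dist (ell ω) Q.center := by
    rw [dist_pos]
    intro heq
    refine h.notMem_of_mem_frontier (h.ell_mem_frontier hω) ?_
    have := hq.2 Q.center (Metric.mem_closedBall_self hr.le) 1 ⟨one_pos, le_rfl⟩
    rw [AffineMap.lineMap_apply_one] at this
    rwa [heq]
  -- The points converge to the vertex and their distance to it is `s i` times a positive constant,
  -- so the parameters tend to zero.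
  have hs0 : Tendsto s atTop (𝓝 0) := by
    have h1 := tendsto_iff_dist_tendsto_zero.1 (h.tendsto_ell hω.1 hyω)
    have h2 := h1.mul_const (dist (ell ω) Q.center)⁻¹
    rw [zero_mul] at h2
    refine h2.congr fun i => ?_
    rw [hys i, dist_lineMap_left, Real.norm_eq_abs, abs_of_pos (hs i).1]
    field_simp
  have hyeq : y = fun i => (AffineMap.lineMap (ell ω) Q.center (s i) : Fin n → ℝ) := funext hys
  rw [hyeq] at hyω
  refine h.cone_mem_of_cone_mem hω.1 hq.isStarBall (half_pos hr) (y := fun _ => Q.center)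
    (fun i => by rw [dist_self]; linarith) (fun i => by linarith [hz i]) hs ht hs0 ht0 hyω

end IsProperDomain

end StarBall

/-! ### Nearest boundary points and the elements they define. -/

section Nearest

variable {n : ℕ} {Ω : Set (Fin n → ℝ)} {α : ℝ}

lemma bddBelow_image2_dist (A B : Set (Fin n → ℝ)) : BddBelow (Set.image2 dist A B) :=
  ⟨0, by rintro _ ⟨a, _, b, _, rfl⟩; exact dist_nonneg⟩

lemma setDist_nonneg (A B : Set (Fin n → ℝ)) : 0 ≤ setDist A B :=
  Real.sInf_nonneg (by rintro _ ⟨a, _, b, _, rfl⟩; exact dist_nonneg)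

lemma setDist_le_dist {A B : Set (Fin n → ℝ)} {a b : Fin n → ℝ} (ha : a ∈ A) (hb : b ∈ B) :
    setDist A B ≤ dist a b :=
  csInf_le (bddBelow_image2_dist A B) ⟨a, ha, b, hb, rfl⟩

lemma Cube.toSet_nonempty (Q : Cube n) : Q.toSet.Nonempty :=
  ⟨Q.center, Metric.mem_closedBall_self Q.radius_pos.le⟩

lemma setDist_le_infDist {Q : Cube n} {B : Set (Fin n → ℝ)} {a : Fin n → ℝ} (ha : a ∈ Q.toSet)
    (hB : B.Nonempty) : setDist Q.toSet B ≤ Metric.infDist a B :=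
  (Metric.le_infDist hB).2 fun _ hb => setDist_le_dist ha hb

lemma setDist_le_infDist_left {Q : Cube n} {B : Set (Fin n → ℝ)} {b : Fin n → ℝ} (hb : b ∈ B) :
    setDist Q.toSet B ≤ Metric.infDist b Q.toSet :=
  (Metric.le_infDist Q.toSet_nonempty).2 fun _ ha => by
    rw [dist_comm]; exact setDist_le_dist ha hb

/-- Two opposite corners realise the diameter. A coordinate must exist, hence `1 ≤ n`. -/
lemma Cube.diam_eq (hn : 1 ≤ n) (Q : Cube n) : Q.diam = 2 * Q.radius := by
  refine le_antisymm (Metric.diam_closedBall Q.radius_pos.le) ?_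
  have hne : (Function.const (Fin n) Q.radius) = fun _ => Q.radius := rfl
  have h1 : dist (Q.center + fun _ => Q.radius) (Q.center - fun _ => Q.radius) ≤ Q.diam := by
    refine Metric.dist_le_diam_of_mem Metric.isBounded_closedBall ?_ ?_
    · rw [Cube.toSet, Metric.mem_closedBall, dist_eq_norm, add_sub_cancel_left]
      exact (pi_norm_const_le _).trans_eq (by rw [Real.norm_eq_abs, abs_of_pos Q.radius_pos])
    · rw [Cube.toSet, Metric.mem_closedBall, dist_eq_norm, sub_sub_cancel_left, norm_neg]
      exact (pi_norm_const_le _).trans_eq (by rw [Real.norm_eq_abs, abs_of_pos Q.radius_pos])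
  refine le_trans ?_ h1
  have h2 := dist_le_pi_dist (Q.center + fun _ => Q.radius) (Q.center - fun _ => Q.radius)
    (⟨0, hn⟩ : Fin n)
  refine le_trans ?_ h2
  rw [Real.dist_eq]
  simp only [Pi.add_apply, Pi.sub_apply]
  refine le_trans (le_of_eq ?_) (le_abs_self _)
  ring

lemma exists_isNearestBoundaryPoint (hne : (frontier Ω).Nonempty) (Q : Cube n) :
    ∃ a, IsNearestBoundaryPoint Ω Q a := by
  obtain ⟨a, ha, hmin⟩ := isClosed_frontier.exists_infDist_eq_dist hne Q.center
  obtain ⟨x, hx, hxmin⟩ := (isCompact_closedBall Q.center Q.radius).exists_isMinOn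
    Q.toSet_nonempty (Metric.continuous_infDist_pt (frontier Ω)).continuousOn
  obtain ⟨b, hb, hxb⟩ := isClosed_frontier.exists_infDist_eq_dist hne x
  refine ⟨b, hb, le_antisymm ?_ (setDist_le_infDist_left hb)⟩
  refine le_csInf (Q.toSet_nonempty.image2 hne) ?_
  rintro _ ⟨y, hy, c, hc, rfl⟩
  calc Metric.infDist b Q.toSet ≤ dist b x := Metric.infDist_le_dist_of_mem hx
    _ = Metric.infDist x (frontier Ω) := by rw [hxb, dist_comm]
    _ ≤ Metric.infDist y (frontier Ω) := hxmin hy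
    _ ≤ dist y c := Metric.infDist_le_dist_of_mem hc

/-- The distance from a point outside of a cube to the cube. -/
lemma dist_center_sub_radius_le_infDist (Q : Cube n) (a : Fin n → ℝ) :
    dist a Q.center - Q.radius ≤ Metric.infDist a Q.toSet :=
  (Metric.le_infDist Q.toSet_nonempty).2 fun {y} hy => by
    have := Metric.mem_closedBall.1 hy
    linarith [dist_triangle a y Q.center]

lemma infDist_cube_le (Q : Cube n) {a : Fin n → ℝ} (h : Q.radius ≤ dist a Q.center) :
    Metric.infDist a Q.toSet ≤ dist a Q.center - Q.radius := by
  have hr := Q.radius_pos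
  have hd : 0 < dist a Q.center := hr.trans_le h
  set t := Q.radius / dist a Q.center with ht
  have ht1 : t ≤ 1 := (div_le_one hd).2 h
  have htp : 0 < t := div_pos hr hd
  have hmem : (AffineMap.lineMap Q.center a t : Fin n → ℝ) ∈ Q.toSet := by
    rw [Cube.toSet, Metric.mem_closedBall, dist_lineMap_left, Real.norm_eq_abs, abs_of_pos htp,
      dist_comm Q.center, ht, div_mul_cancel₀ _ hd.ne']
  refine (Metric.infDist_le_dist_of_mem hmem).trans_eq ?_
  rw [dist_comm, dist_lineMap_right, Real.norm_eq_abs, abs_of_nonneg (by linarith),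
    dist_comm Q.center, sub_mul, ht, div_mul_cancel₀ _ hd.ne', one_mul]

/-- In the uniform norm, the points at distance less than `δ` from a cube of radius `r` form the
open concentric cube of radius `r + δ`. With `δ` the distance to the frontier, that cube contains no
frontier point. -/
lemma ball_setDist_subset (hΩ : IsOpen Ω) {Q : Cube n} (hQ : Q.toSet ⊆ Ω) :
    Metric.ball Q.center (Q.radius + setDist Q.toSet (frontier Ω)) ⊆ Ω := by
  have hc : Q.center ∈ Q.toSet := Metric.mem_closedBall_self Q.radius_pos.le
  refine subset_of_convex_of_disjoint_frontier (convex_ball _ _) (Metric.mem_ball_self ?_)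
    (hQ hc) fun z hz hzf => ?_
  · linarith [Q.radius_pos, setDist_nonneg Q.toSet (frontier Ω)]
  · have hzQ : Q.radius ≤ dist z Q.center := by
      by_contra! hlt
      rw [hΩ.frontier_eq] at hzf
      exact hzf.2 (hQ (Metric.mem_closedBall.2 hlt.le))
    have h1 := infDist_cube_le Q hzQ
    have h2 := setDist_le_infDist_left (Q := Q) hzf
    rw [Metric.mem_ball] at hz
    linarith

lemma IsNearestBoundaryPoint.dist_center (hΩ : IsOpen Ω) {Q : Cube n} (hQ : Q.toSet ⊆ Ω)
    {a : Fin n → ℝ} (ha : IsNearestBoundaryPoint Ω Q a) :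
    dist a Q.center = Q.radius + setDist Q.toSet (frontier Ω) := by
  have haQ : Q.radius ≤ dist a Q.center := by
    by_contra! hlt
    have := ha.1
    rw [hΩ.frontier_eq] at this
    exact this.2 (hQ (Metric.mem_closedBall.2 hlt.le))
  have h1 := infDist_cube_le Q haQ
  have h2 := dist_center_sub_radius_le_infDist Q a
  rw [ha.2] at h1 h2
  linarith

/-- The nearest point lies on the surface of the enlarged cube of `ball_setDist_subset`, so by
convexity its segments to interior points enter that cube at once. Visibility thus holds from the
whole enlarged cube, which is what lets neighbouring cubes share visible elements. -/
lemma IsNearestBoundaryPoint.isStarBall (hΩ : IsOpen Ω) {Q : Cube n} (hQ : Q.toSet ⊆ Ω)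
    {a : Fin n → ℝ} (ha : IsNearestBoundaryPoint Ω Q a) :
    IsStarBall Ω a Q.center (Q.radius + setDist Q.toSet (frontier Ω)) := by
  intro y hy t ht
  refine ball_setDist_subset hΩ hQ ?_
  set R := Q.radius + setDist Q.toSet (frontier Ω)
  have ha' := ha.dist_center hΩ hQ
  rw [Metric.mem_ball] at hy ⊢
  have hx : Q.center = AffineMap.lineMap Q.center Q.center t := by simp
  calc dist (AffineMap.lineMap a y t : Fin n → ℝ) Q.center
      = dist (AffineMap.lineMap a y t : Fin n → ℝ) (AffineMap.lineMap Q.center Q.center t) := by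
        rw [← hx]
    _ ≤ (1 - t) * dist a Q.center + t * dist y Q.center := by
        rw [dist_eq_norm, dist_eq_norm, dist_eq_norm]
        have : (AffineMap.lineMap a y t : Fin n → ℝ) - AffineMap.lineMap Q.center Q.center t =
            (1 - t) • (a - Q.center) + t • (y - Q.center) := by
          ext i
          simp [AffineMap.lineMap_apply]
          ring
        rw [this]
        refine (norm_add_le _ _).trans_eq ?_
        rw [norm_smul, norm_smul, Real.norm_eq_abs, Real.norm_eq_abs, abs_of_pos ht.1,
          abs_of_nonneg (by linarith [ht.2])]
    _ < R := by
        rw [ha']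
        nlinarith [ht.1, ht.2]

lemma visibleElement_eq (Q : Cube n) (a : Fin n → ℝ) :
    visibleElement Ω α Q a =
      seqClass Ω α fun i : ℕ => AffineMap.lineMap a Q.center (1 / ((i : ℝ) + 1)) := by
  unfold visibleElement
  congr 1
  ext i : 1
  rw [AffineMap.lineMap_apply, vsub_eq_sub, vadd_eq_add, add_comm]

lemma one_div_succ_mem_Ioc (i : ℕ) : (1 / ((i : ℝ) + 1)) ∈ Set.Ioc (0 : ℝ) 1 := by
  have : (0 : ℝ) < i + 1 := by positivity
  refine ⟨by positivity, ?_⟩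
  rw [div_le_one this]
  linarith [Nat.cast_nonneg (α := ℝ) i]

namespace IsProperDomain

lemma nearest_mem_cauchySeqs (h : IsProperDomain Ω α) {Q : Cube n} (hQ : Q.toSet ⊆ Ω)
    {a : Fin n → ℝ} (ha : IsNearestBoundaryPoint Ω Q a) :
    (fun i : ℕ => (AffineMap.lineMap a Q.center (1 / ((i : ℝ) + 1)) : Fin n → ℝ)) ∈
      cauchySeqs Ω α := by
  refine h.cone_mem_cauchySeqs (ha.isStarBall h.isOpen hQ) Q.radius_pos (y := fun _ => Q.center)
    (fun i => ?_) one_div_succ_mem_Ioc tendsto_one_div_add_atTop_nhds_zero_nat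
  rw [dist_self]
  linarith [setDist_nonneg Q.toSet (frontier Ω)]

lemma visibleElement_mem (h : IsProperDomain Ω α) {Q : Cube n} (hQ : Q.toSet ⊆ Ω)
    {a : Fin n → ℝ} (ha : IsNearestBoundaryPoint Ω Q a) :
    visibleElement Ω α Q a ∈ alphaBoundary Ω α := by
  rw [visibleElement_eq]
  refine h.seqClass_mem_alphaBoundary (h.nearest_mem_cauchySeqs hQ ha)
    (h.notMem_of_mem_frontier ha.1) ?_
  exact tendsto_lineMap_vertex (x := Q.center) (R := 0) (fun i => by simp)
    tendsto_one_div_add_atTop_nhds_zero_nat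

lemma cone_mem_visibleElement (h : IsProperDomain Ω α) {Q : Cube n} (hQ : Q.toSet ⊆ Ω)
    {a : Fin n → ℝ} (ha : IsNearestBoundaryPoint Ω Q a) {z : Fin n → ℝ}
    (hz : dist z Q.center < Q.radius + setDist Q.toSet (frontier Ω)) :
    (fun i : ℕ => (AffineMap.lineMap a z (1 / ((i : ℝ) + 1)) : Fin n → ℝ)) ∈
      visibleElement Ω α Q a := by
  have hmem := h.visibleElement_mem hQ ha
  have h1 : (fun i : ℕ => (AffineMap.lineMap a Q.center (1 / ((i : ℝ) + 1)) : Fin n → ℝ)) ∈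
      visibleElement Ω α Q a := by
    rw [visibleElement_eq]
    exact h.mem_seqClass_self (h.nearest_mem_cauchySeqs hQ ha)
  refine h.cone_mem_of_cone_mem hmem.1 (ha.isStarBall h.isOpen hQ)
    (ρ := Q.radius + setDist Q.toSet (frontier Ω) - dist z Q.center) (by linarith)
    (y := fun _ => Q.center) (z := fun _ => z) (fun i => ?_) (fun i => by linarith)
    one_div_succ_mem_Ioc one_div_succ_mem_Ioc tendsto_one_div_add_atTop_nhds_zero_nat
    tendsto_one_div_add_atTop_nhds_zero_nat h1
  rw [dist_self]
  linarith [dist_nonneg (x := z) (y := Q.center)]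

lemma ell_visibleElement (h : IsProperDomain Ω α) {Q : Cube n} (hQ : Q.toSet ⊆ Ω)
    {a : Fin n → ℝ} (ha : IsNearestBoundaryPoint Ω Q a) : ell (visibleElement Ω α Q a) = a := by
  have hmem := h.visibleElement_mem hQ ha
  refine h.ell_eq hmem.1 (h.cone_mem_visibleElement hQ ha (z := Q.center) ?_) ?_
  · rw [dist_self]
    linarith [setDist_nonneg Q.toSet (frontier Ω), Q.radius_pos]
  · exact tendsto_lineMap_vertex (x := Q.center) (R := 0) (fun i => by simp)
      tendsto_one_div_add_atTop_nhds_zero_nat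

/-- A cube contained in the large cube around `Q` sees the element `ω_{Q,α}`. -/
lemma alphaVisible_visibleElement (h : IsProperDomain Ω α) {Q K : Cube n} (hQ : Q.toSet ⊆ Ω)
    {a : Fin n → ℝ} (ha : IsNearestBoundaryPoint Ω Q a)
    (hK : K.toSet ⊆ Metric.ball Q.center (Q.radius + setDist Q.toSet (frontier Ω))) :
    AlphaVisible Ω K (visibleElement Ω α Q a) := by
  unfold AlphaVisible QVisible
  rw [h.ell_visibleElement hQ ha]
  refine ⟨⟨frontier_subset_closure ha.1, fun y hy t ht =>
    ha.isStarBall h.isOpen hQ y (hK hy) t ht⟩, _, h.cone_mem_visibleElement hQ ha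
      (hK (Metric.mem_closedBall_self K.radius_pos.le)), fun i =>
      ⟨_, one_div_succ_mem_Ioc i, rfl⟩⟩

end IsProperDomain

end Nearest

end SobolevTrace

/-! ### Smooth kernels scaled to cubes. -/

namespace SobolevTrace

/-- A smooth bump function with integral one, supported in the cube of radius `1/2`. -/
noncomputable def bump (n : ℕ) : (Fin n → ℝ) → ℝ :=
  (⟨1 / 4, 1 / 2, by norm_num, by norm_num⟩ : ContDiffBump (0 : Fin n → ℝ)).normed volume

/-- The bump function rescaled to the cube of centre `c` and radius `r / 2`. -/
noncomputable def kernel {n : ℕ} (c : Fin n → ℝ) (r : ℝ) (z : Fin n → ℝ) : ℝ :=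
  (r ^ n)⁻¹ * bump n (r⁻¹ • (z - c))

/-- The average of `F` with respect to `kernel c r`. -/
noncomputable def bumpAverage {n : ℕ} (F : (Fin n → ℝ) → ℝ) (c : Fin n → ℝ) (r : ℝ) : ℝ :=
  ∫ z, F z * kernel c r z

/-- The derivative in `t` of `kernel (c + t • v) (r + t * w) z`. -/
noncomputable def kernelDeriv {n : ℕ} (c v : Fin n → ℝ) (r w t : ℝ) (z : Fin n → ℝ) : ℝ :=
  -(((r + t * w) ^ (n + 1))⁻¹ * (n * w * bump n ((r + t * w)⁻¹ • (z - (c + t • v))) +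
    fderiv ℝ (bump n) ((r + t * w)⁻¹ • (z - (c + t • v)))
      (v + w • ((r + t * w)⁻¹ • (z - (c + t • v))))))

section Bump

variable {n : ℕ}

lemma contDiff_bump : ContDiff ℝ ((⊤ : ℕ∞) : WithTop ℕ∞) (bump n) :=
  ContDiffBump.contDiff_normed _

lemma bump_nonneg (u : Fin n → ℝ) : 0 ≤ bump n u := ContDiffBump.nonneg_normed _ _

lemma integral_bump : ∫ u, bump n u = 1 := ContDiffBump.integral_normed _

lemma support_bump : Function.support (bump n) = Metric.ball 0 (1 / 2) :=
  ContDiffBump.support_normed_eq _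

lemma tsupport_bump_subset : tsupport (bump n) ⊆ Metric.closedBall 0 (1 / 2) := by
  rw [tsupport, support_bump]
  exact Metric.closure_ball_subset_closedBall

lemma hasCompactSupport_bump : HasCompactSupport (bump n) :=
  ContDiffBump.hasCompactSupport_normed _

lemma bump_eq_zero {u : Fin n → ℝ} (hu : 1 / 2 ≤ ‖u‖) : bump n u = 0 := by
  by_contra h
  have : u ∈ Function.support (bump n) := h
  rw [support_bump, mem_ball_zero_iff] at this
  linarith

lemma exists_bump_le (n : ℕ) : ∃ B : ℝ, 0 < B ∧ ∀ u, bump n u ≤ B := by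
  obtain ⟨C, hC⟩ := hasCompactSupport_bump.exists_bound_of_continuous
    (contDiff_bump (n := n)).continuous
  exact ⟨max C 1, by positivity, fun u =>
    (le_abs_self _).trans ((hC u).trans (le_max_left _ _))⟩

lemma kernel_nonneg (c : Fin n → ℝ) {r : ℝ} (hr : 0 < r) (z : Fin n → ℝ) : 0 ≤ kernel c r z :=
  mul_nonneg (by positivity) (bump_nonneg _)

lemma kernel_le {B : ℝ} (hB : ∀ u, bump n u ≤ B) (c : Fin n → ℝ) {r : ℝ} (hr : 0 < r)
    (z : Fin n → ℝ) : kernel c r z ≤ (r ^ n)⁻¹ * B :=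
  mul_le_mul_of_nonneg_left (hB _) (by positivity)

lemma norm_inv_smul_sub (c z : Fin n → ℝ) {r : ℝ} (hr : 0 < r) :
    ‖r⁻¹ • (z - c)‖ = dist z c / r := by
  rw [norm_smul, Real.norm_eq_abs, abs_of_pos (inv_pos.2 hr), dist_eq_norm]
  field_simp

lemma kernel_eq_zero {c z : Fin n → ℝ} {r : ℝ} (hr : 0 < r) (h : r / 2 ≤ dist z c) :
    kernel c r z = 0 := by
  unfold kernel
  rw [bump_eq_zero, mul_zero]
  rw [norm_inv_smul_sub _ _ hr, le_div_iff₀ hr]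
  linarith

lemma contDiff_kernel (c : Fin n → ℝ) (r : ℝ) :
    ContDiff ℝ ((⊤ : ℕ∞) : WithTop ℕ∞) (kernel c r) := by
  unfold kernel
  exact contDiff_const.mul (contDiff_bump.comp ((contDiff_id.sub contDiff_const).const_smul _))

lemma support_kernel_subset (c : Fin n → ℝ) {r : ℝ} (hr : 0 < r) :
    Function.support (kernel c r) ⊆ Metric.closedBall c (r / 2) := by
  intro z hz
  by_contra hd
  rw [Metric.mem_closedBall, not_le] at hd
  exact hz (kernel_eq_zero hr hd.le)

lemma integral_kernel (c : Fin n → ℝ) {r : ℝ} (hr : 0 < r) : ∫ z, kernel c r z = 1 := by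
  unfold kernel
  rw [integral_const_mul, integral_sub_right_eq_self (fun z => bump n (r⁻¹ • z)) c,
    Measure.integral_comp_inv_smul_of_nonneg _ _ hr.le, integral_bump]
  simp
  field_simp

lemma integrable_kernel (c : Fin n → ℝ) {r : ℝ} (hr : 0 < r) : Integrable (kernel c r) := by
  by_contra h
  have := integral_kernel c hr
  rw [integral_undef h] at this
  exact zero_ne_one this

lemma lintegral_kernel (c : Fin n → ℝ) {r : ℝ} (hr : 0 < r) :
    ∫⁻ z, ENNReal.ofReal (kernel c r z) = 1 := by
  rw [← ofReal_integral_eq_lintegral_ofReal (integrable_kernel c hr)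
    (Eventually.of_forall fun z => kernel_nonneg c hr z), integral_kernel c hr, ENNReal.ofReal_one]

lemma hasDerivAt_kernel (c v z : Fin n → ℝ) (r w t : ℝ) (hr : 0 < r + t * w) :
    HasDerivAt (fun t => kernel (c + t • v) (r + t * w) z) (kernelDeriv c v r w t z) t := by
  have hr' : r + t * w ≠ 0 := hr.ne'
  have h1 : HasDerivAt (fun t : ℝ => r + t * w) w t := by
    simpa using ((hasDerivAt_id t).mul_const w).const_add r
  have h2 : HasDerivAt (fun t : ℝ => ((r + t * w) ^ n)⁻¹) (-(n * w) * ((r + t * w) ^ (n + 1))⁻¹)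
      t := by
    have e : HasDerivAt (fun t : ℝ => ((r + t * w) ^ n)⁻¹)
        (-(n * (r + t * w) ^ (n - 1) * w) / ((r + t * w) ^ n) ^ 2) t :=
      (h1.pow n).inv (pow_ne_zero n hr')
    refine e.congr_deriv ?_
    rcases n with _ | m
    · simp
    · rw [Nat.add_sub_cancel]
      field_simp
      ring
  have h3 : HasDerivAt (fun t : ℝ => (r + t * w)⁻¹ • (z - (c + t • v)))
      (-((r + t * w)⁻¹ • (v + w • ((r + t * w)⁻¹ • (z - (c + t • v)))))) t := by
    have e1 : HasDerivAt (fun t : ℝ => z - (c + t • v)) (-v) t := by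
      simpa using (((hasDerivAt_id t).smul_const v).const_add c).const_sub z
    have e2 : HasDerivAt (fun t : ℝ => (r + t * w)⁻¹ • (z - (c + t • v)))
        ((r + t * w)⁻¹ • (-v) + (-w / (r + t * w) ^ 2) • (z - (c + t • v))) t :=
      (h1.inv hr').smul e1
    refine e2.congr_deriv ?_
    ext i
    simp only [Pi.add_apply, Pi.smul_apply, Pi.neg_apply, Pi.sub_apply, smul_eq_mul]
    field_simp
    ring
  have h4 : HasDerivAt (fun t : ℝ => bump n ((r + t * w)⁻¹ • (z - (c + t • v)))) _ t :=
    ((contDiff_bump.differentiable (by simp)) _).hasFDerivAt.comp_hasDerivAt t h3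
  refine (h2.mul h4).congr_deriv ?_
  unfold kernelDeriv
  rw [map_neg, map_smul, smul_eq_mul]
  field_simp
  ring

lemma continuousOn_kernelDeriv (c v : Fin n → ℝ) (r w : ℝ) :
    ContinuousOn (fun q : ℝ × (Fin n → ℝ) => kernelDeriv c v r w q.1 q.2)
      {q | 0 < r + q.1 * w} := by
  have hU : ContinuousOn (fun q : ℝ × (Fin n → ℝ) => (r + q.1 * w)⁻¹ • (q.2 - (c + q.1 • v)))
      {q | 0 < r + q.1 * w} := by
    have h1 : ContinuousOn (fun q : ℝ × (Fin n → ℝ) => (r + q.1 * w)⁻¹) {q | 0 < r + q.1 * w} :=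
      ContinuousOn.inv₀ (by fun_prop) fun q hq => ne_of_gt hq
    have h2 : Continuous (fun q : ℝ × (Fin n → ℝ) => q.2 - (c + q.1 • v)) := by fun_prop
    exact h1.smul h2.continuousOn
  have hf : Continuous (fderiv ℝ (bump n)) := contDiff_bump.continuous_fderiv (by simp)
  unfold kernelDeriv
  refine ((ContinuousOn.inv₀ (by fun_prop) fun q hq => pow_ne_zero _ (ne_of_gt hq)).mul
    ((continuousOn_const.mul (contDiff_bump.continuous.comp_continuousOn hU)).add
      ((hf.comp_continuousOn hU).clm_apply (continuousOn_const.add (hU.const_smul w))))).neg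

lemma kernelDeriv_eq_zero {c v z : Fin n → ℝ} {r w t : ℝ} (hr : 0 < r + t * w)
    (h : (r + t * w) / 2 < dist z (c + t • v)) : kernelDeriv c v r w t z = 0 := by
  set u := (r + t * w)⁻¹ • (z - (c + t • v)) with hu
  have hnorm : 1 / 2 < ‖u‖ := by
    rw [hu, norm_inv_smul_sub _ _ hr, lt_div_iff₀ hr]
    linarith
  have hd : fderiv ℝ (bump n) u = 0 := by
    have : u ∉ tsupport (bump n) := fun hm => by
      have := tsupport_bump_subset hm
      rw [mem_closedBall_zero_iff] at this
      linarith
    exact image_eq_zero_of_notMem_tsupport (fun hm => this (tsupport_fderiv_subset ℝ hm))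
  unfold kernelDeriv
  rw [← hu, hd, bump_eq_zero hnorm.le]
  simp

/-- The component of the test field associated with the motion of the kernel. -/
noncomputable def testField (c v : Fin n → ℝ) (r w : ℝ) (i : Fin n) (z : Fin n → ℝ) : ℝ :=
  (v i + w * (r⁻¹ * (z i - c i))) * kernel c r z

lemma contDiff_testField (c v : Fin n → ℝ) (r w : ℝ) (i : Fin n) :
    ContDiff ℝ ((⊤ : ℕ∞) : WithTop ℕ∞) (testField c v r w i) := by
  unfold testField
  refine ContDiff.mul ?_ (contDiff_kernel c r)
  fun_prop

/-- This is the continuity equation: the kernel is a probability density transported by the velocity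
field `v + w * (z - c) / r`. The divergence of the part proportional to `w` produces the term with
`n * w`, which also comes from differentiating the normalisation. -/
lemma sum_fderiv_testField (c v z : Fin n → ℝ) (r w t : ℝ) (hr : 0 < r + t * w) :
    ∑ i, fderiv ℝ (testField (c + t • v) v (r + t * w) w i) z (Pi.single i 1) =
      - kernelDeriv c v r w t z := by
  set ρ := r + t * w with hρ
  set x := c + t • v with hx
  set u := ρ⁻¹ • (z - x) with hu
  have hk : HasFDerivAt (kernel x ρ) ((ρ ^ n)⁻¹ • (fderiv ℝ (bump n) u).comp
      (ρ⁻¹ • ContinuousLinearMap.id ℝ (Fin n → ℝ))) z := by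
    have h1 : HasFDerivAt (fun z : Fin n → ℝ => ρ⁻¹ • (z - x))
        (ρ⁻¹ • ContinuousLinearMap.id ℝ (Fin n → ℝ)) z :=
      ((hasFDerivAt_id z).sub_const x).const_smul ρ⁻¹
    have h2 : HasFDerivAt (bump n) (fderiv ℝ (bump n) u) (ρ⁻¹ • (z - x)) :=
      ((contDiff_bump.differentiable (by simp)) _).hasFDerivAt
    have h3 := (h2.comp z h1).const_mul (ρ ^ n)⁻¹
    exact h3
  have hterm : ∀ i, fderiv ℝ (testField x v ρ w i) z (Pi.single i 1) =
      (ρ ^ (n + 1))⁻¹ * (w * bump n u) +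
        (ρ ^ (n + 1))⁻¹ * ((v i + w * u i) * fderiv ℝ (bump n) u (Pi.single i 1)) := by
    intro i
    have h1 : HasFDerivAt (fun z : Fin n → ℝ => v i + w * (ρ⁻¹ * (z i - x i)))
        (w • ρ⁻¹ • ContinuousLinearMap.proj (R := ℝ) (φ := fun _ : Fin n => ℝ) i) z := by
      have e : HasFDerivAt (fun z : Fin n → ℝ => z i)
        (ContinuousLinearMap.proj (R := ℝ) (φ := fun _ : Fin n => ℝ) i) z :=
        hasFDerivAt_apply i z
      exact (((e.sub_const (x i)).const_mul ρ⁻¹).const_mul w).const_add (v i)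
    have h2 := (h1.mul hk).fderiv
    have h3 : testField x v ρ w i =
        (fun z : Fin n → ℝ => v i + w * (ρ⁻¹ * (z i - x i))) * kernel x ρ := rfl
    rw [h3, h2]
    have hui : u i = ρ⁻¹ * (z i - x i) := rfl
    have hku : kernel x ρ z = (ρ ^ n)⁻¹ * bump n u := rfl
    rw [hku, ← hui]
    simp only [add_apply, smul_apply, ContinuousLinearMap.comp_apply, smul_eq_mul,
      ContinuousLinearMap.proj_apply, Pi.single_eq_same, ContinuousLinearMap.id_apply, map_smul]
    field_simp
    ring
  have hlin : fderiv ℝ (bump n) u (v + w • u) =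
      ∑ i, (v i + w * u i) * fderiv ℝ (bump n) u (Pi.single i 1) := by
    conv_lhs => rw [← Finset.univ_sum_single (v + w • u)]
    rw [map_sum]
    refine Finset.sum_congr rfl fun i _ => ?_
    have : (Pi.single i ((v + w • u) i) : Fin n → ℝ) =
        (v i + w * u i) • (Pi.single i (1 : ℝ) : Fin n → ℝ) := by
      rw [← Pi.single_smul]
      simp
    rw [this, map_smul, smul_eq_mul]
  rw [Finset.sum_congr rfl fun i _ => hterm i, Finset.sum_add_distrib,
    ← Finset.mul_sum (f := fun i => (v i + w * u i) * fderiv ℝ (bump n) u (Pi.single i 1)), ← hlin]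
  unfold kernelDeriv
  rw [← hρ, ← hx, ← hu]
  simp
  ring

/-- On the support of the kernel the rescaled coordinate is at most one, so the velocity is at most
`‖v‖ + |w|` in each component. -/
lemma abs_testField_le {c v z : Fin n → ℝ} {r w : ℝ} (hr : 0 < r) (i : Fin n) :
    |testField c v r w i z| ≤ (‖v‖ + |w|) * kernel c r z := by
  unfold testField
  rw [abs_mul, abs_of_nonneg (kernel_nonneg c hr z)]
  rcases le_or_gt (r / 2) (dist z c) with h | h
  · rw [kernel_eq_zero hr h]; simp
  · refine mul_le_mul_of_nonneg_right ?_ (kernel_nonneg c hr z)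
    refine (abs_add_le _ _).trans (add_le_add (norm_le_pi_norm v i) ?_)
    rw [abs_mul]
    refine mul_le_of_le_one_right (abs_nonneg w) ?_
    rw [abs_mul, abs_of_pos (inv_pos.2 hr)]
    have h1 : |z i - c i| ≤ dist z c := by
      rw [← Real.dist_eq]; exact dist_le_pi_dist z c i
    rw [inv_mul_le_iff₀ hr]
    linarith

end Bump

end SobolevTrace

/-! ### Change of the averages under motion of the kernel. -/

namespace SobolevTrace

section Transport

variable {n : ℕ} {Ω : Set (Fin n → ℝ)} {F : (Fin n → ℝ) → ℝ} {G : (Fin n → ℝ) → Fin n → ℝ}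

/-- The weak gradient tested against the derivative of a moving kernel. -/
lemma IsWeakGradient.integral_mul_kernelDeriv (hw : IsWeakGradient Ω F G) (hΩ : IsOpen Ω)
    (hF : ContinuousOn F Ω) (c v : Fin n → ℝ) (r w t : ℝ) (hr : 0 < r + t * w)
    (hsub : Metric.closedBall (c + t • v) ((r + t * w) / 2) ⊆ Ω) :
    ∫ z, F z * kernelDeriv c v r w t z =
      ∑ i, ∫ z in Ω, G z i * testField (c + t • v) v (r + t * w) w i z := by
  set x := c + t • v with hx
  set ρ := r + t * w with hρ
  have htsupp : ∀ i, tsupport (testField x v ρ w i) ⊆ Metric.closedBall x (ρ / 2) := by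
    intro i
    refine closure_minimal ?_ Metric.isClosed_closedBall
    intro z hz
    refine support_kernel_subset x hr fun h0 => hz ?_
    simp [testField, h0]
  have hcs : ∀ i, HasCompactSupport (testField x v ρ w i) := fun i =>
    HasCompactSupport.of_support_subset_isCompact (isCompact_closedBall x (ρ / 2))
      (subset_closure.trans (htsupp i))
  have h1 : ∀ i, ∫ z in Ω, G z i * testField x v ρ w i z =
      - ∫ z in Ω, F z * fderiv ℝ (testField x v ρ w i) z (Pi.single i 1) := by
    intro i
    rw [hw _ (contDiff_testField x v ρ w i) (hcs i) ((htsupp i).trans hsub) i, neg_neg]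
  have hInt : ∀ i, IntegrableOn
      (fun z => F z * fderiv ℝ (testField x v ρ w i) z (Pi.single i 1)) Ω := by
    intro i
    have hcont : ContinuousOn (fun z => F z * fderiv ℝ (testField x v ρ w i) z (Pi.single i 1))
        (Metric.closedBall x (ρ / 2)) := by
      refine (hF.mono hsub).mul (Continuous.continuousOn ?_)
      exact ((contDiff_testField x v ρ w i).continuous_fderiv (by simp)).clm_apply continuous_const
    have h2 := hcont.integrableOn_compact (μ := volume) (isCompact_closedBall x (ρ / 2))
    refine h2.of_forall_sdiff_eq_zero hΩ.measurableSet fun z hz => ?_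
    have : fderiv ℝ (testField x v ρ w i) z = 0 :=
      image_eq_zero_of_notMem_tsupport fun hm => hz.2 (htsupp i (tsupport_fderiv_subset ℝ hm))
    rw [this]; simp
  rw [Finset.sum_congr rfl fun i _ => h1 i, Finset.sum_neg_distrib,
    ← integral_finsetSum _ fun i _ => hInt i]
  rw [← integral_neg, ← setIntegral_eq_integral_of_forall_compl_eq_zero (s := Ω)]
  · refine integral_congr_ae (Eventually.of_forall fun z => ?_)
    simp only
    rw [← Finset.mul_sum, sum_fderiv_testField c v z r w t hr]
    ring
  · intro z hz
    rw [kernelDeriv_eq_zero hr, mul_zero]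
    by_contra! hle
    exact hz (hsub (Metric.mem_closedBall.2 hle))

lemma integrable_mul_kernel (hF : ContinuousOn F Ω) {c : Fin n → ℝ} {r : ℝ} (hr : 0 < r)
    (hsub : Metric.closedBall c (r / 2) ⊆ Ω) : Integrable (fun z => F z * kernel c r z) := by
  have h1 : IntegrableOn (fun z => F z * kernel c r z) (Metric.closedBall c (r / 2)) :=
    ((hF.mono hsub).mul (contDiff_kernel c r).continuous.continuousOn).integrableOn_compact
      (isCompact_closedBall _ _)
  rw [← integrableOn_univ]
  refine h1.of_forall_sdiff_eq_zero MeasurableSet.univ fun z hz => ?_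
  rw [kernel_eq_zero hr, mul_zero]
  by_contra! hle
  exact hz.2 (Metric.mem_closedBall.2 hle.le)

/-- The variation of the averages of `F` along an affine motion of the averaging cube. -/
lemma IsWeakGradient.enorm_bumpAverage_sub_le (hw : IsWeakGradient Ω F G) (hΩ : IsOpen Ω)
    (hF : ContinuousOn F Ω) (c v : Fin n → ℝ) (r w : ℝ) {a b : ℝ} (hab : a ≤ b)
    (hr : ∀ t ∈ Set.Icc a b, 0 < r + t * w)
    (hsub : ∀ t ∈ Set.Icc a b, Metric.closedBall (c + t • v) ((r + t * w) / 2) ⊆ Ω) :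
    ‖bumpAverage F (c + b • v) (r + b * w) - bumpAverage F (c + a • v) (r + a * w)‖ₑ ≤
      ∫⁻ t in Set.Icc a b, ∫⁻ z in Ω, ‖G z‖ₑ *
        ENNReal.ofReal (n * (‖v‖ + |w|) * kernel (c + t • v) (r + t * w) z) := by
  have ha : a ∈ Set.Icc a b := ⟨le_rfl, hab⟩
  have hb : b ∈ Set.Icc a b := ⟨hab, le_rfl⟩
  -- The region swept by the supports is compact and contained in `Ω`. Hence continuity of `F` on
  -- `Ω` alone gives integrability on the product, and Fubini applies.
  set K : Set (Fin n → ℝ) := (fun q : ℝ × (Fin n → ℝ) => c + q.1 • v + (r + q.1 * w) • q.2) ''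
    (Set.Icc a b ×ˢ Metric.closedBall 0 (1 / 2)) with hK
  have hKc : IsCompact K :=
    (isCompact_Icc.prod (isCompact_closedBall _ _)).image (by fun_prop)
  have hball : ∀ t ∈ Set.Icc a b, ∀ z, z ∈ Metric.closedBall (c + t • v) ((r + t * w) / 2) ↔
      ‖(r + t * w)⁻¹ • (z - (c + t • v))‖ ≤ 1 / 2 := by
    intro t ht z
    rw [norm_inv_smul_sub _ _ (hr t ht), Metric.mem_closedBall, div_le_iff₀ (hr t ht)]
    constructor <;> intro h <;> linarith
  have hKsub : K ⊆ Ω := by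
    rintro _ ⟨⟨t, u⟩, ⟨ht, hu⟩, rfl⟩
    refine hsub t ht ((hball t ht _).2 ?_)
    have hne := (hr t ht).ne'
    simp only [add_sub_cancel_left]
    rw [smul_smul, inv_mul_cancel₀ hne, one_smul]
    simpa using hu
  have hKmem : ∀ t ∈ Set.Icc a b, ∀ z ∉ K, kernelDeriv c v r w t z = 0 := by
    intro t ht z hz
    refine kernelDeriv_eq_zero (hr t ht) ?_
    by_contra! hle
    refine hz ⟨⟨t, (r + t * w)⁻¹ • (z - (c + t • v))⟩, ⟨ht, ?_⟩, ?_⟩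
    · rw [mem_closedBall_zero_iff]
      exact (hball t ht z).1 (Metric.mem_closedBall.2 hle)
    · simp only
      rw [smul_smul, mul_inv_cancel₀ (hr t ht).ne', one_smul, add_sub_cancel]
  -- the kernel derivative is integrable on the product
  have hcontprod : ContinuousOn (fun q : ℝ × (Fin n → ℝ) => F q.2 * kernelDeriv c v r w q.1 q.2)
      (Set.Icc a b ×ˢ K) := by
    refine ContinuousOn.mul (hF.comp continuousOn_snd fun q hq => hKsub hq.2) ?_
    exact (continuousOn_kernelDeriv c v r w).mono fun q hq => hr q.1 hq.1
  have hintprod : Integrable (fun q : ℝ × (Fin n → ℝ) => F q.2 * kernelDeriv c v r w q.1 q.2)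
      ((volume.restrict (Set.Icc a b)).prod volume) := by
    have h1 := hcontprod.integrableOn_compact (μ := (volume : Measure ℝ).prod volume)
      (isCompact_Icc.prod hKc)
    have h2 : IntegrableOn (fun q : ℝ × (Fin n → ℝ) => F q.2 * kernelDeriv c v r w q.1 q.2)
        (Set.Icc a b ×ˢ Set.univ) ((volume : Measure ℝ).prod volume) := by
      refine h1.of_forall_sdiff_eq_zero (measurableSet_Icc.prod MeasurableSet.univ) fun q hq => ?_
      rw [hKmem q.1 hq.1.1 q.2 fun hk => hq.2 ⟨hq.1.1, hk⟩, mul_zero]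
    rw [IntegrableOn, ← Measure.prod_restrict, Measure.restrict_univ] at h2
    exact h2
  have hFTC : ∀ z, ∫ t in Set.Icc a b, F z * kernelDeriv c v r w t z =
      F z * kernel (c + b • v) (r + b * w) z - F z * kernel (c + a • v) (r + a * w) z := by
    intro z
    rw [integral_const_mul, integral_Icc_eq_integral_Ioc, ← intervalIntegral.integral_of_le hab,
      intervalIntegral.integral_eq_sub_of_hasDerivAt
        (f := fun t => kernel (c + t • v) (r + t * w) z), mul_sub]
    · intro t ht
      rw [Set.uIcc_of_le hab] at ht
      exact hasDerivAt_kernel c v z r w t (hr t ht)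
    · refine ContinuousOn.intervalIntegrable ?_
      rw [Set.uIcc_of_le hab]
      exact (continuousOn_kernelDeriv c v r w).comp (f := fun t : ℝ => (t, z))
        (by fun_prop) fun t ht => hr t ht
  have hdiff : bumpAverage F (c + b • v) (r + b * w) - bumpAverage F (c + a • v) (r + a * w) =
      ∫ t in Set.Icc a b, ∫ z, F z * kernelDeriv c v r w t z := by
    rw [integral_integral_swap hintprod]
    unfold bumpAverage
    rw [← integral_sub (integrable_mul_kernel hF (hr b hb) (hsub b hb))
      (integrable_mul_kernel hF (hr a ha) (hsub a ha))]
    exact integral_congr_ae (Eventually.of_forall fun z => (hFTC z).symm)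
  rw [hdiff]
  refine (enorm_integral_le_lintegral_enorm _).trans ?_
  refine setLIntegral_mono' measurableSet_Icc fun t ht => ?_
  rw [hw.integral_mul_kernelDeriv hΩ hF c v r w t (hr t ht) (hsub t ht)]
  refine (enorm_sum_le _ _).trans ?_
  have hterm : ∀ i, ‖∫ z in Ω, G z i * testField (c + t • v) v (r + t * w) w i z‖ₑ ≤
      ∫⁻ z in Ω, ‖G z‖ₑ * ENNReal.ofReal ((‖v‖ + |w|) * kernel (c + t • v) (r + t * w) z) := by
    intro i
    refine (enorm_integral_le_lintegral_enorm _).trans (lintegral_mono fun z => ?_)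
    rw [enorm_mul]
    refine mul_le_mul' ?_ ?_
    · rw [enorm_le_iff_norm_le]
      exact norm_le_pi_norm (G z) i
    · rw [← ofReal_norm]
      exact ENNReal.ofReal_le_ofReal (abs_testField_le (hr t ht) i)
  refine (Finset.sum_le_sum fun i _ => hterm i).trans_eq ?_
  rw [Finset.sum_const, Finset.card_univ, Fintype.card_fin, nsmul_eq_mul,
    ← lintegral_const_mul' _ _ (ENNReal.natCast_ne_top n)]
  refine lintegral_congr fun z => ?_
  rw [mul_assoc (n : ℝ), ENNReal.ofReal_mul (Nat.cast_nonneg n), ENNReal.ofReal_natCast]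
  ring

end Transport

end SobolevTrace

/-! ### A packing bound and a weighted Hölder inequality. -/

namespace SobolevTrace

section Packing

variable {n : ℕ}

/-- Translation and scaling remove `z` and `ρ`; the remaining integral converges because `σ > 0`. -/
lemma lintegral_scaled_japanese {σ : ℝ} (hσ : 0 < σ) (z : Fin n → ℝ) {ρ : ℝ} (hρ : 0 < ρ) :
    ∫⁻ w, ENNReal.ofReal (ρ ^ σ * (ρ + ‖w - z‖) ^ (-(n + σ))) =
      ENNReal.ofReal (∫ u : Fin n → ℝ, (1 + ‖u‖) ^ (-(n + σ))) := by
  have hInt : Integrable (fun u : Fin n → ℝ => (1 + ‖u‖) ^ (-(n + σ))) :=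
    integrable_one_add_norm (by simp [hσ])
  have hint2 : Integrable (fun w : Fin n → ℝ => (1 + ‖ρ⁻¹ • w‖) ^ (-(n + σ))) :=
    hInt.comp_smul (inv_ne_zero hρ.ne')
  have heq : ∀ w : Fin n → ℝ, ρ ^ σ * (ρ + ‖w‖) ^ (-(n + σ)) =
      (ρ ^ n)⁻¹ * (1 + ‖ρ⁻¹ • w‖) ^ (-(n + σ)) := by
    intro w
    have h1 : ρ + ‖w‖ = ρ * (1 + ‖ρ⁻¹ • w‖) := by
      rw [norm_smul, Real.norm_eq_abs, abs_of_pos (inv_pos.2 hρ)]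
      field_simp
    rw [h1, Real.mul_rpow hρ.le (by positivity), ← mul_assoc, ← Real.rpow_add hρ]
    congr 1
    rw [← Real.rpow_natCast, ← Real.rpow_neg hρ.le]
    congr 1
    ring
  rw [lintegral_sub_right_eq_self
    (fun w : Fin n → ℝ => ENNReal.ofReal (ρ ^ σ * (ρ + ‖w‖) ^ (-(n + σ)))) z]
  simp_rw [heq]
  rw [← ofReal_integral_eq_lintegral_ofReal (hint2.const_mul _)
    (Eventually.of_forall fun w => by positivity), integral_const_mul,
    Measure.integral_comp_inv_smul_of_nonneg (μ := volume)
      (fun u : Fin n → ℝ => (1 + ‖u‖) ^ (-(n + σ))) hρ.le]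
  congr 1
  simp
  field_simp

/-- A weighted count of the members of a disjoint family of cubes which are near a given point and
not too small. -/
lemma exists_packing_bound (n : ℕ) {A σ : ℝ} (hA : 0 < A) (hσ : 0 < σ) :
    ∃ C : ℝ, 0 < C ∧ ∀ (ι : Type) [Countable ι] (x : ι → Fin n → ℝ) (r : ι → ℝ),
      (∀ i, 0 < r i) →
      (Pairwise fun i j => Disjoint (Metric.ball (x i) (r i)) (Metric.ball (x j) (r j))) →
      ∀ (z : Fin n → ℝ) (ρ : ℝ), 0 < ρ →
      ∑' i, {i | dist (x i) z ≤ A * r i ∧ ρ ≤ A * r i}.indicator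
        (fun i => ENNReal.ofReal ((ρ / r i) ^ σ)) i ≤ ENNReal.ofReal C := by
  set J := ∫ u : Fin n → ℝ, (1 + ‖u‖) ^ (-(n + σ)) with hJ
  have hJ0 : 0 ≤ J := integral_nonneg fun u => by positivity
  set D := (2 * A + 1) ^ (n + σ) with hD
  have hD0 : 0 < D := by positivity
  refine ⟨D * J + 1, by positivity, fun ι _ x r hr hdisj z ρ hρ => ?_⟩
  -- This density turns the sum into one integral. On an admissible ball `ρ + ‖w - z‖ ≤ (2 * A + 1)
  -- * r i`, so its integral over that ball is at least `(ρ / r i) ^ σ`. Disjointness adds these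
  -- integrals up, and the total integral does not depend on `z` and `ρ`.
  set φ : (Fin n → ℝ) → ℝ≥0∞ := fun w =>
    ENNReal.ofReal D * ENNReal.ofReal (ρ ^ σ * (ρ + ‖w - z‖) ^ (-(n + σ))) with hφ
  have hterm : ∀ i, {i | dist (x i) z ≤ A * r i ∧ ρ ≤ A * r i}.indicator
        (fun i => ENNReal.ofReal ((ρ / r i) ^ σ)) i ≤ ∫⁻ w in Metric.ball (x i) (r i), φ w := by
    intro i
    refine Set.indicator_le' (f := fun i => ENNReal.ofReal ((ρ / r i) ^ σ))
      (g := fun i => ∫⁻ w in Metric.ball (x i) (r i), φ w) (fun i hi => ?_) (fun i _ => zero_le) i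
    have hri := hr i
    have hbound : ∀ w ∈ Metric.ball (x i) (r i),
        ENNReal.ofReal (ρ ^ σ * r i ^ (-(n + σ))) ≤ φ w := by
      intro w hw
      rw [hφ]
      simp only
      rw [← ENNReal.ofReal_mul hD0.le]
      refine ENNReal.ofReal_le_ofReal ?_
      have h1 : ρ + ‖w - z‖ ≤ (2 * A + 1) * r i := by
        rw [← dist_eq_norm]
        have := dist_triangle w (x i) z
        have := Metric.mem_ball.1 hw
        linarith [hi.1, hi.2]
      have h2 : ((2 * A + 1) * r i) ^ (-(n + σ)) ≤ (ρ + ‖w - z‖) ^ (-(n + σ)) :=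
        Real.rpow_le_rpow_of_nonpos (by positivity) h1
          (by have : (0 : ℝ) ≤ n := Nat.cast_nonneg n
              linarith)
      rw [Real.mul_rpow (by positivity) hri.le, Real.rpow_neg (by positivity), ← hD] at h2
      calc ρ ^ σ * r i ^ (-(n + σ)) = D * (ρ ^ σ * (D⁻¹ * r i ^ (-(n + σ)))) := by
            field_simp
        _ ≤ _ := by gcongr
    calc ENNReal.ofReal ((ρ / r i) ^ σ)
        ≤ ENNReal.ofReal (ρ ^ σ * r i ^ (-(n + σ))) * volume (Metric.ball (x i) (r i)) := by
          rw [Real.volume_pi_ball _ hri, ← ENNReal.ofReal_mul (by positivity)]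
          refine ENNReal.ofReal_le_ofReal ?_
          rw [Real.div_rpow hρ.le hri.le, Real.rpow_neg hri.le, Real.rpow_add hri,
            Real.rpow_natCast, Fintype.card_fin, mul_pow]
          have : (1 : ℝ) ≤ 2 ^ n := one_le_pow₀ one_le_two
          calc ρ ^ σ / r i ^ σ = ρ ^ σ * (r i ^ n * r i ^ σ)⁻¹ * (1 * r i ^ n) := by field_simp
            _ ≤ _ := by gcongr
      _ ≤ ∫⁻ w in Metric.ball (x i) (r i), φ w := by
          rw [← setLIntegral_const]
          exact setLIntegral_mono' Metric.isOpen_ball.measurableSet hbound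
  calc _ ≤ ∑' i, ∫⁻ w in Metric.ball (x i) (r i), φ w := ENNReal.tsum_le_tsum hterm
    _ = ∫⁻ w in ⋃ i, Metric.ball (x i) (r i), φ w :=
        (lintegral_iUnion (fun i => Metric.isOpen_ball.measurableSet) hdisj _).symm
    _ ≤ ∫⁻ w, φ w := setLIntegral_le_lintegral _ _
    _ = ENNReal.ofReal (D * J) := by
        rw [hφ, lintegral_const_mul' _ _ ENNReal.ofReal_ne_top, lintegral_scaled_japanese hσ z hρ,
          ← ENNReal.ofReal_mul hD0.le]
    _ ≤ _ := ENNReal.ofReal_le_ofReal (by linarith)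

end Packing

section Holder

/-- Hölder's inequality with respect to a weight. -/
lemma lintegral_mul_rpow_le {X : Type*} [MeasurableSpace X] (μ : Measure X) {p : ℝ} (hp : 1 < p)
    {g k : X → ℝ≥0∞} (hg : AEMeasurable g μ) (hk : AEMeasurable k μ) :
    (∫⁻ x, g x * k x ∂μ) ^ p ≤ (∫⁻ x, g x ^ p * k x ∂μ) * (∫⁻ x, k x ∂μ) ^ (p - 1) := by
  have hp0 : 0 < p := by linarith
  have hpq : p.HolderConjugate (Real.conjExponent p) := Real.HolderConjugate.conjExponent hp
  set q := Real.conjExponent p with hq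
  have hq0 : 0 < q := hpq.symm.pos
  have hsum : 1 / p + 1 / q = 1 := by
    have := hpq.inv_add_inv_eq_one
    simpa [one_div] using this
  have h1 := ENNReal.lintegral_mul_le_Lp_mul_Lq μ hpq
    (hg.mul (hk.pow_const (1 / p))) (hk.pow_const (1 / q))
  have h2 : ∫⁻ x, g x * k x ∂μ ≤ (∫⁻ x, g x ^ p * k x ∂μ) ^ (1 / p) * (∫⁻ x, k x ∂μ) ^ (1 / q) := by
    refine le_trans (le_of_eq ?_) (h1.trans (le_of_eq ?_))
    · refine lintegral_congr fun x => ?_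
      simp only [Pi.mul_apply]
      rw [mul_assoc, ← ENNReal.rpow_add_of_nonneg _ _ (by positivity) (by positivity), hsum,
        ENNReal.rpow_one]
    · congr 2
      · refine lintegral_congr fun x => ?_
        simp only [Pi.mul_apply]
        rw [ENNReal.mul_rpow_of_nonneg _ _ hp0.le, ← ENNReal.rpow_mul, one_div_mul_cancel hp0.ne',
          ENNReal.rpow_one]
      · refine lintegral_congr fun x => ?_
        rw [← ENNReal.rpow_mul, one_div_mul_cancel hq0.ne', ENNReal.rpow_one]
  calc _ ≤ ((∫⁻ x, g x ^ p * k x ∂μ) ^ (1 / p) * (∫⁻ x, k x ∂μ) ^ (1 / q)) ^ p :=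
        ENNReal.rpow_le_rpow h2 hp0.le
    _ = _ := by
        rw [ENNReal.mul_rpow_of_nonneg _ _ hp0.le, ← ENNReal.rpow_mul, ← ENNReal.rpow_mul,
          one_div_mul_cancel hp0.ne', ENNReal.rpow_one]
        congr 2
        rw [show 1 / q = 1 - 1 / p by linarith, sub_mul, one_div_mul_cancel hp0.ne', one_mul]

end Holder

/-! ### Averages near a visible boundary element. -/

section Average

variable {n : ℕ} {Ω : Set (Fin n → ℝ)} {α : ℝ} {F : (Fin n → ℝ) → ℝ}

lemma abs_bumpAverage_sub_le (hF : ContinuousOn F Ω) {c : Fin n → ℝ} {r : ℝ} (hr : 0 < r)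
    (hsub : Metric.closedBall c (r / 2) ⊆ Ω) {y ε : ℝ}
    (hy : ∀ z ∈ Metric.closedBall c (r / 2), |F z - y| ≤ ε) : |bumpAverage F c r - y| ≤ ε := by
  have h1 : bumpAverage F c r - y = ∫ z, (F z - y) * kernel c r z := by
    simp_rw [sub_mul]
    rw [integral_sub (integrable_mul_kernel hF hr hsub) ((integrable_kernel c hr).const_mul y),
      integral_const_mul, integral_kernel c hr, mul_one]
    rfl
  rw [h1]
  calc |∫ z, (F z - y) * kernel c r z| ≤ ∫ z, ε * kernel c r z := by
        rw [← Real.norm_eq_abs]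
        refine norm_integral_le_of_norm_le ((integrable_kernel c hr).const_mul ε)
          (Eventually.of_forall fun z => ?_)
        rw [Real.norm_eq_abs, abs_mul, abs_of_nonneg (kernel_nonneg c hr z)]
        rcases le_or_gt (dist z c) (r / 2) with hz | hz
        · exact mul_le_mul_of_nonneg_right (hy z (Metric.mem_closedBall.2 hz))
            (kernel_nonneg c hr z)
        · rw [kernel_eq_zero hr hz.le]; simp
    _ = ε := by rw [integral_const_mul, integral_kernel c hr, mul_one]

namespace IsProperDomain

lemma closedBall_cone_subset (h : IsProperDomain Ω α) {a x : Fin n → ℝ} {r t : ℝ} (hr : 0 < r)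
    (hs : IsStarBall Ω a x r) (ht : t ∈ Set.Ioc (0 : ℝ) 1) :
    Metric.closedBall (AffineMap.lineMap a x t) (t * r / 2) ⊆ Ω := by
  intro z hz
  have h1 := h.mul_le_infDist_lineMap (y := x) hs ht
  rw [dist_self, sub_zero] at h1
  refine h.mem_of_dist_lt (hs x (Metric.mem_ball_self hr) t ht) ?_
  have := Metric.mem_closedBall.1 hz
  nlinarith [mul_pos ht.1 hr]

/-- The averages over the central cubes of the cone converge to the trace. -/
lemma tendsto_bumpAverage_cone (h : IsProperDomain Ω α) (hF : ContinuousOn F Ω)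
    {f : alphaBoundary Ω α → ℝ} (hf : IsTrace Ω α F f) (ω : alphaBoundary Ω α) {Q : Cube n}
    (hv : AlphaVisible Ω Q ω) {ε : ℝ} (hε : 0 < ε) :
    ∃ τ₀ ∈ Set.Ioc (0 : ℝ) 1, ∀ τ ∈ Set.Ioc 0 τ₀,
      |bumpAverage F (AffineMap.lineMap (ell (ω : Set (ℕ → Fin n → ℝ))) Q.center τ)
        (τ * Q.radius) - f ω| ≤ ε := by
  set a := ell (ω : Set (ℕ → Fin n → ℝ)) with ha
  have hr := Q.radius_pos
  have hst := hv.1.isStarBall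
  by_contra! hcon
  -- An average that is off by more than `ε` forces a point of the supporting cube at which `F` is
  -- off by more than `ε`.
  have hbad : ∀ i : ℕ, ∃ τ ∈ Set.Ioc (0 : ℝ) (1 / ((i : ℝ) + 1)), ∃ z ∈
      Metric.closedBall (AffineMap.lineMap a Q.center τ) (τ * Q.radius / 2), ε < |F z - f ω| := by
    intro i
    obtain ⟨τ, hτ, hτε⟩ := hcon _ (one_div_succ_mem_Ioc i)
    refine ⟨τ, hτ, ?_⟩
    by_contra! hall
    have hτ1 : τ ∈ Set.Ioc (0 : ℝ) 1 := ⟨hτ.1, hτ.2.trans (one_div_succ_mem_Ioc i).2⟩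
    exact absurd (abs_bumpAverage_sub_le hF (mul_pos hτ.1 hr)
      (h.closedBall_cone_subset hr hst hτ1) hall) (not_le.2 hτε)
  choose τ hτ z hz hzε using hbad
  have hτ0 : Tendsto τ atTop (𝓝 0) :=
    squeeze_zero (fun i => (hτ i).1.le) (fun i => (hτ i).2)
      tendsto_one_div_add_atTop_nhds_zero_nat
  have hτ1 : ∀ i, τ i ∈ Set.Ioc (0 : ℝ) 1 := fun i =>
    ⟨(hτ i).1, (hτ i).2.trans (one_div_succ_mem_Ioc i).2⟩
  -- Undoing the homothety puts each bad point on a ray over the half-size cube. The bad points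
  -- therefore form a sequence of the class `ω`, along which `F` must converge to `f ω`.
  set y : ℕ → Fin n → ℝ := fun i => a + (τ i)⁻¹ • (z i - a) with hy
  have hzy : ∀ i, z i = AffineMap.lineMap a (y i) (τ i) := by
    intro i
    have := (hτ i).1.ne'
    simp [AffineMap.lineMap_apply, hy, smul_smul, this]
  have hyd : ∀ i, dist (y i) Q.center ≤ Q.radius / 2 := by
    intro i
    have h1 := Metric.mem_closedBall.1 (hz i)
    have h2 : z i - AffineMap.lineMap a Q.center (τ i) = τ i • (y i - Q.center) := by
      conv_lhs => rw [hzy i]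
      ext j
      simp [AffineMap.lineMap_apply]
      ring
    rw [dist_eq_norm, h2, norm_smul, Real.norm_eq_abs, abs_of_pos (hτ i).1, mul_div_assoc] at h1
    rw [dist_eq_norm]
    exact le_of_mul_le_mul_left h1 (hτ i).1
  have hmem := h.cone_mem_of_alphaVisible ω.2 hv hyd hτ1 hτ0
  have hlim := hf ω _ hmem
  have hlim2 : Tendsto (fun i => |F (z i) - f ω|) atTop (𝓝 0) := by
    have := (hlim.sub_const (f ω)).abs
    simp only [sub_self, abs_zero] at this
    refine this.congr fun i => ?_
    rw [hzy i]
  obtain ⟨i, hi⟩ := (hlim2.eventually (gt_mem_nhds hε)).exists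
  exact absurd hi (not_lt.2 (hzε i).le)

end IsProperDomain

end Average

end SobolevTrace

/-! ### The cone estimate. -/

namespace SobolevTrace

section Cone

variable {n : ℕ} {Ω : Set (Fin n → ℝ)} {α : ℝ} {F : (Fin n → ℝ) → ℝ} {G : (Fin n → ℝ) → Fin n → ℝ}

/-- Joint measurability on the product with the time variable needs a genuinely measurable function
on all of `ℝⁿ`. The condition on `φ` at zero makes the extension by zero harmless in every integral
used. -/
lemma exists_measurable_enorm (hΩ : IsOpen Ω) (hG : AEStronglyMeasurable G (volume.restrict Ω)) :
    ∃ g : (Fin n → ℝ) → ℝ≥0∞, Measurable g ∧ (∀ z ∉ Ω, g z = 0) ∧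
      ∀ φ : ℝ≥0∞ → (Fin n → ℝ) → ℝ≥0∞, (∀ z, φ 0 z = 0) →
        ∫⁻ z in Ω, φ ‖G z‖ₑ z = ∫⁻ z, φ (g z) z := by
  refine ⟨Ω.indicator (fun z => ‖hG.mk G z‖ₑ),
    (hG.stronglyMeasurable_mk.measurable.enorm).indicator hΩ.measurableSet,
    fun z hz => Set.indicator_of_notMem hz _, fun φ hφ => ?_⟩
  have h1 : ∀ z, φ (Ω.indicator (fun z => ‖hG.mk G z‖ₑ) z) z =
      Ω.indicator (fun z => φ ‖hG.mk G z‖ₑ z) z := by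
    intro z
    by_cases hz : z ∈ Ω
    · simp [hz]
    · simp [hz, hφ]
  simp_rw [h1]
  rw [lintegral_indicator hΩ.measurableSet]
  refine lintegral_congr_ae ?_
  filter_upwards [hG.ae_eq_mk] with z hz
  rw [hz]

/-- The kernel at time `t` in the cone with vertex `a` over the cube of centre `x` and
radius `r`. -/
noncomputable def coneKernel (a x : Fin n → ℝ) (r t : ℝ) (z : Fin n → ℝ) : ℝ :=
  kernel (AffineMap.lineMap a x t) (t * r) z

lemma measurable_coneKernel (a x : Fin n → ℝ) (r : ℝ) :
    Measurable fun q : ℝ × (Fin n → ℝ) => coneKernel a x r q.1 q.2 := by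
  unfold coneKernel kernel
  have hb : Measurable (bump n) := contDiff_bump.continuous.measurable
  have h1 : Measurable fun q : ℝ × (Fin n → ℝ) =>
      (q.1 * r)⁻¹ • (q.2 - (AffineMap.lineMap a x q.1 : Fin n → ℝ)) := by
    have h0 : Measurable fun q : ℝ × (Fin n → ℝ) => (q.1 * r)⁻¹ := by fun_prop
    have : Continuous fun q : ℝ × (Fin n → ℝ) => q.2 - (AffineMap.lineMap a x q.1 : Fin n → ℝ) := by
      simp only [AffineMap.lineMap_apply, vsub_eq_sub, vadd_eq_add]
      fun_prop
    exact h0.smul this.measurable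
  have h2 : Measurable fun q : ℝ × (Fin n → ℝ) => ((q.1 * r) ^ n)⁻¹ := by fun_prop
  exact h2.mul (hb.comp h1)

lemma coneKernel_nonneg (a x : Fin n → ℝ) {r t : ℝ} (hr : 0 < r) (ht : 0 < t) (z : Fin n → ℝ) :
    0 ≤ coneKernel a x r t z := kernel_nonneg _ (mul_pos ht hr) z

/-- The cube at time `t` is the image of `Q` under the homothety of ratio `t` about the vertex: `Q`
itself at time `1`, shrinking to the boundary as `t` tends to `0`, where the averages tend to the
trace. Stopping at a small positive `τ` keeps the motion inside `Ω`. -/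
lemma enorm_trace_sub_bumpAverage_le (h : IsProperDomain Ω α) (hF : ContinuousOn F Ω)
    (hw : IsWeakGradient Ω F G) {f : alphaBoundary Ω α → ℝ} (hf : IsTrace Ω α F f)
    (ω : alphaBoundary Ω α) {Q : Cube n} (hv : AlphaVisible Ω Q ω) {a : Fin n → ℝ}
    (ha : a = ell (ω : Set (ℕ → Fin n → ℝ))) {L : ℝ} (hL : dist a Q.center + Q.radius ≤ L)
    {g : (Fin n → ℝ) → ℝ≥0∞}
    (hg : ∀ φ : ℝ≥0∞ → (Fin n → ℝ) → ℝ≥0∞, (∀ z, φ 0 z = 0) →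
        ∫⁻ z in Ω, φ ‖G z‖ₑ z = ∫⁻ z, φ (g z) z) :
    ‖f ω - bumpAverage F Q.center Q.radius‖ₑ ≤ ENNReal.ofReal (n * L) *
      ∫⁻ t in Set.Ioc (0 : ℝ) 1, ∫⁻ z, g z * ENNReal.ofReal (coneKernel a Q.center Q.radius t z) := by
  have hr := Q.radius_pos
  refine ENNReal.le_of_forall_pos_le_add fun ε hε _ => ?_
  obtain ⟨τ, hτ, hτε⟩ := h.tendsto_bumpAverage_cone hF hf ω hv (ε := ε) (by exact_mod_cast hε)
  have h1 := hτε τ ⟨hτ.1, le_rfl⟩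
  rw [← ha] at h1
  have hline : ∀ t : ℝ, a + t • (Q.center - a) = AffineMap.lineMap a Q.center t := by
    intro t
    rw [AffineMap.lineMap_apply, vsub_eq_sub, vadd_eq_add, add_comm]
  have hst : IsStarBall Ω a Q.center Q.radius := by rw [ha]; exact hv.1.isStarBall
  have hpos : ∀ t ∈ Set.Icc τ 1, t ∈ Set.Ioc (0 : ℝ) 1 := fun t ht => ⟨hτ.1.trans_le ht.1, ht.2⟩
  have h2 := hw.enorm_bumpAverage_sub_le h.isOpen hF a (Q.center - a) 0 Q.radius hτ.2
    (fun t ht => by rw [zero_add]; exact mul_pos (hpos t ht).1 hr)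
    (fun t ht => by
      rw [zero_add, hline]
      exact h.closedBall_cone_subset hr hst (hpos t ht))
  simp only [hline, zero_add, one_mul, AffineMap.lineMap_apply_one] at h2
  have hL0 : 0 ≤ L := le_trans (add_nonneg dist_nonneg hr.le) hL
  have h3 : ∫⁻ t in Set.Icc τ 1, ∫⁻ z in Ω, ‖G z‖ₑ * ENNReal.ofReal (n * (‖Q.center - a‖ +
      |Q.radius|) * kernel (AffineMap.lineMap a Q.center t) (t * Q.radius) z) ≤
      ENNReal.ofReal (n * L) * ∫⁻ t in Set.Ioc (0 : ℝ) 1,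
        ∫⁻ z, g z * ENNReal.ofReal (coneKernel a Q.center Q.radius t z) := by
    rw [← lintegral_const_mul' _ _ ENNReal.ofReal_ne_top]
    refine (setLIntegral_mono' measurableSet_Icc fun t ht => ?_).trans
      (lintegral_mono_set fun t ht => hpos t ht)
    rw [hg (fun s z => s * ENNReal.ofReal (n * (‖Q.center - a‖ +
      |Q.radius|) * kernel (AffineMap.lineMap a Q.center t) (t * Q.radius) z)) (by simp),
      ← lintegral_const_mul' _ _ ENNReal.ofReal_ne_top]
    refine lintegral_mono fun z => ?_
    rw [mul_left_comm, ← ENNReal.ofReal_mul (by positivity)]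
    gcongr
    · exact coneKernel_nonneg a Q.center hr (hpos t ht).1 z
    · rw [abs_of_pos hr, ← dist_eq_norm, dist_comm]
      exact hL
    · exact le_rfl
  calc ‖f ω - bumpAverage F Q.center Q.radius‖ₑ
      ≤ ‖bumpAverage F (AffineMap.lineMap a Q.center τ) (τ * Q.radius) - f ω‖ₑ +
        ‖bumpAverage F Q.center Q.radius -
          bumpAverage F (AffineMap.lineMap a Q.center τ) (τ * Q.radius)‖ₑ := by
        rw [← enorm_neg (_ - f ω), ← enorm_neg (bumpAverage F Q.center Q.radius - _)]
        refine le_trans (le_of_eq ?_) (enorm_add_le _ _)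
        congr 1
        ring
    _ ≤ ε + ENNReal.ofReal (n * L) * ∫⁻ t in Set.Ioc (0 : ℝ) 1,
          ∫⁻ z, g z * ENNReal.ofReal (coneKernel a Q.center Q.radius t z) := by
        refine add_le_add ?_ (h2.trans h3)
        rw [← ofReal_norm, Real.norm_eq_abs, ← ENNReal.ofReal_coe_nnreal]
        exact ENNReal.ofReal_le_ofReal h1
    _ = _ := add_comm _ _

lemma lintegral_Ioc_rpow_neg {β : ℝ} (hβ : β < 1) :
    ∫⁻ t in Set.Ioc (0 : ℝ) 1, ENNReal.ofReal (t ^ (-β)) = ENNReal.ofReal (1 / (1 - β)) := by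
  have hInt : IntervalIntegrable (fun t : ℝ => t ^ (-β)) volume 0 1 :=
    intervalIntegral.intervalIntegrable_rpow' (by linarith)
  rw [← ofReal_integral_eq_lintegral_ofReal, ← intervalIntegral.integral_of_le zero_le_one,
    integral_rpow (Or.inl (by linarith))]
  · congr 1
    rw [Real.one_rpow, Real.zero_rpow (by linarith)]
    ring
  · exact (intervalIntegrable_iff_integrableOn_Ioc_of_le zero_le_one).1 hInt
  · refine (ae_restrict_iff' measurableSet_Ioc).2 (Eventually.of_forall fun t ht => ?_)
    exact Real.rpow_nonneg ht.1.le _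

/-- Hölder's inequality in time and space after inserting `t ^ β * t ^ (-β)`. The kernels have mass
one, so the dual factor is the integral of `t ^ (-β)`, finite for `β < 1`. The price is the weight
`t ^ (β * (p - 1))` beside `g ^ p`. -/
lemma coneIntegral_rpow_le {p : ℝ} (hp : 1 < p) {β : ℝ} (hβ1 : β < 1)
    (a x : Fin n → ℝ) {r : ℝ} (hr : 0 < r) {g : (Fin n → ℝ) → ℝ≥0∞} (hg : Measurable g) :
    (∫⁻ t in Set.Ioc (0 : ℝ) 1, ∫⁻ z, g z * ENNReal.ofReal (coneKernel a x r t z)) ^ p ≤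
      ENNReal.ofReal (1 / (1 - β)) ^ (p - 1) *
        ∫⁻ z, g z ^ p * ∫⁻ t in Set.Ioc (0 : ℝ) 1,
          ENNReal.ofReal (t ^ (β * (p - 1)) * coneKernel a x r t z) := by
  have hp0 : 0 < p := by linarith
  set μ : Measure (ℝ × (Fin n → ℝ)) := (volume.restrict (Set.Ioc (0 : ℝ) 1)).prod volume with hμ
  have hpos : ∀ᵐ q ∂μ, 0 < q.1 := by
    have h1 : ∀ᵐ t ∂(volume.restrict (Set.Ioc (0 : ℝ) 1)), 0 < t :=
      (ae_restrict_iff' measurableSet_Ioc).2 (Eventually.of_forall fun t ht => ht.1)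
    exact Measure.quasiMeasurePreserving_fst.ae h1
  have hck := measurable_coneKernel a x r
  have hm1 : Measurable fun q : ℝ × (Fin n → ℝ) => g q.2 * ENNReal.ofReal (q.1 ^ β) := by
    fun_prop
  have hm2 : Measurable fun q : ℝ × (Fin n → ℝ) =>
      ENNReal.ofReal (q.1 ^ (-β)) * ENNReal.ofReal (coneKernel a x r q.1 q.2) := by
    fun_prop
  have key := lintegral_mul_rpow_le μ hp hm1.aemeasurable hm2.aemeasurable
  have e1 : ∫⁻ t in Set.Ioc (0 : ℝ) 1, ∫⁻ z, g z * ENNReal.ofReal (coneKernel a x r t z) =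
      ∫⁻ q, g q.2 * ENNReal.ofReal (q.1 ^ β) *
        (ENNReal.ofReal (q.1 ^ (-β)) * ENNReal.ofReal (coneKernel a x r q.1 q.2)) ∂μ := by
    rw [← lintegral_prod (fun q : ℝ × (Fin n → ℝ) =>
      g q.2 * ENNReal.ofReal (coneKernel a x r q.1 q.2)) (by fun_prop)]
    refine lintegral_congr_ae ?_
    filter_upwards [hpos] with q hq
    rw [mul_assoc, ← mul_assoc (ENNReal.ofReal (q.1 ^ β)), ← ENNReal.ofReal_mul (by positivity),
      ← Real.rpow_add hq, add_neg_cancel, Real.rpow_zero, ENNReal.ofReal_one, one_mul]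
  have e2 : ∫⁻ q, (g q.2 * ENNReal.ofReal (q.1 ^ β)) ^ p *
      (ENNReal.ofReal (q.1 ^ (-β)) * ENNReal.ofReal (coneKernel a x r q.1 q.2)) ∂μ =
      ∫⁻ z, g z ^ p * ∫⁻ t in Set.Ioc (0 : ℝ) 1,
          ENNReal.ofReal (t ^ (β * (p - 1)) * coneKernel a x r t z) := by
    have hmm : Measurable fun q : ℝ × (Fin n → ℝ) => g q.2 ^ p *
        ENNReal.ofReal (q.1 ^ (β * (p - 1)) * coneKernel a x r q.1 q.2) := by fun_prop
    have e3 : ∀ z, g z ^ p * ∫⁻ t in Set.Ioc (0 : ℝ) 1,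
          ENNReal.ofReal (t ^ (β * (p - 1)) * coneKernel a x r t z) =
        ∫⁻ t in Set.Ioc (0 : ℝ) 1, g z ^ p *
          ENNReal.ofReal (t ^ (β * (p - 1)) * coneKernel a x r t z) := by
      intro z
      have hz : Measurable fun t : ℝ => coneKernel a x r t z :=
        hck.comp (measurable_id.prodMk measurable_const)
      rw [lintegral_const_mul _ (by fun_prop)]
    simp_rw [e3]
    rw [← lintegral_prod_symm (μ := volume.restrict (Set.Ioc (0 : ℝ) 1)) (ν := volume)
      (fun q : ℝ × (Fin n → ℝ) => g q.2 ^ p *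
        ENNReal.ofReal (q.1 ^ (β * (p - 1)) * coneKernel a x r q.1 q.2)) hmm.aemeasurable]
    refine lintegral_congr_ae ?_
    filter_upwards [hpos] with q hq
    rw [ENNReal.mul_rpow_of_nonneg _ _ hp0.le, ENNReal.ofReal_rpow_of_nonneg (by positivity) hp0.le,
      mul_assoc, ← mul_assoc (ENNReal.ofReal _), ← ENNReal.ofReal_mul (by positivity),
      ← Real.rpow_mul hq.le, ← Real.rpow_add hq, ← ENNReal.ofReal_mul (by positivity)]
    congr 4
    ring
  have e3 : ∫⁻ q, ENNReal.ofReal (q.1 ^ (-β)) * ENNReal.ofReal (coneKernel a x r q.1 q.2) ∂μ =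
      ENNReal.ofReal (1 / (1 - β)) := by
    rw [lintegral_prod _ hm2.aemeasurable, ← lintegral_Ioc_rpow_neg hβ1]
    refine setLIntegral_congr_fun measurableSet_Ioc fun t ht => ?_
    simp only
    rw [lintegral_const_mul' _ _ ENNReal.ofReal_ne_top]
    unfold coneKernel
    rw [lintegral_kernel _ (mul_pos ht.1 hr), mul_one]
  rw [e1, ← e2, ← e3, mul_comm]
  exact key

/-- The time spent at a point by the kernels of a cone. -/
lemma lintegral_coneKernel_le (h : IsProperDomain Ω α) {B : ℝ} (hB0 : 0 < B)
    (hB : ∀ u, bump n u ≤ B) {η s σ : ℝ} (hη : 0 < η) (hσ : 0 < σ) (hs : s = σ + n - 1)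
    {a x : Fin n → ℝ} {r : ℝ} (hr : 0 < r) (hst : IsStarBall Ω a x r) (ha : a ∈ frontier Ω)
    (hax : dist a x ≤ η * r) {z : Fin n → ℝ} (hz : z ∈ Ω) :
    ∫⁻ t in Set.Ioc (0 : ℝ) 1, ENNReal.ofReal (t ^ s * coneKernel a x r t z) ≤
      ENNReal.ofReal (2 * B * (η + 1) * 2 ^ σ * (r ^ n)⁻¹) *
        {z | dist x z ≤ (2 * η + 1) * r ∧
          Metric.infDist z (frontier Ω) ≤ (2 * η + 1) * r}.indicator
        (fun z => ENNReal.ofReal ((Metric.infDist z (frontier Ω) / r) ^ σ)) z := by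
  set d := Metric.infDist z (frontier Ω) with hd
  have hd0 : 0 < d := h.infDist_pos hz
  -- information on the times at which the kernel is active
  have hact : ∀ t ∈ Set.Ioc (0 : ℝ) 1, coneKernel a x r t z ≠ 0 →
      t * r / 2 ≤ d ∧ d ≤ (η + 1) * (t * r) ∧ dist x z ≤ (2 * η + 1) * r := by
    intro t ht hk
    have htr : 0 < t * r := mul_pos ht.1 hr
    have hlt : dist z (AffineMap.lineMap a x t : Fin n → ℝ) < t * r / 2 := by
      by_contra! hle
      exact hk (kernel_eq_zero htr hle)
    have h1 := h.mul_le_infDist_lineMap (y := x) hst ht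
    rw [dist_self, sub_zero] at h1
    have h2 := Metric.infDist_le_infDist_add_dist (s := frontier Ω)
      (x := (AffineMap.lineMap a x t : Fin n → ℝ)) (y := z)
    rw [dist_comm] at h2
    have h3 : dist (AffineMap.lineMap a x t : Fin n → ℝ) a ≤ t * (η * r) := by
      rw [dist_lineMap_left, Real.norm_eq_abs, abs_of_pos ht.1]
      exact mul_le_mul_of_nonneg_left hax ht.1.le
    have h4 : dist z a ≤ t * r / 2 + t * (η * r) :=
      (dist_triangle _ (AffineMap.lineMap a x t : Fin n → ℝ) _).trans (add_le_add hlt.le h3)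
    have h5 : d ≤ dist z a := Metric.infDist_le_dist_of_mem ha
    refine ⟨by linarith, by nlinarith, ?_⟩
    have h6 := dist_triangle x a z
    rw [dist_comm x a, dist_comm a z] at h6
    have h7 : t * r ≤ r := mul_le_of_le_one_left hr.le ht.2
    have h8 : t * (η * r) ≤ η * r := mul_le_of_le_one_left (by positivity) ht.2
    linarith
  by_cases hcond : dist x z ≤ (2 * η + 1) * r ∧ d ≤ (2 * η + 1) * r
  · rw [Set.indicator_of_mem (by exact hcond)]
    -- With `s = σ + n - 1` the integrand is at most a multiple of `r ^ (-n) * t ^ (σ - 1)`. Over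
    -- the active times, all comparable to `d / r`, it is bounded by a constant; times the length `2
    -- * d / r` this gives `(d / r) ^ σ`.
    have hbound : ∀ t ∈ Set.Ioc (0 : ℝ) 1, ENNReal.ofReal (t ^ s * coneKernel a x r t z) ≤
        (Set.Ioc (0 : ℝ) (2 * d / r)).indicator (fun _ => ENNReal.ofReal
          (B * (r ^ n)⁻¹ * ((2 * d / r) ^ σ * ((η + 1) * r / d)))) t := by
      intro t ht
      by_cases hk : coneKernel a x r t z = 0
      · rw [hk]; simp
      obtain ⟨k1, k2, k3⟩ := hact t ht hk
      have htle : t ≤ 2 * d / r := by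
        rw [le_div_iff₀ hr]; linarith
      have hmem : t ∈ Set.Ioc (0 : ℝ) (2 * d / r) := ⟨ht.1, htle⟩
      rw [Set.indicator_of_mem hmem]
      refine ENNReal.ofReal_le_ofReal ?_
      have htp := ht.1
      have e1 : t ^ s = t ^ σ * t ^ n * t⁻¹ := by
        rw [hs, Real.rpow_sub_one htp.ne', Real.rpow_add htp, Real.rpow_natCast]
        rfl
      have e2 : coneKernel a x r t z ≤ ((t * r) ^ n)⁻¹ * B := kernel_le hB _ (mul_pos htp hr) z
      have e3 : t⁻¹ ≤ (η + 1) * r / d := by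
        rw [le_div_iff₀ hd0, inv_mul_le_iff₀ htp]
        linarith
      calc t ^ s * coneKernel a x r t z ≤ t ^ s * (((t * r) ^ n)⁻¹ * B) := by gcongr
        _ = B * (r ^ n)⁻¹ * (t ^ σ * t⁻¹) := by
            rw [e1, mul_pow]
            field_simp
        _ ≤ _ := by gcongr
    refine (setLIntegral_mono' measurableSet_Ioc hbound).trans ?_
    refine (setLIntegral_le_lintegral _ _).trans ?_
    rw [lintegral_indicator measurableSet_Ioc, setLIntegral_const, Real.volume_Ioc, sub_zero,
      ← ENNReal.ofReal_mul (by positivity), ← ENNReal.ofReal_mul (by positivity)]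
    refine ENNReal.ofReal_le_ofReal (le_of_eq ?_)
    rw [show 2 * d / r = 2 * (d / r) by ring, Real.mul_rpow (by norm_num) (by positivity)]
    field_simp
    rw [hd]
  · have hz0 : ∀ t ∈ Set.Ioc (0 : ℝ) 1, ENNReal.ofReal (t ^ s * coneKernel a x r t z) = 0 := by
      intro t ht
      by_cases hk : coneKernel a x r t z = 0
      · rw [hk]; simp
      obtain ⟨k1, k2, k3⟩ := hact t ht hk
      refine absurd ⟨k3, ?_⟩ hcond
      have : t * r ≤ r := mul_le_of_le_one_left hr.le ht.2
      nlinarith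
    rw [setLIntegral_congr_fun measurableSet_Ioc hz0]
    simp

/-- The differences between the trace at visible elements and the averages over disjoint cubes are
controlled by the gradient. -/
theorem exists_cone_estimate (n : ℕ) {p : ℝ} (hn : 1 ≤ n) (hp : (n : ℝ) < p) {η : ℝ}
    (hη : 0 < η) : ∃ C : ℝ, 0 < C ∧ ∀ (Ω : Set (Fin n → ℝ)) (α : ℝ), IsProperDomain Ω α →
      ∀ (F : (Fin n → ℝ) → ℝ) (G : (Fin n → ℝ) → Fin n → ℝ), IsSobolev Ω p F G →
      ∀ f : alphaBoundary Ω α → ℝ, IsTrace Ω α F f →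
      ∀ (ι : Type) [Countable ι] (Q : ι → Cube n) (ω : ι → alphaBoundary Ω α),
      (Pairwise fun i j => Disjoint (Metric.ball (Q i).center (Q i).radius)
        (Metric.ball (Q j).center (Q j).radius)) →
      (∀ i, AlphaVisible Ω (Q i) (ω i)) →
      (∀ i, dist (ell (ω i : Set (ℕ → Fin n → ℝ))) (Q i).center ≤ η * (Q i).radius) →
      ∑' i, ‖f (ω i) - bumpAverage F (Q i).center (Q i).radius‖ₑ ^ p *
        ENNReal.ofReal ((Q i).radius ^ (n - p)) ≤
          ENNReal.ofReal C * ∫⁻ z in Ω, ‖G z‖ₑ ^ p := by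
  have hn' : (1 : ℝ) ≤ n := by exact_mod_cast hn
  have hp1 : 1 < p := by linarith
  have hp0 : 0 < p := by linarith
  -- Any `σ` strictly between `0` and `p - n` would do. Positivity is needed for the packing bound,
  -- and `σ < p - n` is equivalent to `β < 1`.
  set σ : ℝ := (p - n) / 2 with hσ
  have hσ0 : 0 < σ := by rw [hσ]; linarith
  set s : ℝ := σ + n - 1 with hs
  set β : ℝ := s / (p - 1) with hβ
  have hβ1 : β < 1 := by
    rw [hβ, div_lt_one (by linarith)]
    rw [hs, hσ]; linarith
  have hβs : β * (p - 1) = s := by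
    rw [hβ]; field_simp [show p - 1 ≠ 0 by linarith]
  obtain ⟨B, hB0, hB⟩ := exists_bump_le n
  obtain ⟨P, hP0, hP⟩ := exists_packing_bound n (A := 2 * η + 1) (by positivity) hσ0
  have h1β : 0 < 1 - β := by linarith
  set E : ℝ := (n * (η + 1)) ^ p * (1 / (1 - β)) ^ (p - 1) * (2 * B * (η + 1) * 2 ^ σ) with hE
  have hE0 : 0 < E := by positivity
  refine ⟨E * P, by positivity, ?_⟩
  intro Ω α h F G hS f hf ι _ Q ω hdisj hv hηQ
  obtain ⟨hF, -, hG, hw⟩ := hS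
  obtain ⟨g, hgm, hg0, hgi⟩ := exists_measurable_enorm h.isOpen hG.1
  set χ : ι → (Fin n → ℝ) → ℝ≥0∞ := fun i => {z | dist (Q i).center z ≤ (2 * η + 1) * (Q i).radius ∧
          Metric.infDist z (frontier Ω) ≤ (2 * η + 1) * (Q i).radius}.indicator
        (fun z => ENNReal.ofReal ((Metric.infDist z (frontier Ω) / (Q i).radius) ^ σ)) with hχ
  have hχm : ∀ i, Measurable (χ i) := by
    intro i
    have hdm : Measurable fun z : Fin n → ℝ => Metric.infDist z (frontier Ω) :=
      (Metric.continuous_infDist_pt _).measurable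
    have h1 : Measurable fun z : Fin n → ℝ =>
        ENNReal.ofReal ((Metric.infDist z (frontier Ω) / (Q i).radius) ^ σ) := by fun_prop
    have h2 : Measurable fun z : Fin n → ℝ => dist (Q i).center z := by fun_prop
    exact h1.indicator ((measurableSet_le h2 measurable_const).inter
      (measurableSet_le hdm measurable_const))
  have hterm : ∀ i, ‖f (ω i) - bumpAverage F (Q i).center (Q i).radius‖ₑ ^ p *
        ENNReal.ofReal ((Q i).radius ^ (n - p)) ≤ ENNReal.ofReal E * ∫⁻ z, g z ^ p * χ i z := by
    intro i
    have hr := (Q i).radius_pos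
    set r := (Q i).radius with hrdef
    set a := ell (ω i : Set (ℕ → Fin n → ℝ)) with ha
    have hst : IsStarBall Ω a (Q i).center r := (hv i).1.isStarBall
    have haf : a ∈ frontier Ω := h.ell_mem_frontier (ω i).2
    have k1 := enorm_trace_sub_bumpAverage_le h hF hw hf (ω i) (hv i) ha
      (L := (η + 1) * r) (by linarith [hηQ i]) hgi
    have k2 := coneIntegral_rpow_le hp1 hβ1 a (Q i).center hr hgm
    rw [hβs] at k2
    have k3 : ∫⁻ z, g z ^ p * ∫⁻ t in Set.Ioc (0 : ℝ) 1,
          ENNReal.ofReal (t ^ s * coneKernel a (Q i).center r t z) ≤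
        ENNReal.ofReal (2 * B * (η + 1) * 2 ^ σ * (r ^ n)⁻¹) * ∫⁻ z, g z ^ p * χ i z := by
      rw [← lintegral_const_mul' _ _ ENNReal.ofReal_ne_top]
      refine lintegral_mono fun z => ?_
      by_cases hz : z ∈ Ω
      · rw [mul_left_comm]
        exact mul_le_mul_right (lintegral_coneKernel_le h hB0 hB hη hσ0 hs hr hst haf (hηQ i) hz) _
      · rw [hg0 z hz, ENNReal.zero_rpow_of_pos hp0]; simp
    calc _ ≤ (ENNReal.ofReal (n * ((η + 1) * r)) * ∫⁻ t in Set.Ioc (0 : ℝ) 1, ∫⁻ z, g z *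
            ENNReal.ofReal (coneKernel a (Q i).center r t z)) ^ p * ENNReal.ofReal (r ^ (n - p)) := by
          gcongr
      _ ≤ ENNReal.ofReal (n * ((η + 1) * r)) ^ p * (ENNReal.ofReal (1 / (1 - β)) ^ (p - 1) *
            (ENNReal.ofReal (2 * B * (η + 1) * 2 ^ σ * (r ^ n)⁻¹) * ∫⁻ z, g z ^ p * χ i z)) *
              ENNReal.ofReal (r ^ (n - p)) := by
          rw [ENNReal.mul_rpow_of_nonneg _ _ hp0.le]
          gcongr
          exact k2.trans (by gcongr)
      _ = ENNReal.ofReal E * ∫⁻ z, g z ^ p * χ i z := by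
          rw [ENNReal.ofReal_rpow_of_nonneg (by positivity) hp0.le,
            ENNReal.ofReal_rpow_of_nonneg (by positivity) (by linarith), mul_right_comm,
            ← mul_assoc (ENNReal.ofReal ((1 / (1 - β)) ^ (p - 1))), ← mul_assoc,
            ← ENNReal.ofReal_mul (by positivity), ← ENNReal.ofReal_mul (by positivity),
            ← ENNReal.ofReal_mul (by positivity)]
          congr 2
          rw [hE, show (n : ℝ) * ((η + 1) * r) = n * (η + 1) * r by ring,
            Real.mul_rpow (by positivity) hr.le, Real.rpow_sub hr,
            Real.rpow_natCast]
          field_simp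
  -- Only here do different cubes interact: sum and integral are interchanged, and the packing bound
  -- is applied at each `z` with `ρ` equal to the distance of `z` from the boundary.
  calc _ ≤ ∑' i, ENNReal.ofReal E * ∫⁻ z, g z ^ p * χ i z := ENNReal.tsum_le_tsum hterm
    _ = ENNReal.ofReal E * ∫⁻ z, g z ^ p * ∑' i, χ i z := by
        rw [ENNReal.tsum_mul_left]
        congr 1
        simp_rw [← ENNReal.tsum_mul_left]
        exact (lintegral_tsum (f := fun i z => g z ^ p * χ i z)
          fun i => ((hgm.pow_const p).mul (hχm i)).aemeasurable).symm
    _ ≤ ENNReal.ofReal E * ∫⁻ z, g z ^ p * ENNReal.ofReal P := by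
        refine mul_le_mul_right (lintegral_mono fun z => ?_) _
        by_cases hz : z ∈ Ω
        · refine mul_le_mul_right ?_ _
          exact hP ι (fun i => (Q i).center) (fun i => (Q i).radius) (fun i => (Q i).radius_pos)
            hdisj z _ (h.infDist_pos hz)
        · rw [hg0 z hz, ENNReal.zero_rpow_of_pos hp0]; simp
    _ = ENNReal.ofReal (E * P) * ∫⁻ z in Ω, ‖G z‖ₑ ^ p := by
        rw [lintegral_mul_const' _ _ ENNReal.ofReal_ne_top,
          hgi (fun s _ => s ^ p) (fun _ => ENNReal.zero_rpow_of_pos hp0),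
          ENNReal.ofReal_mul hE0.le]
        ring

end Cone

end SobolevTrace

/-! ### Chains of cubes along a curve. -/

namespace SobolevTrace

section CurveLength

variable {n : ℕ} {Ω : Set (Fin n → ℝ)} {α : ℝ}

/-- The length of a Lipschitz curve dominates the distance between its end points. -/
lemma ofReal_dist_le_lintegral_deriv {γ : ℝ → Fin n → ℝ} {K : NNReal} {a b : ℝ} (hab : a ≤ b)
    (hK : LipschitzOnWith K γ (Set.Icc a b)) :
    ENNReal.ofReal (dist (γ b) (γ a)) ≤
      ∫⁻ t in Set.Ioc a b, ENNReal.ofReal (Real.sqrt (∑ i, (deriv γ t i) ^ 2)) := by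
  set I := ∫⁻ t in Set.Ioc a b, ENNReal.ofReal (Real.sqrt (∑ i, (deriv γ t i) ^ 2)) with hI
  by_cases htop : I = ⊤
  · rw [htop]; exact le_top
  have hdiff : ∀ᵐ t ∂volume.restrict (Set.Ioc a b), DifferentiableAt ℝ γ t := by
    rw [← restrict_Ioo_eq_restrict_Ioc, ae_restrict_iff' measurableSet_Ioo]
    filter_upwards [hK.ae_differentiableWithinAt_of_mem_real] with t ht hmem
    exact (ht (Set.Ioo_subset_Icc_self hmem)).differentiableAt (Icc_mem_nhds hmem.1 hmem.2)
  have hcoord : ∀ i, |γ b i - γ a i| ≤ I.toReal := by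
    intro i
    have hlip : LipschitzOnWith K (fun t => γ t i) (Set.uIcc a b) := by
      rw [Set.uIcc_of_le hab]
      refine LipschitzOnWith.of_dist_le_mul fun s hs t ht => ?_
      exact (dist_le_pi_dist _ _ i).trans (hK.dist_le_mul s hs t ht)
    have hftc := hlip.absolutelyContinuousOnInterval.integral_deriv_eq_sub
    rw [intervalIntegral.integral_of_le hab] at hftc
    rw [← hftc]
    refine (ENNReal.ofReal_le_iff_le_toReal htop).1 ?_
    have h1 := enorm_integral_le_lintegral_enorm (μ := volume.restrict (Set.Ioc a b))
      (fun t => deriv (fun s => γ s i) t)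
    rw [← ofReal_norm, Real.norm_eq_abs] at h1
    refine h1.trans ?_
    refine lintegral_mono_ae ?_
    filter_upwards [hdiff] with t ht
    have : deriv (fun s => γ s i) t = deriv γ t i :=
      ((hasDerivAt_pi.1 ht.hasDerivAt) i).deriv
    rw [this, ← ofReal_norm]
    refine ENNReal.ofReal_le_ofReal ?_
    exact (norm_le_pi_norm (deriv γ t) i).trans (norm_le_sqrt_sum_sq _)
  refine (ENNReal.ofReal_le_iff_le_toReal htop).2 ?_
  rw [dist_eq_norm]
  exact (pi_norm_le_iff_of_nonneg ENNReal.toReal_nonneg).2 hcoord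

/-- A curve leaving the cube of radius `d(x) / 8` around `x` has subhyperbolic length at least
`c d(x) ^ α` there. -/
lemma le_subhypLengthOn_of_exit (hα : 0 < α) (hα1 : α ≤ 1) {γ : ℝ → Fin n → ℝ} {K : NNReal}
    {a b : ℝ} (hab : a ≤ b) (hK : LipschitzOnWith K γ (Set.Icc a b))
    (hΩ : ∀ t ∈ Set.Icc a b, 0 < Metric.infDist (γ t) (frontier Ω)) {r : ℝ} (hr : 0 < r)
    (hrd : Metric.infDist (γ a) (frontier Ω) = 8 * r) (hexit : r ≤ dist (γ b) (γ a)) :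
    ENNReal.ofReal (r ^ α / 9) ≤ subhypLengthOn Ω α γ (Set.Ioc a b) := by
  set S : Set ℝ := {t ∈ Set.Icc a b | r ≤ dist (γ t) (γ a)} with hS
  have hcont : ContinuousOn (fun t => dist (γ t) (γ a)) (Set.Icc a b) :=
    continuous_dist.comp_continuousOn (hK.continuousOn.prodMk continuousOn_const)
  have hSc : IsCompact S := by
    have : S = Set.Icc a b ∩ (fun t => dist (γ t) (γ a)) ⁻¹' Set.Ici r := rfl
    rw [this]
    exact isCompact_Icc.of_isClosed_subset (hcont.preimage_isClosed_of_isClosed isClosed_Icc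
      isClosed_Ici) Set.inter_subset_left
  -- Up to the first exit time `e` the curve stays within `r` of its start, so its distance to the
  -- boundary is at most `8 * r + r = 9 * r`. The weight is then at least `(9 * r) ^ (α - 1)`, over
  -- a length of at least `r`.
  obtain ⟨e, he, hleast⟩ := hSc.exists_isLeast ⟨b, ⟨hab, le_rfl⟩, hexit⟩
  have hle : ∀ t ∈ Set.Ioc a e, dist (γ t) (γ a) ≤ r := by
    intro t ht
    have hopen : ∀ s ∈ Set.Ico a e, dist (γ s) (γ a) ≤ r := by
      intro s hs
      by_contra! hlt
      exact absurd (hleast ⟨⟨hs.1, hs.2.le.trans he.1.2⟩, hlt.le⟩) (not_le.2 hs.2)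
    rcases lt_or_eq_of_le ht.2 with h | h
    · exact hopen t ⟨ht.1.le, h⟩
    · subst h
      have hc : ContinuousWithinAt (fun s => dist (γ s) (γ a)) (Set.Ico a t) t :=
        (hcont t he.1).mono fun s hs => ⟨hs.1, hs.2.le.trans he.1.2⟩
      have : (𝓝[Set.Ico a t] t).NeBot := by
        rw [← mem_closure_iff_nhdsWithin_neBot, closure_Ico ht.1.ne]
        exact ⟨ht.1.le, le_rfl⟩
      exact le_of_tendsto hc (eventually_mem_nhdsWithin.mono hopen)
  have hlen := ofReal_dist_le_lintegral_deriv he.1.1 (hK.mono (Set.Icc_subset_Icc_right he.1.2))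
  have h9 : (0 : ℝ) < (9 * r) ^ (α - 1) := by positivity
  calc ENNReal.ofReal (r ^ α / 9) ≤ ENNReal.ofReal ((9 * r) ^ (α - 1)) *
        ENNReal.ofReal (dist (γ e) (γ a)) := by
        rw [← ENNReal.ofReal_mul h9.le]
        refine ENNReal.ofReal_le_ofReal ?_
        have h1 : (9 : ℝ) ^ (-1 : ℝ) ≤ 9 ^ (α - 1) :=
          Real.rpow_le_rpow_of_exponent_le (by norm_num) (by linarith)
        rw [Real.rpow_neg_one] at h1
        calc r ^ α / 9 = 9⁻¹ * r ^ (α - 1) * r := by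
              rw [Real.rpow_sub_one hr.ne']; field_simp
          _ ≤ 9 ^ (α - 1) * r ^ (α - 1) * dist (γ e) (γ a) := by
              have := he.2
              gcongr
          _ = _ := by rw [Real.mul_rpow (by norm_num) hr.le]
    _ ≤ ENNReal.ofReal ((9 * r) ^ (α - 1)) *
        ∫⁻ t in Set.Ioc a e, ENNReal.ofReal (Real.sqrt (∑ i, (deriv γ t i) ^ 2)) := by
        gcongr
    _ = ∫⁻ t in Set.Ioc a e,
          ENNReal.ofReal ((9 * r) ^ (α - 1) * Real.sqrt (∑ i, (deriv γ t i) ^ 2)) := by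
        rw [← lintegral_const_mul' _ _ ENNReal.ofReal_ne_top]
        refine lintegral_congr fun t => ?_
        rw [ENNReal.ofReal_mul h9.le]
    _ ≤ subhypLengthOn Ω α γ (Set.Ioc a e) := by
        refine setLIntegral_mono' measurableSet_Ioc fun t ht => ENNReal.ofReal_le_ofReal ?_
        refine mul_le_mul_of_nonneg_right ?_ (Real.sqrt_nonneg _)
        refine Real.rpow_le_rpow_of_nonpos (hΩ t ⟨ht.1.le, ht.2.trans he.1.2⟩) ?_ (by linarith)
        have := Metric.infDist_le_infDist_add_dist (s := frontier Ω) (x := γ t) (y := γ a)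
        linarith [hle t ht]
    _ ≤ _ := lintegral_mono_set (Set.Ioc_subset_Ioc_right he.1.2)

lemma sum_subhypLengthOn_Ioc (γ : ℝ → Fin n → ℝ) {t : ℕ → ℝ} (ht : Monotone t) (N : ℕ) :
    ∑ k ∈ Finset.range N, subhypLengthOn Ω α γ (Set.Ioc (t k) (t (k + 1))) =
      subhypLengthOn Ω α γ (Set.Ioc (t 0) (t N)) := by
  induction N with
  | zero => simp [subhypLengthOn]
  | succ N ih =>
    rw [Finset.sum_range_succ, ih]
    unfold subhypLengthOn
    rw [← Set.Ioc_union_Ioc_eq_Ioc (ht (Nat.zero_le N)) (ht (Nat.le_succ N)),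
      lintegral_union measurableSet_Ioc]
    rw [Set.Ioc_disjoint_Ioc]
    exact (min_le_left _ _).trans (le_max_right _ _)

/-- A curve can be covered by a chain of cubes with comparable distances to the boundary, centred at
well separated points of the curve. -/
lemma exists_chain (h : IsProperDomain Ω α) {x y : Fin n → ℝ} {γ : ℝ → Fin n → ℝ}
    (hγ : IsCurveJoining Ω x y γ) :
    ∃ (m : ℕ) (X : ℕ → Fin n → ℝ), X 0 = x ∧ X m = y ∧ (∀ k, X k ∈ Ω) ∧
      (∀ k < m, dist (X (k + 1)) (X k) ≤ Metric.infDist (X k) (frontier Ω) / 8) ∧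
      (∀ j k, k < j → j < m → Metric.infDist (X k) (frontier Ω) / 8 ≤ dist (X j) (X k)) ∧
      ∑ k ∈ Finset.range (m - 1), ENNReal.ofReal ((Metric.infDist (X k) (frontier Ω) / 8) ^ α / 9) ≤
        subhypLength Ω α γ := by
  obtain ⟨⟨K, hK⟩, hmΩ, h0, h1⟩ := hγ
  have hcont := hK.continuousOn
  have hdist : ∀ z : Fin n → ℝ, ContinuousOn (fun t => dist (γ t) z) (Set.Icc 0 1) := fun z =>
    continuous_dist.comp_continuousOn (hcont.prodMk continuousOn_const)
  have hdcont : ContinuousOn (fun t => Metric.infDist (γ t) (frontier Ω)) (Set.Icc 0 1) :=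
    (Metric.continuous_infDist_pt _).comp_continuousOn hcont
  obtain ⟨t₀, ht₀, hmin⟩ := isCompact_Icc.exists_isMinOn ⟨0, ⟨le_rfl, zero_le_one⟩⟩ hdcont
  set ρ := Metric.infDist (γ t₀) (frontier Ω) with hρ
  have hρ0 : 0 < ρ := h.infDist_pos (hmΩ t₀ ht₀)
  have hρle : ∀ t ∈ Set.Icc (0 : ℝ) 1, ρ ≤ Metric.infDist (γ t) (frontier Ω) := fun t ht => hmin ht
  set S : ℝ → Set ℝ := fun s =>
    {t ∈ Set.Icc (0 : ℝ) 1 | dist (γ t) (γ s) ≤ Metric.infDist (γ s) (frontier Ω) / 8} with hS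
  -- The last visit, not the first exit: the curve never returns to the cube afterwards, so every
  -- later centre is separated from this one.
  set nxt : ℝ → ℝ := fun s => sSup (S s) with hnxt
  have hSbdd : ∀ s, BddAbove (S s) := fun s => ⟨1, fun t ht => ht.1.2⟩
  have hself : ∀ s ∈ Set.Icc (0 : ℝ) 1, s ∈ S s := by
    intro s hs
    refine ⟨hs, ?_⟩
    rw [dist_self]
    have := Metric.infDist_nonneg (x := γ s) (s := frontier Ω)
    positivity
  have hScompact : ∀ s, IsCompact (S s) := by
    intro s
    have : S s = Set.Icc 0 1 ∩ (fun t => dist (γ t) (γ s)) ⁻¹'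
      Set.Iic (Metric.infDist (γ s) (frontier Ω) / 8) := rfl
    rw [this]
    exact isCompact_Icc.of_isClosed_subset ((hdist (γ s)).preimage_isClosed_of_isClosed
      isClosed_Icc isClosed_Iic) Set.inter_subset_left
  have hnmem : ∀ s ∈ Set.Icc (0 : ℝ) 1, nxt s ∈ S s := fun s hs =>
    (hScompact s).sSup_mem ⟨s, hself s hs⟩
  have hnle : ∀ s ∈ Set.Icc (0 : ℝ) 1, s ≤ nxt s := fun s hs => le_csSup (hSbdd s) (hself s hs)
  have hout : ∀ s, ∀ t ∈ Set.Icc (0 : ℝ) 1, nxt s < t →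
      Metric.infDist (γ s) (frontier Ω) / 8 < dist (γ t) (γ s) := by
    intro s t ht hlt
    by_contra! hle
    exact absurd (le_csSup (hSbdd s) ⟨ht, hle⟩) (not_le.2 hlt)
  -- A lower bound for the time gained in each step, from the Lipschitz constant and the least
  -- distance to the boundary along the curve; it makes the chain finite. The summand `1` avoids
  -- division by zero.
  set δ : ℝ := ρ / (8 * (K + 1)) with hδ
  have hδ0 : 0 < δ := by positivity
  have hstep : ∀ s ∈ Set.Icc (0 : ℝ) 1, min 1 (s + δ) ≤ nxt s := by
    intro s hs
    have hu : min 1 (s + δ) ∈ Set.Icc (0 : ℝ) 1 :=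
      ⟨le_min zero_le_one (by linarith [hs.1]), min_le_left _ _⟩
    refine le_csSup (hSbdd s) ⟨hu, ?_⟩
    refine (hK.dist_le_mul _ hu _ hs).trans ?_
    have hsu : s ≤ min 1 (s + δ) := le_min hs.2 (by linarith)
    rw [Real.dist_eq, abs_of_nonneg (by linarith)]
    have h2 : min 1 (s + δ) - s ≤ δ := by linarith [min_le_right 1 (s + δ)]
    calc (K : ℝ) * (min 1 (s + δ) - s) ≤ (K + 1) * δ := by
          refine mul_le_mul (by linarith) h2 (by linarith) (by positivity)
      _ = ρ / 8 := by rw [hδ]; field_simp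
      _ ≤ _ := by linarith [hρle s hs]
  set t : ℕ → ℝ := fun k => nxt^[k] 0 with ht
  have ht0 : t 0 = 0 := rfl
  have htsucc : ∀ k, t (k + 1) = nxt (t k) := fun k => Function.iterate_succ_apply' nxt k 0
  have htmem : ∀ k, t k ∈ Set.Icc (0 : ℝ) 1 := by
    intro k
    induction k with
    | zero => rw [ht0]; exact ⟨le_rfl, zero_le_one⟩
    | succ k ih => rw [htsucc]; exact (hnmem _ ih).1
  have htmono : Monotone t := monotone_nat_of_le_succ fun k => by
    rw [htsucc]; exact hnle _ (htmem k)
  have htlow : ∀ k : ℕ, min 1 (k * δ) ≤ t k := by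
    intro k
    induction k with
    | zero => simp [ht0]
    | succ k ih =>
      rw [htsucc]
      refine le_trans ?_ (hstep _ (htmem k))
      push_cast
      rcases le_total 1 (k * δ) with hk | hk
      · rw [min_eq_left hk] at ih
        exact (min_le_left _ _).trans (le_min le_rfl (by linarith))
      · rw [min_eq_right hk] at ih
        exact min_le_min le_rfl (by linarith)
  have hex : ∃ m, t m = 1 := by
    obtain ⟨k, hk⟩ := exists_nat_gt (1 / δ)
    refine ⟨k, le_antisymm (htmem k).2 ?_⟩
    have : 1 ≤ k * δ := by
      rw [div_lt_iff₀ hδ0] at hk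
      exact hk.le
    rw [← min_eq_left this]
    exact htlow k
  classical
  set m := Nat.find hex with hm
  have htm : t m = 1 := Nat.find_spec hex
  have hlt1 : ∀ k < m, t k < 1 := fun k hk => lt_of_le_of_ne (htmem k).2 (Nat.find_min hex hk)
  -- For `j = k + 1` the centre is itself in the closed cube, so the strict bound at later times is
  -- passed to the limit from the right. This needs `t j < 1`, that is, `j < m`.
  have hsep : ∀ j k, k < j → j < m →
      Metric.infDist (γ (t k)) (frontier Ω) / 8 ≤ dist (γ (t j)) (γ (t k)) := by
    intro j k hkj hjm
    have hle : t (k + 1) ≤ t j := htmono hkj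
    have hc : ContinuousWithinAt (fun s => dist (γ s) (γ (t k))) (Set.Ioc (t j) 1) (t j) :=
      (hdist (γ (t k)) (t j) (htmem j)).mono fun s hs =>
        ⟨(htmem j).1.trans hs.1.le, hs.2⟩
    have : (𝓝[Set.Ioc (t j) 1] (t j)).NeBot := by
      rw [← mem_closure_iff_nhdsWithin_neBot, closure_Ioc (hlt1 j hjm).ne]
      exact ⟨le_rfl, (htmem j).2⟩
    refine ge_of_tendsto hc (eventually_mem_nhdsWithin.mono fun s hs => ?_)
    refine (hout (t k) s ⟨(htmem j).1.trans hs.1.le, hs.2⟩ ?_).le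
    rw [← htsucc]
    exact hle.trans_lt hs.1
  refine ⟨m, fun k => γ (t k), by simp only [ht0]; exact h0, by simp only [htm]; exact h1,
    fun k => hmΩ _ (htmem k), fun k _ => ?_, hsep, ?_⟩
  · simp only
    rw [htsucc]
    exact (hnmem _ (htmem k)).2
  · calc _ ≤ ∑ k ∈ Finset.range (m - 1), subhypLengthOn Ω α γ (Set.Ioc (t k) (t (k + 1))) := by
          refine Finset.sum_le_sum fun k hk => ?_
          -- The last step may end inside its cube, so only the first `m - 1` steps have to pay for
          -- an exit.
          have hkm : k + 1 < m := by
            have := Finset.mem_range.1 hk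
            omega
          have hdp := h.infDist_pos (hmΩ _ (htmem k))
          have hsub : Set.Icc (t k) (t (k + 1)) ⊆ Set.Icc 0 1 :=
            Set.Icc_subset_Icc (htmem k).1 (htmem (k + 1)).2
          refine le_subhypLengthOn_of_exit h.pos h.le_one (htmono (Nat.le_succ k))
            (hK.mono hsub) (fun s hs => h.infDist_pos (hmΩ s (hsub hs))) (by positivity) (by ring) ?_
          exact hsep (k + 1) k (Nat.lt_succ_self k) hkm
      _ = subhypLengthOn Ω α γ (Set.Ioc (t 0) (t (m - 1))) := sum_subhypLengthOn_Ioc γ htmono _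
      _ ≤ subhypLength Ω α γ := by
          rw [← subhypLengthOn_Icc]
          refine lintegral_mono_set fun s hs => ⟨?_, hs.2.trans (htmem _).2⟩
          rw [ht0] at hs
          exact hs.1.le

end CurveLength

end SobolevTrace

/-! ### Averages along a chain and continuity of the trace. -/

namespace SobolevTrace

lemma sum_mul_rpow_le {p : ℝ} (hp : 1 < p) (m : ℕ) (g k : ℕ → ℝ≥0∞) :
    (∑ i ∈ Finset.range m, g i * k i) ^ p ≤
      (∑ i ∈ Finset.range m, g i ^ p * k i) * (∑ i ∈ Finset.range m, k i) ^ (p - 1) := by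
  have := lintegral_mul_rpow_le (Measure.count : Measure (Fin m)) hp
    (g := fun i => g i) (k := fun i => k i) (by fun_prop) (by fun_prop)
  simpa only [lintegral_count, tsum_fintype, Finset.sum_range] using this

section Chain

/-- The variation of the averages between neighbouring cubes. -/
lemma exists_step_estimate (n : ℕ) {p : ℝ} (hp : 1 < p) :
    ∃ C : ℝ, 0 < C ∧ ∀ (Ω : Set (Fin n → ℝ)) (α : ℝ), IsProperDomain Ω α →
      ∀ (F : (Fin n → ℝ) → ℝ) (G : (Fin n → ℝ) → Fin n → ℝ), IsSobolev Ω p F G →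
      ∀ (x y : Fin n → ℝ) (r : ℝ), x ∈ Ω → r = Metric.infDist x (frontier Ω) / 8 → dist y x ≤ r →
      ‖bumpAverage F y (Metric.infDist y (frontier Ω) / 8) - bumpAverage F x r‖ₑ ^ p ≤
        ENNReal.ofReal (C * r ^ (p - n)) * ∫⁻ z in Metric.closedBall x (2 * r), ‖G z‖ₑ ^ p := by
  obtain ⟨B, hB0, hB⟩ := exists_bump_le n
  have hp0 : 0 < p := by linarith
  refine ⟨((n + 1) * (2 * (2 ^ n * B))) ^ p * (4 ^ n) ^ (p - 1), by positivity, ?_⟩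
  intro Ω α h F G hS x y r hx hr hyx
  obtain ⟨hF, -, hG, hw⟩ := hS
  have hd := h.infDist_pos hx
  have hr0 : 0 < r := by rw [hr]; positivity
  have hdx : Metric.infDist x (frontier Ω) = 8 * r := by rw [hr]; ring
  set w := Metric.infDist y (frontier Ω) / 8 - r with hwdef
  -- The distance to the boundary is 1-Lipschitz and the averaging radius is an eighth of it. So
  -- along the motion the radius stays between `r / 2` and `2 * r`, and the supports stay in the
  -- cube of radius `2 * r`.
  have hwr : |w| ≤ r / 8 := by
    have h1 := Metric.infDist_le_infDist_add_dist (s := frontier Ω) (x := x) (y := y)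
    have h2 := Metric.infDist_le_infDist_add_dist (s := frontier Ω) (x := y) (y := x)
    rw [dist_comm] at h1
    rw [abs_le]
    constructor <;> linarith
  have hwr' := abs_le.1 hwr
  have hrt : ∀ t ∈ Set.Icc (0 : ℝ) 1, r / 2 ≤ r + t * w ∧ r + t * w ≤ 2 * r := by
    intro t ht
    have : |t * w| ≤ r / 8 := by
      rw [abs_mul, abs_of_nonneg ht.1]
      exact (mul_le_of_le_one_left (abs_nonneg w) ht.2).trans hwr
    have := abs_le.1 this
    constructor <;> linarith
  have hball : ∀ t ∈ Set.Icc (0 : ℝ) 1, Metric.closedBall (x + t • (y - x)) ((r + t * w) / 2) ⊆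
      Metric.closedBall x (2 * r) := by
    intro t ht
    refine Metric.closedBall_subset_closedBall' ?_
    rw [dist_eq_norm, add_sub_cancel_left, norm_smul, Real.norm_eq_abs, abs_of_nonneg ht.1,
      ← dist_eq_norm]
    have := (mul_le_of_le_one_left dist_nonneg ht.2).trans hyx
    linarith [(hrt t ht).2]
  have hsubΩ : Metric.closedBall x (2 * r) ⊆ Ω := fun z hz =>
    h.mem_of_dist_lt hx (by have := Metric.mem_closedBall.1 hz; linarith)
  have key := hw.enorm_bumpAverage_sub_le h.isOpen hF x (y - x) r w zero_le_one
    (fun t ht => by linarith [(hrt t ht).1]) (fun t ht => (hball t ht).trans hsubΩ)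
  have e1 : r + 1 * w = Metric.infDist y (frontier Ω) / 8 := by rw [hwdef]; ring
  have e2 : r + 0 * w = r := by ring
  have e3 : x + (1 : ℝ) • (y - x) = y := by simp
  have e4 : x + (0 : ℝ) • (y - x) = x := by simp
  rw [e1, e2, e3, e4] at key
  set M : ℝ := (n + 1) * (2 * r) * ((r ^ n)⁻¹ * (2 ^ n * B)) with hM
  have hM0 : 0 ≤ M := by positivity
  have hinner : ∀ t ∈ Set.Icc (0 : ℝ) 1, ∫⁻ z in Ω, ‖G z‖ₑ * ENNReal.ofReal
      (n * (‖y - x‖ + |w|) * kernel (x + t • (y - x)) (r + t * w) z) ≤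
      ENNReal.ofReal M * ∫⁻ z in Metric.closedBall x (2 * r), ‖G z‖ₑ := by
    intro t ht
    have hrp : 0 < r + t * w := by linarith [(hrt t ht).1]
    rw [← lintegral_const_mul' _ _ ENNReal.ofReal_ne_top,
      ← lintegral_indicator measurableSet_closedBall]
    refine (setLIntegral_le_lintegral _ _).trans (lintegral_mono fun z => ?_)
    by_cases hz : z ∈ Metric.closedBall x (2 * r)
    · rw [Set.indicator_of_mem hz, mul_comm]
      refine mul_le_mul_left (ENNReal.ofReal_le_ofReal ?_) _
      have k1 : kernel (x + t • (y - x)) (r + t * w) z ≤ (r ^ n)⁻¹ * (2 ^ n * B) := by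
        refine (kernel_le hB _ hrp z).trans ?_
        rw [← mul_assoc]
        refine mul_le_mul_of_nonneg_right ?_ hB0.le
        have e : (r ^ n)⁻¹ * 2 ^ n = ((r / 2) ^ n)⁻¹ := by
          rw [div_pow, inv_div]; field_simp
        rw [e]
        exact inv_anti₀ (by positivity) (pow_le_pow_left₀ (by positivity) (hrt t ht).1 n)
      have k2 : ‖y - x‖ + |w| ≤ 2 * r := by
        rw [← dist_eq_norm]; linarith
      have k3 := kernel_nonneg (x + t • (y - x)) hrp z
      have k4 : (n : ℝ) ≤ n + 1 := by linarith
      rw [hM]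
      gcongr
    · rw [Set.indicator_of_notMem hz, kernel_eq_zero hrp]
      · simp
      · by_contra! hlt
        exact hz (hball t ht (Metric.mem_closedBall.2 hlt.le))
  have key2 : ‖bumpAverage F y (Metric.infDist y (frontier Ω) / 8) - bumpAverage F x r‖ₑ ≤
      ENNReal.ofReal M * ∫⁻ z in Metric.closedBall x (2 * r), ‖G z‖ₑ := by
    refine key.trans ((setLIntegral_mono' measurableSet_Icc hinner).trans ?_)
    rw [setLIntegral_const, Real.volume_Icc]
    simp
  have hGm : AEMeasurable (fun z => ‖G z‖ₑ) (volume.restrict (Metric.closedBall x (2 * r))) :=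
    (hG.1.mono_measure (Measure.restrict_mono hsubΩ le_rfl)).enorm
  have hold := lintegral_mul_rpow_le (volume.restrict (Metric.closedBall x (2 * r))) hp
    (g := fun z => ‖G z‖ₑ) (k := fun _ => 1) hGm aemeasurable_const
  simp only [mul_one, setLIntegral_const, one_mul] at hold
  rw [Real.volume_pi_closedBall _ (by positivity)] at hold
  calc _ ≤ (ENNReal.ofReal M * ∫⁻ z in Metric.closedBall x (2 * r), ‖G z‖ₑ) ^ p := by gcongr
    _ ≤ ENNReal.ofReal M ^ p * ((∫⁻ z in Metric.closedBall x (2 * r), ‖G z‖ₑ ^ p) *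
        ENNReal.ofReal ((2 * (2 * r)) ^ Fintype.card (Fin n)) ^ (p - 1)) := by
        rw [ENNReal.mul_rpow_of_nonneg _ _ hp0.le]
        gcongr
    _ = _ := by
        rw [ENNReal.ofReal_rpow_of_nonneg hM0 hp0.le,
          ENNReal.ofReal_rpow_of_nonneg (by positivity) (by linarith), mul_left_comm, mul_comm,
          ← ENNReal.ofReal_mul (by positivity)]
        congr 2
        have m1 : M = ((n + 1) * (2 * (2 ^ n * B))) * (r * (r ^ n)⁻¹) := by rw [hM]; ring
        have m2 : (2 * (2 * r)) ^ Fintype.card (Fin n) = 4 ^ n * r ^ n := by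
          rw [Fintype.card_fin, ← mul_pow]; congr 1; ring
        rw [m1, m2, Real.mul_rpow (by positivity) (by positivity),
          Real.mul_rpow (x := 4 ^ n) (by positivity) (by positivity)]
        have m3 : (r * (r ^ n)⁻¹) ^ p * (r ^ n) ^ (p - 1) = r ^ (p - n) := by
          rw [Real.mul_rpow hr0.le (by positivity), Real.inv_rpow (by positivity),
            Real.rpow_sub_one (by positivity), Real.rpow_sub hr0, Real.rpow_natCast]
          field_simp
        rw [← m3]
        ring

/-- The averages of a Sobolev function over Whitney cubes are Hölder continuous with respect to
the subhyperbolic metric. -/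
lemma exists_chain_estimate (n : ℕ) {p : ℝ} (hp : 1 < p) :
    ∃ C : ℝ, 0 < C ∧ ∀ (Ω : Set (Fin n → ℝ)) (α : ℝ), IsProperDomain Ω α → α * (p - 1) = p - n →
      ∀ (F : (Fin n → ℝ) → ℝ) (G : (Fin n → ℝ) → Fin n → ℝ), IsSobolev Ω p F G →
      ∀ (x y : Fin n → ℝ) (δ : ℝ), x ∈ Ω → y ∈ Ω → subhypDist Ω α x y < δ →
      ‖bumpAverage F y (Metric.infDist y (frontier Ω) / 8) -
        bumpAverage F x (Metric.infDist x (frontier Ω) / 8)‖ₑ ^ p ≤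
        ENNReal.ofReal C * ENNReal.ofReal (27 * δ + Metric.infDist x (frontier Ω) ^ α) ^ (p - 1) *
          ∫⁻ z in Ω, ‖G z‖ₑ ^ p := by
  obtain ⟨C, hC0, hC⟩ := exists_step_estimate n hp
  obtain ⟨P, hP0, hP⟩ := exists_packing_bound n (A := 30) (σ := 1) (by norm_num) one_pos
  have hp0 : 0 < p := by linarith
  refine ⟨C * P, by positivity, ?_⟩
  intro Ω α h hα F G hS x y δ hx hy hδ
  have hδ0 : 0 < δ := (subhypDist_nonneg x y).trans_lt hδ
  have hlt : subhypEDist Ω α x y < ENNReal.ofReal δ := by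
    rw [← ENNReal.ofReal_toReal (subhypEDist_lt_top h.isOpen h.isConnected h.frontier_nonempty h.pos
      h.le_one hx hy).ne]
    exact (ENNReal.ofReal_lt_ofReal_iff hδ0).2 hδ
  unfold subhypEDist at hlt
  rw [iInf_lt_iff] at hlt
  obtain ⟨γ, hγ⟩ := hlt
  rw [iInf_lt_iff] at hγ
  obtain ⟨hjoin, hlen⟩ := hγ
  obtain ⟨m, X, hX0, hXm, hXΩ, hstep, hsep, hsum⟩ := exists_chain h hjoin
  set R : ℕ → ℝ := fun k => Metric.infDist (X k) (frontier Ω) / 8 with hR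
  have hRpos : ∀ k, 0 < R k := fun k => div_pos (h.infDist_pos (hXΩ k)) (by norm_num)
  have hRd : ∀ k, Metric.infDist (X k) (frontier Ω) = 8 * R k := fun k => by
    simp only [hR]; ring
  set a : ℕ → ℝ := fun k => bumpAverage F (X k) (R k) with ha
  have htri : ‖a m - a 0‖ₑ ≤ ∑ k ∈ Finset.range m, ‖a (k + 1) - a k‖ₑ := by
    have := edist_le_range_sum_edist a m
    rw [← edist_eq_enorm_sub, edist_comm]
    refine this.trans (Finset.sum_le_sum fun k _ => ?_)
    rw [edist_comm, edist_eq_enorm_sub]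
  have hI : ∀ k < m, ‖a (k + 1) - a k‖ₑ ^ p ≤ ENNReal.ofReal (C * R k ^ (p - n)) *
      ∫⁻ z in Metric.closedBall (X k) (2 * R k), ‖G z‖ₑ ^ p := fun k hk =>
    hC Ω α h F G hS (X k) (X (k + 1)) (R k) (hXΩ k) rfl (hstep k hk)
  -- The length of the curve pays `9 * δ` for all radii but the last. The last radius term is at
  -- most twice its predecessor, adding `18 * δ`. A chain of one step has no predecessor and is
  -- covered by the term in the distance of `x` from the boundary.
  have hrad : ∑ k ∈ Finset.range m, ENNReal.ofReal (R k ^ α) ≤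
      ENNReal.ofReal (27 * δ + Metric.infDist x (frontier Ω) ^ α) := by
    have hdx := h.infDist_pos hx
    have hα0 := h.pos
    have hlast : ∀ N, m = N + 2 → R (N + 1) ^ α ≤ 2 * R N ^ α := by
      intro N hN
      have h1 := Metric.infDist_le_infDist_add_dist (s := frontier Ω) (x := X (N + 1)) (y := X N)
      have h2 := hstep N (by omega)
      rw [hRd] at h1
      rw [hRd] at h1
      have h3 : R (N + 1) ≤ 2 * R N := by
        have h4 : dist (X (N + 1)) (X N) ≤ R N := h2
        linarith [hRpos N]
      calc R (N + 1) ^ α ≤ (2 * R N) ^ α := Real.rpow_le_rpow (hRpos _).le h3 hα0.le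
        _ = 2 ^ α * R N ^ α := Real.mul_rpow (by norm_num) (hRpos N).le
        _ ≤ 2 * R N ^ α := by
            have := Real.rpow_nonneg (hRpos N).le α
            gcongr
            calc (2 : ℝ) ^ α ≤ 2 ^ (1 : ℝ) :=
                  Real.rpow_le_rpow_of_exponent_le (by norm_num) h.le_one
              _ = 2 := Real.rpow_one 2
    have hsum' : ∑ k ∈ Finset.range (m - 1), R k ^ α ≤ 9 * δ := by
      rw [← ENNReal.ofReal_sum_of_nonneg (fun k _ => by have := hRpos k; positivity)] at hsum
      have := (hsum.trans hlen.le)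
      rw [ENNReal.ofReal_le_ofReal_iff hδ0.le, ← Finset.sum_div] at this
      linarith
    rw [← ENNReal.ofReal_sum_of_nonneg (fun k _ => by have := hRpos k; positivity)]
    refine ENNReal.ofReal_le_ofReal ?_
    have hdα : 0 < Metric.infDist x (frontier Ω) ^ α := by positivity
    match m, hlast, hsum' with
    | 0, _, _ => simp; positivity
    | 1, _, _ =>
      simp only [Finset.range_one, Finset.sum_singleton]
      have : R 0 ^ α ≤ Metric.infDist x (frontier Ω) ^ α := by
        refine Real.rpow_le_rpow (hRpos 0).le ?_ hα0.le
        simp only [hR, hX0]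
        linarith
      linarith
    | N + 2, hl, hs =>
      rw [Finset.sum_range_succ]
      have h1 := hl N rfl
      have h2 : N + 2 - 1 = N + 1 := rfl
      rw [h2] at hs
      have h3 : R N ^ α ≤ ∑ k ∈ Finset.range (N + 1), R k ^ α :=
        Finset.single_le_sum (f := fun k => R k ^ α)
          (fun k _ => by have := hRpos k; positivity) (Finset.self_mem_range_succ N)
      linarith
  have hoverlap : ∑ k ∈ Finset.range m, ∫⁻ z in Metric.closedBall (X k) (2 * R k), ‖G z‖ₑ ^ p ≤
      ENNReal.ofReal P * ∫⁻ z in Ω, ‖G z‖ₑ ^ p := by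
    have hsubΩ : ∀ k, Metric.closedBall (X k) (2 * R k) ⊆ Ω := fun k z hz =>
      h.mem_of_dist_lt (hXΩ k) (by
        have := Metric.mem_closedBall.1 hz
        linarith [hRd k, hRpos k])
    have hGm : AEMeasurable (fun z => ‖G z‖ₑ ^ p) (volume.restrict Ω) :=
      hS.2.2.1.1.enorm.pow_const p
    have e1 : ∀ k, ∫⁻ z in Metric.closedBall (X k) (2 * R k), ‖G z‖ₑ ^ p =
        ∫⁻ z in Ω, (Metric.closedBall (X k) (2 * R k)).indicator (fun z => ‖G z‖ₑ ^ p) z := by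
      intro k
      rw [lintegral_indicator measurableSet_closedBall, Measure.restrict_restrict
        measurableSet_closedBall, Set.inter_eq_left.2 (hsubΩ k)]
    simp_rw [e1]
    rw [← lintegral_finsetSum' _ fun k _ => hGm.indicator measurableSet_closedBall,
      ← lintegral_const_mul' _ _ ENNReal.ofReal_ne_top]
    refine setLIntegral_mono' h.isOpen.measurableSet fun z hz => ?_
    -- Separation alone bounds the overlap. For `k < j` the distance of the centres is at least `R
    -- k`, and `R j ≤ R k + dist / 8`, so a third of each radius leaves the balls disjoint.
    have hdisj : Pairwise fun i j : Fin m => Disjoint (Metric.ball (X i) (R i / 3))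
        (Metric.ball (X j) (R j / 3)) := by
      have aux : ∀ j k : Fin m, k < j → R k / 3 + R j / 3 ≤ dist (X j) (X k) := by
        intro j k hkj
        have h1 : R k ≤ dist (X j) (X k) := hsep j k hkj j.2
        have h2 := Metric.infDist_le_infDist_add_dist (s := frontier Ω) (x := X j) (y := X k)
        rw [hRd, hRd] at h2
        linarith [hRpos k, hRpos j]
      intro i j hij
      rcases lt_or_gt_of_ne hij with hlt | hlt
      · refine Metric.ball_disjoint_ball ?_
        rw [dist_comm]
        exact aux j i hlt
      · refine Metric.ball_disjoint_ball ?_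
        rw [add_comm]
        exact aux i j hlt
    have hpack := hP (Fin m) (fun k => X k) (fun k => R k / 3) (fun k => by
      have := hRpos k; positivity) hdisj z _ (h.infDist_pos hz)
    rw [tsum_fintype] at hpack
    -- On the cube of radius `2 * R k` the distance to the boundary lies between `6 * R k` and `10 *
    -- R k`. Hence `A = 30` admits the ball of radius `R k / 3`, and its weight in the packing sum
    -- is at least one.
    have hcount : ∀ k, (Metric.closedBall (X k) (2 * R k)).indicator (fun z => ‖G z‖ₑ ^ p) z ≤
        ({k | dist (X k) z ≤ 30 * (R k / 3) ∧
          Metric.infDist z (frontier Ω) ≤ 30 * (R k / 3)}.indicator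
          (fun k => ENNReal.ofReal ((Metric.infDist z (frontier Ω) / (R k / 3)) ^ (1 : ℝ))) k) *
            ‖G z‖ₑ ^ p := by
      intro k
      have hRk := hRpos k
      by_cases hzk : z ∈ Metric.closedBall (X k) (2 * R k)
      · have hzd := Metric.mem_closedBall.1 hzk
        have h1 := Metric.infDist_le_infDist_add_dist (s := frontier Ω) (x := z) (y := X k)
        have h2 := Metric.infDist_le_infDist_add_dist (s := frontier Ω) (x := X k) (y := z)
        rw [hRd] at h1 h2
        rw [dist_comm] at h2
        have hmem : k ∈ {k | dist (X k) z ≤ 30 * (R k / 3) ∧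
          Metric.infDist z (frontier Ω) ≤ 30 * (R k / 3)} := by
          refine ⟨?_, by linarith⟩
          rw [dist_comm]; linarith
        rw [Set.indicator_of_mem hzk, Set.indicator_of_mem hmem]
        refine le_mul_of_one_le_left' ?_
        rw [Real.rpow_one, ENNReal.one_le_ofReal, le_div_iff₀ (by positivity)]
        linarith
      · rw [Set.indicator_of_notMem hzk]
        exact zero_le
    calc _ ≤ ∑ k ∈ Finset.range m, ({k | dist (X k) z ≤ 30 * (R k / 3) ∧
          Metric.infDist z (frontier Ω) ≤ 30 * (R k / 3)}.indicator
          (fun k => ENNReal.ofReal ((Metric.infDist z (frontier Ω) / (R k / 3)) ^ (1 : ℝ))) k) *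
            ‖G z‖ₑ ^ p := Finset.sum_le_sum fun k _ => hcount k
      _ ≤ _ := by
          rw [← Finset.sum_mul, Finset.sum_range]
          exact mul_le_mul_left hpack _
  -- the discrete Hölder inequality
  have hhold := sum_mul_rpow_le hp m
    (fun k => ‖a (k + 1) - a k‖ₑ * ENNReal.ofReal (R k ^ (-α))) (fun k => ENNReal.ofReal (R k ^ α))
  have hcancel : ∀ k, ENNReal.ofReal (R k ^ (-α)) * ENNReal.ofReal (R k ^ α) = 1 := by
    intro k
    have := hRpos k
    rw [← ENNReal.ofReal_mul (by positivity), ← Real.rpow_add this, neg_add_cancel, Real.rpow_zero,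
      ENNReal.ofReal_one]
  simp_rw [mul_assoc, hcancel, mul_one] at hhold
  have hpow : ∀ k < m, (‖a (k + 1) - a k‖ₑ * ENNReal.ofReal (R k ^ (-α))) ^ p *
      ENNReal.ofReal (R k ^ α) ≤ ENNReal.ofReal C *
        ∫⁻ z in Metric.closedBall (X k) (2 * R k), ‖G z‖ₑ ^ p := by
    intro k hk
    have hRk := hRpos k
    rw [ENNReal.mul_rpow_of_nonneg _ _ hp0.le, mul_assoc,
      ENNReal.ofReal_rpow_of_nonneg (by positivity) hp0.le, ← ENNReal.ofReal_mul (by positivity),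
      ← Real.rpow_mul hRk.le, ← Real.rpow_add hRk]
    -- The weights `R k ^ α` in Hölder's inequality are chosen for this: the factor `R k ^ (p - n)`
    -- of the step estimate cancels exactly.
    have he : -α * p + α = -(p - n) := by rw [← hα]; ring
    rw [he]
    calc _ ≤ ENNReal.ofReal (C * R k ^ (p - n)) *
          (∫⁻ z in Metric.closedBall (X k) (2 * R k), ‖G z‖ₑ ^ p) *
            ENNReal.ofReal (R k ^ (-(p - n))) := mul_le_mul_left (hI k hk) _
      _ = _ := by
          rw [mul_right_comm, ← ENNReal.ofReal_mul (by positivity), mul_assoc C,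
            ← Real.rpow_add hRk, add_neg_cancel, Real.rpow_zero, mul_one]
  have ham : a m = bumpAverage F y (Metric.infDist y (frontier Ω) / 8) := by
    simp only [ha, hR, hXm]
  have ha0 : a 0 = bumpAverage F x (Metric.infDist x (frontier Ω) / 8) := by
    simp only [ha, hR, hX0]
  rw [← ham, ← ha0]
  calc ‖a m - a 0‖ₑ ^ p ≤ (∑ k ∈ Finset.range m, ‖a (k + 1) - a k‖ₑ) ^ p := by gcongr
    _ ≤ _ := hhold
    _ ≤ (∑ k ∈ Finset.range m, ENNReal.ofReal C *
        ∫⁻ z in Metric.closedBall (X k) (2 * R k), ‖G z‖ₑ ^ p) *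
          ENNReal.ofReal (27 * δ + Metric.infDist x (frontier Ω) ^ α) ^ (p - 1) := by
        refine mul_le_mul' (Finset.sum_le_sum fun k hk => hpow k (Finset.mem_range.1 hk)) ?_
        exact ENNReal.rpow_le_rpow hrad (by linarith)
    _ ≤ (ENNReal.ofReal C * (ENNReal.ofReal P * ∫⁻ z in Ω, ‖G z‖ₑ ^ p)) *
          ENNReal.ofReal (27 * δ + Metric.infDist x (frontier Ω) ^ α) ^ (p - 1) := by
        rw [← Finset.mul_sum]
        gcongr
    _ = _ := by
        rw [ENNReal.ofReal_mul hC0.le]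
        ring

end Chain

section Continuity

variable {n : ℕ} {Ω : Set (Fin n → ℝ)} {α : ℝ} {F : (Fin n → ℝ) → ℝ} {G : (Fin n → ℝ) → Fin n → ℝ}

/-- In each averaging cube take the point where `F` is farthest from `f ω`. These points are
Whitney-size perturbations of a sequence of `ω`, hence again a sequence of `ω`, and they dominate
the error of the averages. -/
lemma IsProperDomain.tendsto_bumpAverage (h : IsProperDomain Ω α) (hF : ContinuousOn F Ω)
    {f : alphaBoundary Ω α → ℝ} (hf : IsTrace Ω α F f) (ω : alphaBoundary Ω α)
    {x : ℕ → Fin n → ℝ} (hx : x ∈ (ω : Set (ℕ → Fin n → ℝ))) :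
    Tendsto (fun i => bumpAverage F (x i) (Metric.infDist (x i) (frontier Ω) / 8)) atTop
      (𝓝 (f ω)) := by
  have hxΩ := (mem_cauchySeqs ω.2.1 hx).1
  have hd : ∀ i, 0 < Metric.infDist (x i) (frontier Ω) := fun i => h.infDist_pos (hxΩ i)
  have hsub : ∀ i, Metric.closedBall (x i) (Metric.infDist (x i) (frontier Ω) / 8 / 2) ⊆ Ω :=
    fun i z hz => h.mem_of_dist_lt (hxΩ i) (by
      have := Metric.mem_closedBall.1 hz
      linarith [hd i])
  have hmax : ∀ i, ∃ z ∈ Metric.closedBall (x i) (Metric.infDist (x i) (frontier Ω) / 8 / 2),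
      ∀ w ∈ Metric.closedBall (x i) (Metric.infDist (x i) (frontier Ω) / 8 / 2),
        |F w - f ω| ≤ |F z - f ω| := by
    intro i
    obtain ⟨z, hz, hzm⟩ := (isCompact_closedBall (x i)
      (Metric.infDist (x i) (frontier Ω) / 8 / 2)).exists_isMaxOn
      ⟨x i, Metric.mem_closedBall_self (by linarith [hd i])⟩
      (((hF.mono (hsub i)).sub continuousOn_const).abs : ContinuousOn (fun w => |F w - f ω|) _)
    exact ⟨z, hz, fun w hw => hzm hw⟩
  choose z hz hzm using hmax
  have hzω : z ∈ (ω : Set (ℕ → Fin n → ℝ)) := h.mem_of_dist_le_half_infDist ω.2 hx fun i => by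
    have := Metric.mem_closedBall.1 (hz i)
    linarith [hd i]
  have hlim := ((hf ω z hzω).sub_const (f ω)).abs
  rw [sub_self, abs_zero] at hlim
  rw [tendsto_iff_norm_sub_tendsto_zero]
  refine squeeze_zero (fun _ => norm_nonneg _) (fun i => ?_) hlim
  exact abs_bumpAverage_sub_le hF (by linarith [hd i]) (hsub i) (hzm i)

/-- The trace of a Sobolev function is continuous on the boundary. -/
theorem IsTrace.continuousForClosureDist (h : IsProperDomain Ω α) {p : ℝ} (hp : 1 < p)
    (hα : α * (p - 1) = p - n) (hS : IsSobolev Ω p F G) {f : alphaBoundary Ω α → ℝ}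
    (hf : IsTrace Ω α F f) : ContinuousForClosureDist Ω α f := by
  obtain ⟨C, hC0, hC⟩ := exists_chain_estimate n hp
  have hp0 : 0 < p := by linarith
  intro ω τ hτ
  set I := ∫⁻ z in Ω, ‖G z‖ₑ ^ p with hI
  have hItop : I ≠ ⊤ := by
    have := lintegral_rpow_enorm_lt_top_of_eLpNorm_lt_top (f := G) (μ := volume.restrict Ω)
      (p := ENNReal.ofReal p) (by simpa using hp0) ENNReal.ofReal_ne_top hS.2.2.1.2
    rw [ENNReal.toReal_ofReal hp0.le] at this
    exact this.ne
  -- The `28` is the `27` of the chain estimate plus one for the power of the distance to the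
  -- boundary, which falls below `δ` along the sequence.
  obtain ⟨δ, hδ0, hδ⟩ : ∃ δ : ℝ, 0 < δ ∧
      ENNReal.ofReal C * ENNReal.ofReal (28 * δ) ^ (p - 1) * I < ENNReal.ofReal (τ / 2) ^ p := by
    have hlim : Tendsto (fun δ : ℝ => ENNReal.ofReal C * ENNReal.ofReal (28 * δ) ^ (p - 1) * I)
        (𝓝[>] 0) (𝓝 0) := by
      have h1 : Tendsto (fun δ : ℝ => ENNReal.ofReal (28 * δ) ^ (p - 1)) (𝓝[>] 0) (𝓝 0) := by
        have h2 : Continuous fun δ : ℝ => ENNReal.ofReal (28 * δ) ^ (p - 1) :=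
          ENNReal.continuous_rpow_const.comp (ENNReal.continuous_ofReal.comp (by fun_prop))
        have h3 := (h2.tendsto 0).mono_left (nhdsWithin_le_nhds (s := Set.Ioi 0))
        simpa [ENNReal.zero_rpow_of_pos (show 0 < p - 1 by linarith)] using h3
      have h4 := ENNReal.Tendsto.mul_const (b := I)
        (ENNReal.Tendsto.const_mul (a := ENNReal.ofReal C) h1 (Or.inr ENNReal.ofReal_ne_top))
        (Or.inr hItop)
      simpa using h4
    have hpos : 0 < ENNReal.ofReal (τ / 2) ^ p :=
      ENNReal.rpow_pos (ENNReal.ofReal_pos.2 (by positivity)) ENNReal.ofReal_ne_top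
    obtain ⟨δ, h1, h2⟩ := ((hlim.eventually (gt_mem_nhds hpos)).and
      self_mem_nhdsWithin).exists
    exact ⟨δ, h2, h1⟩
  refine ⟨δ, hδ0, fun ω' hω' => ?_⟩
  obtain ⟨x, hx⟩ := h.nonempty_of_mem ω.2.1
  obtain ⟨y, hy⟩ := h.nonempty_of_mem ω'.2.1
  have hxΩ := (mem_cauchySeqs ω.2.1 hx).1
  have hyΩ := (mem_cauchySeqs ω'.2.1 hy).1
  have hdist := h.tendsto_closureDist ω.2.1 ω'.2.1 hx hy
  have hdα := (h.tendsto_infDist_of_mem ω.2 hx).rpow_const (p := α) (Or.inr h.pos.le)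
  rw [Real.zero_rpow h.pos.ne'] at hdα
  have hav := (h.tendsto_bumpAverage hS.1 hf ω' hy).sub (h.tendsto_bumpAverage hS.1 hf ω hx)
  have hle : |f ω' - f ω| ≤ τ / 2 := by
    refine le_of_tendsto hav.abs ?_
    filter_upwards [hdist.eventually (gt_mem_nhds hω'), hdα.eventually (gt_mem_nhds hδ0)]
      with i hi1 hi2
    have hest := hC Ω α h hα F G hS (x i) (y i) δ (hxΩ i) (hyΩ i) hi1
    have hest2 : ‖bumpAverage F (y i) (Metric.infDist (y i) (frontier Ω) / 8) -
        bumpAverage F (x i) (Metric.infDist (x i) (frontier Ω) / 8)‖ₑ ^ p ≤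
          ENNReal.ofReal (τ / 2) ^ p := by
      refine hest.trans (le_trans ?_ hδ.le)
      have h1 : (0 : ℝ) ≤ p - 1 := by linarith
      gcongr
      linarith
    have h3 := (ENNReal.rpow_le_rpow_iff hp0).1 hest2
    rw [← ofReal_norm, ENNReal.ofReal_le_ofReal_iff (by positivity)] at h3
    exact h3
  linarith

end Continuity

end SobolevTrace

/-! ### Whitney coverings and necessity of conditions 2 and 3. -/

namespace SobolevTrace

variable {n : ℕ} {Ω : Set (Fin n → ℝ)} {α θ : ℝ} {𝒬 : Set (Cube n)}

lemma add_rpow_le_ofReal (a b : ℝ≥0∞) {p : ℝ} (hp : 1 ≤ p) :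
    (a + b) ^ p ≤ ENNReal.ofReal (2 ^ (p - 1)) * (a ^ p + b ^ p) := by
  have e : ENNReal.ofReal (2 ^ (p - 1)) = 2 ^ (p - 1) := by
    rw [← ENNReal.ofReal_rpow_of_pos two_pos, ENNReal.ofReal_ofNat]
  rw [e]
  exact ENNReal.rpow_add_le_mul_rpow_add_rpow a b hp

lemma Cube.interior_toSet (Q : Cube n) :
    interior Q.toSet = Metric.ball Q.center Q.radius :=
  interior_closedBall _ Q.radius_pos.ne'

lemma Cube.ball_subset_toSet (Q : Cube n) : Metric.ball Q.center Q.radius ⊆ Q.toSet :=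
  Metric.ball_subset_closedBall

namespace IsWhitneyCovering

lemma disjoint_ball (hW : IsWhitneyCovering Ω θ 𝒬) :
    Pairwise fun Q K : 𝒬 => Disjoint (Metric.ball Q.1.center Q.1.radius)
      (Metric.ball K.1.center K.1.radius) := by
  intro Q K hne
  have := hW.2.2.1 Q.2 K.2 (fun e => hne (Subtype.ext e))
  simpa only [Cube.interior_toSet] using this

lemma countable (hW : IsWhitneyCovering Ω θ 𝒬) : Countable 𝒬 := by
  refine Pairwise.countable_of_isOpen_disjoint
    (s := fun Q : 𝒬 => Metric.ball Q.1.center Q.1.radius) hW.disjoint_ball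
    (fun Q => Metric.isOpen_ball) (fun Q => ⟨Q.1.center, Metric.mem_ball_self Q.1.radius_pos⟩)

/-- The open cubes miss only countably many cube surfaces, each of measure zero; countability comes
from their disjointness. Values of `T` off the interiors thus never matter. -/
lemma ae_eq_iUnion_ball (hW : IsWhitneyCovering Ω θ 𝒬) :
    Ω =ᵐ[volume] ⋃ Q : 𝒬, Metric.ball Q.1.center Q.1.radius := by
  have := hW.countable
  refine EventuallyLE.antisymm ?_ (LE.le.eventuallyLE ?_)
  · have hnull : volume (⋃ Q : 𝒬, Metric.sphere Q.1.center Q.1.radius) = 0 :=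
      measure_iUnion_null fun Q => Measure.addHaar_sphere_of_ne_zero _ _ Q.1.radius_pos.ne'
    rw [ae_le_set]
    refine measure_mono_null ?_ hnull
    rintro x ⟨hx, hx'⟩
    obtain ⟨Q, hQ, hxQ⟩ := Set.mem_iUnion₂.1 (hW.2.1 hx)
    refine Set.mem_iUnion.2 ⟨⟨Q, hQ⟩, ?_⟩
    rcases (Metric.mem_closedBall.1 hxQ).lt_or_eq with hlt | heq
    · exact absurd (Set.mem_iUnion.2 ⟨⟨Q, hQ⟩, hlt⟩) hx'
    · exact heq
  · refine Set.iUnion_subset fun Q => ?_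
    exact Q.1.ball_subset_toSet.trans (hW.1 Q.1 Q.2)

lemma setLIntegral_eq_tsum (hW : IsWhitneyCovering Ω θ 𝒬) (g : (Fin n → ℝ) → ℝ≥0∞) :
    ∫⁻ x in Ω, g x = ∑' Q : 𝒬, ∫⁻ x in Metric.ball Q.1.center Q.1.radius, g x := by
  have := hW.countable
  rw [Measure.restrict_congr_set hW.ae_eq_iUnion_ball,
    lintegral_iUnion (fun Q => measurableSet_ball) hW.disjoint_ball]

lemma two_mul_radius_le (hW : IsWhitneyCovering Ω θ 𝒬) (hn : 1 ≤ n) (hθ : 0 < θ) {Q : Cube n}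
    (hQ : Q ∈ 𝒬) : 2 * Q.radius ≤ θ * setDist Q.toSet (frontier Ω) := by
  have := (hW.2.2.2 Q hQ).1
  rw [Cube.diam_eq hn, one_div, inv_mul_le_iff₀ hθ] at this
  exact this

lemma setDist_le (hW : IsWhitneyCovering Ω θ 𝒬) (hn : 1 ≤ n) {Q : Cube n}
    (hQ : Q ∈ 𝒬) : setDist Q.toSet (frontier Ω) ≤ θ * (2 * Q.radius) := by
  have := (hW.2.2.2 Q hQ).2
  rwa [Cube.diam_eq hn] at this

end IsWhitneyCovering

lemma IsBoundaryProjection.exists_nearest {T : (Fin n → ℝ) → alphaBoundary Ω α}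
    (hT : IsBoundaryProjection Ω α 𝒬 T) {Q : Cube n} (hQ : Q ∈ 𝒬) :
    ∃ a, IsNearestBoundaryPoint Ω Q a ∧
      (T Q.center : Set (ℕ → Fin n → ℝ)) = visibleElement Ω α Q a := by
  obtain ⟨a, ha, h⟩ := hT Q hQ
  refine ⟨a, ha, h _ ?_⟩
  rw [Cube.interior_toSet]
  exact Metric.mem_ball_self Q.radius_pos

lemma IsBoundaryProjection.eq_center {T : (Fin n → ℝ) → alphaBoundary Ω α}
    (hT : IsBoundaryProjection Ω α 𝒬 T) {Q : Cube n} (hQ : Q ∈ 𝒬) {x : Fin n → ℝ}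
    (hx : x ∈ Metric.ball Q.center Q.radius) : T x = T Q.center := by
  obtain ⟨a, ha, h⟩ := hT Q hQ
  rw [Cube.interior_toSet] at h
  exact Subtype.ext ((h x hx).trans (h _ (Metric.mem_ball_self Q.radius_pos)).symm)

/-- The weighted Hölder inequality with the kernel, of mass one, as weight; afterwards the kernel is
replaced by its maximum. -/
lemma enorm_bumpAverage_rpow_le {F : (Fin n → ℝ) → ℝ} (hF : ContinuousOn F Ω) {B p : ℝ}
    (hp : 1 < p) (hB : ∀ u, bump n u ≤ B) {c : Fin n → ℝ} {r : ℝ} (hr : 0 < r)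
    (hsub : Metric.ball c r ⊆ Ω) :
    ‖bumpAverage F c r‖ₑ ^ p ≤
      ENNReal.ofReal ((r ^ n)⁻¹ * B) * ∫⁻ z in Metric.ball c r, ‖F z‖ₑ ^ p := by
  have h1 : ‖bumpAverage F c r‖ₑ ≤
      ∫⁻ z in Metric.ball c r, ‖F z‖ₑ * ENNReal.ofReal (kernel c r z) := by
    unfold bumpAverage
    refine (enorm_integral_le_lintegral_enorm _).trans ?_
    rw [← lintegral_indicator measurableSet_ball]
    refine lintegral_mono fun z => ?_
    by_cases hz : z ∈ Metric.ball c r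
    · rw [Set.indicator_of_mem hz, enorm_mul,
        Real.enorm_eq_ofReal (kernel_nonneg c hr z)]
    · rw [Set.indicator_of_notMem hz, kernel_eq_zero hr]
      · simp
      · rw [Metric.mem_ball, not_lt] at hz
        linarith
  have hFm : AEMeasurable (fun z => ‖F z‖ₑ) (volume.restrict (Metric.ball c r)) :=
    ((hF.mono hsub).aestronglyMeasurable measurableSet_ball).enorm
  have hkm : AEMeasurable (fun z => ENNReal.ofReal (kernel c r z))
      (volume.restrict (Metric.ball c r)) :=
    (contDiff_kernel c r).continuous.measurable.ennreal_ofReal.aemeasurable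
  have hk1 : ∫⁻ z in Metric.ball c r, ENNReal.ofReal (kernel c r z) ≤ 1 :=
    (setLIntegral_le_lintegral _ _).trans (lintegral_kernel c hr).le
  calc ‖bumpAverage F c r‖ₑ ^ p ≤ _ := ENNReal.rpow_le_rpow h1 (by linarith)
    _ ≤ _ := lintegral_mul_rpow_le _ hp hFm hkm
    _ ≤ (∫⁻ z in Metric.ball c r, ‖F z‖ₑ ^ p * ENNReal.ofReal (kernel c r z)) * 1 := by
        refine mul_le_mul_right ?_ _
        exact ENNReal.rpow_le_one hk1 (by linarith)
    _ ≤ ∫⁻ z in Metric.ball c r, ENNReal.ofReal ((r ^ n)⁻¹ * B) * ‖F z‖ₑ ^ p := by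
        rw [mul_one]
        refine lintegral_mono fun z => ?_
        rw [mul_comm]
        exact mul_le_mul_left (ENNReal.ofReal_le_ofReal (kernel_le hB c hr z)) _
    _ = _ := lintegral_const_mul' _ _ ENNReal.ofReal_ne_top

lemma boundaryNhd_eq_inter (Ω : Set (Fin n → ℝ)) (ε : ℝ) :
    boundaryNhd Ω ε = {x | Metric.infDist x (frontier Ω) < ε} ∩ Ω := by
  ext x; exact and_comm

lemma isOpen_infDist_lt (s : Set (Fin n → ℝ)) (ε : ℝ) : IsOpen {x | Metric.infDist x s < ε} :=
  isOpen_lt (Metric.continuous_infDist_pt s) continuous_const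

lemma volume_ball (Q : Cube n) :
    volume (Metric.ball Q.center Q.radius) = ENNReal.ofReal ((2 * Q.radius) ^ n) := by
  rw [Real.volume_pi_ball _ Q.radius_pos, Fintype.card_fin]

/-- On a covering cube `f ∘ T` is one visible value, compared with the average of `F` over the cube.
The average is bounded by the `L_p` norm of `F` there, and the difference is a term of the cone
estimate for the whole covering. -/
theorem exists_projection_estimate (n : ℕ) {p : ℝ} (hn : 1 ≤ n) (hp : (n : ℝ) < p) {ε θ : ℝ}
    (hε : 0 < ε) (hθ : 1 < θ) : ∃ C : ℝ, 0 < C ∧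
      ∀ (Ω : Set (Fin n → ℝ)) (α : ℝ), IsProperDomain Ω α →
      ∀ 𝒬 : Set (Cube n), IsWhitneyCovering Ω θ 𝒬 →
      ∀ T : (Fin n → ℝ) → alphaBoundary Ω α, IsBoundaryProjection Ω α 𝒬 T →
      ∀ (F : (Fin n → ℝ) → ℝ) (G : (Fin n → ℝ) → Fin n → ℝ), IsSobolev Ω p F G →
      ∀ f : alphaBoundary Ω α → ℝ, IsTrace Ω α F f →
      ∫⁻ x in boundaryNhd Ω ε, ‖f (T x)‖ₑ ^ p ≤
        ENNReal.ofReal C * ((∫⁻ z in Ω, ‖F z‖ₑ ^ p) + ∫⁻ z in Ω, ‖G z‖ₑ ^ p) := by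
  -- The nearest point is at distance `r + dist(Q, ∂Ω)` from the centre, and `dist(Q, ∂Ω) ≤ θ * (2 *
  -- r)`.
  obtain ⟨C₀, hC₀, hC⟩ := exists_cone_estimate n hn hp (η := 1 + 2 * θ) (by linarith)
  obtain ⟨B, hB0, hB⟩ := exists_bump_le n
  have hn1 : (1 : ℝ) ≤ n := by exact_mod_cast hn
  have hp1 : 1 < p := by linarith
  set A₁ : ℝ := 2 ^ (p - 1) * (2 ^ n * (θ * ε) ^ p) with hA₁
  set A₂ : ℝ := 2 ^ (p - 1) * (2 ^ n * B) with hA₂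
  have hA₁0 : 0 < A₁ := by positivity
  have hA₂0 : 0 < A₂ := by positivity
  refine ⟨A₂ + A₁ * C₀, by positivity, ?_⟩
  intro Ω α h 𝒬 hW T hT F G hS f hf
  have hcount := hW.countable
  rw [boundaryNhd_eq_inter, ← setLIntegral_indicator (isOpen_infDist_lt _ ε).measurableSet,
    hW.setLIntegral_eq_tsum, hW.setLIntegral_eq_tsum (fun z => ‖F z‖ₑ ^ p)]
  have hcone := hC Ω α h F G hS f hf 𝒬 (fun Q => Q.1) (fun Q => T Q.1.center)
    hW.disjoint_ball
    (by
      intro Q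
      obtain ⟨a, ha, hTa⟩ := hT.exists_nearest Q.2
      rw [hTa]
      refine h.alphaVisible_visibleElement (hW.1 _ Q.2) ha ?_
      refine Metric.closedBall_subset_ball ?_
      have := hW.two_mul_radius_le hn (by linarith) Q.2
      have := Q.1.radius_pos
      nlinarith)
    (by
      intro Q
      obtain ⟨a, ha, hTa⟩ := hT.exists_nearest Q.2
      rw [hTa, h.ell_visibleElement (hW.1 _ Q.2) ha, ha.dist_center h.isOpen (hW.1 _ Q.2)]
      have := hW.setDist_le hn Q.2
      linarith)
  have hQ : ∀ Q : 𝒬, ∫⁻ x in Metric.ball Q.1.center Q.1.radius,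
      {x | Metric.infDist x (frontier Ω) < ε}.indicator (fun x => ‖f (T x)‖ₑ ^ p) x ≤
      ENNReal.ofReal A₂ * (∫⁻ x in Metric.ball Q.1.center Q.1.radius, ‖F x‖ₑ ^ p) +
      ENNReal.ofReal A₁ * (‖f (T Q.1.center) - bumpAverage F Q.1.center Q.1.radius‖ₑ ^ p *
        ENNReal.ofReal (Q.1.radius ^ (n - p))) := by
    intro Q
    set r := Q.1.radius with hr
    have hr0 : 0 < r := Q.1.radius_pos
    by_cases hmeet : ∃ x ∈ Metric.ball Q.1.center r, Metric.infDist x (frontier Ω) < ε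
    swap
    · push Not at hmeet
      refine le_trans (le_of_eq ?_) (zero_le)
      rw [setLIntegral_congr_fun measurableSet_ball (g := fun _ => 0)]
      · simp
      · intro x hx
        exact Set.indicator_of_notMem (by simpa using hmeet x hx) _
    obtain ⟨x, hx, hxε⟩ := hmeet
    have hrε : r ≤ θ * ε := by
      have h1 := hW.two_mul_radius_le hn (by linarith) Q.2
      have h2 := setDist_le_infDist (Q.1.ball_subset_toSet hx) h.frontier_nonempty
      nlinarith
    set avg := bumpAverage F Q.1.center r with havg
    set v := f (T Q.1.center) with hv
    have hvol : ∫⁻ x in Metric.ball Q.1.center r,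
        {x | Metric.infDist x (frontier Ω) < ε}.indicator (fun x => ‖f (T x)‖ₑ ^ p) x ≤
        ‖v‖ₑ ^ p * ENNReal.ofReal ((2 * r) ^ n) := by
      rw [← volume_ball, ← setLIntegral_const]
      refine setLIntegral_mono' measurableSet_ball fun x hx => ?_
      refine (Set.indicator_le_self _ _ x).trans ?_
      rw [hT.eq_center Q.2 hx]
    have hv1 : ‖v‖ₑ ^ p ≤ ENNReal.ofReal (2 ^ (p - 1)) * (‖v - avg‖ₑ ^ p + ‖avg‖ₑ ^ p) := by
      have e : ‖v‖ₑ ≤ ‖v - avg‖ₑ + ‖avg‖ₑ := by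
        simpa using enorm_add_le (v - avg) avg
      exact (ENNReal.rpow_le_rpow e (by linarith)).trans (add_rpow_le_ofReal _ _ hp1.le)
    have hav := enorm_bumpAverage_rpow_le hS.1 hp1 hB hr0
      (Q.1.ball_subset_toSet.trans (hW.1 _ Q.2))
    set I := ∫⁻ x in Metric.ball Q.1.center r, ‖F x‖ₑ ^ p with hI
    have e1 : ENNReal.ofReal (2 ^ (p - 1)) * ENNReal.ofReal ((r ^ n)⁻¹ * B) *
        ENNReal.ofReal ((2 * r) ^ n) = ENNReal.ofReal A₂ := by
      rw [← ENNReal.ofReal_mul (by positivity), ← ENNReal.ofReal_mul (by positivity), hA₂, mul_pow]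
      congr 1
      field_simp
    -- The cone estimate carries `r ^ (n - p)` while the volume is `r ^ n`. The excess `r ^ p` is
    -- bounded since a cube meeting the `ε`-neighbourhood has `r ≤ θ * ε`; this makes the constant
    -- depend on `ε`.
    have e2 : ENNReal.ofReal (2 ^ (p - 1)) * ENNReal.ofReal ((2 * r) ^ n) ≤
        ENNReal.ofReal A₁ * ENNReal.ofReal (r ^ (n - p)) := by
      rw [← ENNReal.ofReal_mul (by positivity), ← ENNReal.ofReal_mul (by positivity), hA₁, mul_pow,
        mul_assoc, mul_assoc]
      refine ENNReal.ofReal_le_ofReal ?_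
      have : r ^ n = r ^ p * r ^ ((n : ℝ) - p) := by
        rw [← Real.rpow_add hr0, ← Real.rpow_natCast]; congr 1; ring
      rw [this]
      have := Real.rpow_le_rpow hr0.le hrε (by linarith : 0 ≤ p)
      gcongr
    calc _ ≤ ‖v‖ₑ ^ p * ENNReal.ofReal ((2 * r) ^ n) := hvol
      _ ≤ (ENNReal.ofReal (2 ^ (p - 1)) * (‖v - avg‖ₑ ^ p +
            ENNReal.ofReal ((r ^ n)⁻¹ * B) * I)) * ENNReal.ofReal ((2 * r) ^ n) := by
          refine mul_le_mul_left (hv1.trans ?_) _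
          gcongr
      _ = ENNReal.ofReal (2 ^ (p - 1)) * ENNReal.ofReal ((r ^ n)⁻¹ * B) *
            ENNReal.ofReal ((2 * r) ^ n) * I +
            ENNReal.ofReal (2 ^ (p - 1)) * ENNReal.ofReal ((2 * r) ^ n) * ‖v - avg‖ₑ ^ p := by ring
      _ ≤ _ := by
          rw [e1]
          refine add_le_add le_rfl ((mul_le_mul_left e2 _).trans (le_of_eq ?_))
          ring
  refine (ENNReal.tsum_le_tsum hQ).trans ?_
  rw [ENNReal.tsum_add, ENNReal.tsum_mul_left, ENNReal.tsum_mul_left]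
  calc _ ≤ ENNReal.ofReal A₂ * (∑' Q : 𝒬, ∫⁻ x in Metric.ball Q.1.center Q.1.radius, ‖F x‖ₑ ^ p) +
        ENNReal.ofReal A₁ * (ENNReal.ofReal C₀ * ∫⁻ z in Ω, ‖G z‖ₑ ^ p) := by gcongr
    _ ≤ _ := by
      rw [mul_add, ← mul_assoc, ← ENNReal.ofReal_mul hA₁0.le]
      have := mul_pos hA₁0 hC₀
      gcongr <;> linarith

/-- Both boundary values are compared with the same average over the cube, and the cone estimate is
applied to each family. The constant `lam` is a variable so that it can be taken strictly positive
even when the gradient vanishes. -/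
theorem exists_variational_estimate (n : ℕ) {p : ℝ} (hn : 1 ≤ n) (hp : (n : ℝ) < p) {η : ℝ}
    (hη : 0 < η) : ∃ C : ℝ, 0 < C ∧
      ∀ (Ω : Set (Fin n → ℝ)), IsProperDomain Ω (sobolevExponent n p) →
      ∀ (F : (Fin n → ℝ) → ℝ) (G : (Fin n → ℝ) → Fin n → ℝ), IsSobolev Ω p F G →
      ∀ f : SobolevBoundary Ω p → ℝ, IsTrace Ω (sobolevExponent n p) F f →
      ∀ (ε lam : ℝ), ENNReal.ofReal C * (∫⁻ z in Ω, ‖G z‖ₑ ^ p) ≤ ENNReal.ofReal lam → 0 ≤ lam →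
      VariationalBound Ω p ε η f lam := by
  obtain ⟨C₀, hC₀, hC⟩ := exists_cone_estimate n hn hp hη
  have hn1 : (1 : ℝ) ≤ n := by exact_mod_cast hn
  have hp1 : 1 < p := by linarith
  refine ⟨2 ^ (p - 1) * (C₀ + C₀), by positivity, ?_⟩
  intro Ω h F G hS f hf ε lam hlam hlam0 m Q ω₁ ω₂ hQ hdisj hvis hell
  have hdisj' : Pairwise fun i j => Disjoint (Metric.ball (Q i).center (Q i).radius)
      (Metric.ball (Q j).center (Q j).radius) := fun i j hij =>
    (hdisj hij).mono (Q i).ball_subset_toSet (Q j).ball_subset_toSet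
  have h1 := hC Ω _ h F G hS f hf (Fin m) Q ω₁ hdisj' (fun i => (hvis i).1)
    (fun i => Metric.mem_closedBall.1 (hell i).1.1)
  have h2 := hC Ω _ h F G hS f hf (Fin m) Q ω₂ hdisj' (fun i => (hvis i).2)
    (fun i => Metric.mem_closedBall.1 (hell i).2.1)
  rw [tsum_fintype] at h1 h2
  have hi : ∀ i, ENNReal.ofReal (|f (ω₁ i) - f (ω₂ i)| ^ p / (Q i).diam ^ (p - n)) ≤
      ENNReal.ofReal (2 ^ (p - 1)) *
      (‖f (ω₁ i) - bumpAverage F (Q i).center (Q i).radius‖ₑ ^ p *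
        ENNReal.ofReal ((Q i).radius ^ (n - p)) +
      ‖f (ω₂ i) - bumpAverage F (Q i).center (Q i).radius‖ₑ ^ p *
        ENNReal.ofReal ((Q i).radius ^ (n - p))) := by
    intro i
    have hr0 := (Q i).radius_pos
    set r := (Q i).radius
    set avg := bumpAverage F (Q i).center r
    have e : ‖f (ω₁ i) - f (ω₂ i)‖ₑ ≤ ‖f (ω₁ i) - avg‖ₑ + ‖f (ω₂ i) - avg‖ₑ := by
      have := enorm_sub_le (a := f (ω₁ i) - avg) (b := f (ω₂ i) - avg)
      simpa using this
    have e2 := (ENNReal.rpow_le_rpow e (by linarith : 0 ≤ p)).trans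
      (add_rpow_le_ofReal _ _ hp1.le)
    have e3 : ENNReal.ofReal (|f (ω₁ i) - f (ω₂ i)| ^ p / (Q i).diam ^ (p - n)) ≤
        ‖f (ω₁ i) - f (ω₂ i)‖ₑ ^ p * ENNReal.ofReal (r ^ (n - p)) := by
      rw [← ofReal_norm, Real.norm_eq_abs, ENNReal.ofReal_rpow_of_nonneg (abs_nonneg _) (by linarith),
        ← ENNReal.ofReal_mul (by positivity)]
      refine ENNReal.ofReal_le_ofReal ?_
      rw [div_eq_mul_inv]
      refine mul_le_mul_of_nonneg_left ?_ (by positivity)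
      rw [show (n : ℝ) - p = -(p - n) by ring, Real.rpow_neg hr0.le]
      refine inv_anti₀ (Real.rpow_pos_of_pos hr0 _) (Real.rpow_le_rpow hr0.le ?_ (by linarith))
      rw [Cube.diam_eq hn]
      linarith
    refine e3.trans ((mul_le_mul_left e2 _).trans (le_of_eq ?_))
    ring
  have hsum : ENNReal.ofReal (∑ i, |f (ω₁ i) - f (ω₂ i)| ^ p / (Q i).diam ^ (p - n)) ≤
      ENNReal.ofReal lam := by
    have hnn : ∀ i ∈ Finset.univ, 0 ≤ |f (ω₁ i) - f (ω₂ i)| ^ p / (Q i).diam ^ (p - n) :=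
      fun i _ => div_nonneg (by positivity) (Real.rpow_nonneg Metric.diam_nonneg _)
    rw [ENNReal.ofReal_sum_of_nonneg hnn]
    refine (Finset.sum_le_sum fun i _ => hi i).trans (le_trans ?_ hlam)
    rw [← Finset.mul_sum, Finset.sum_add_distrib, ENNReal.ofReal_mul (by positivity), mul_assoc,
      ENNReal.ofReal_add hC₀.le hC₀.le, add_mul]
    gcongr
  exact (ENNReal.ofReal_le_ofReal_iff hlam0).1 hsum

end SobolevTrace

/-! ### Lipschitz bounds for averages and weak gradients of Lipschitz functions. -/

namespace SobolevTrace

variable {n : ℕ}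

lemma exists_abs_kernelDeriv_le (n : ℕ) : ∃ C : ℝ, 0 < C ∧ ∀ (c v z : Fin n → ℝ) (r w t : ℝ),
    0 < r + t * w → |kernelDeriv c v r w t z| ≤ C * ((r + t * w) ^ (n + 1))⁻¹ * (‖v‖ + |w|) := by
  obtain ⟨B, hB0, hB⟩ := exists_bump_le n
  obtain ⟨L, hL⟩ := (hasCompactSupport_bump (n := n)).fderiv (𝕜 := ℝ)
    |>.exists_bound_of_continuous ((contDiff_bump (n := n)).continuous_fderiv (by simp))
  have hL0 : 0 ≤ L := (norm_nonneg _).trans (hL 0)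
  refine ⟨n * B + L + 1, by positivity, ?_⟩
  intro c v z r w t hr
  set u := (r + t * w)⁻¹ • (z - (c + t • v)) with hu
  by_cases hfar : (r + t * w) / 2 < dist z (c + t • v)
  · rw [kernelDeriv_eq_zero hr hfar, abs_zero]
    positivity
  have hu1 : ‖u‖ ≤ 1 := by
    rw [hu, norm_inv_smul_sub _ _ hr, div_le_one hr]
    linarith
  have h1 : |fderiv ℝ (bump n) u (v + w • u)| ≤ L * (‖v‖ + |w|) := by
    refine ((fderiv ℝ (bump n) u).le_opNorm _).trans ?_
    refine mul_le_mul (hL u) ?_ (norm_nonneg _) hL0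
    refine (norm_add_le _ _).trans ?_
    rw [norm_smul, Real.norm_eq_abs]
    have := mul_le_of_le_one_right (abs_nonneg w) hu1
    linarith
  have h2 : |n * w * bump n u| ≤ n * B * (‖v‖ + |w|) := by
    rw [abs_mul, abs_mul, abs_of_nonneg (bump_nonneg u), Nat.abs_cast]
    have h3 : |w| * bump n u ≤ (‖v‖ + |w|) * B :=
      mul_le_mul (by linarith [norm_nonneg v]) (hB u) (bump_nonneg u) (by positivity)
    calc (n : ℝ) * |w| * bump n u = n * (|w| * bump n u) := by ring
      _ ≤ n * ((‖v‖ + |w|) * B) := by gcongr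
      _ = _ := by ring
  unfold kernelDeriv
  rw [← hu, abs_neg, abs_mul, abs_of_pos (inv_pos.2 (pow_pos hr _)),
    mul_comm (n * B + L + 1 : ℝ), mul_assoc (_⁻¹)]
  refine mul_le_mul_of_nonneg_left ?_ (inv_pos.2 (pow_pos hr _)).le
  refine (abs_add_le _ _).trans ?_
  have : 0 ≤ ‖v‖ + |w| := by positivity
  nlinarith

/-- The mean value inequality along the affine path between the two cubes, on which the radius never
falls below `ρ`. -/
lemma exists_abs_kernel_sub_le (n : ℕ) : ∃ C : ℝ, 0 < C ∧
    ∀ (c c' z : Fin n → ℝ) (r r' ρ : ℝ), 0 < ρ → ρ ≤ r → ρ ≤ r' →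
      |kernel c' r' z - kernel c r z| ≤ C * (ρ ^ (n + 1))⁻¹ * (dist c' c + |r' - r|) := by
  obtain ⟨C, hC0, hC⟩ := exists_abs_kernelDeriv_le n
  refine ⟨C, hC0, ?_⟩
  intro c c' z r r' ρ hρ hr hr'
  have hpos : ∀ t ∈ Set.Icc (0 : ℝ) 1, ρ ≤ r + t * (r' - r) := by
    intro t ht
    nlinarith [ht.1, ht.2]
  have key := norm_image_sub_le_of_norm_deriv_le_segment_01'
    (f := fun t : ℝ => kernel (c + t • (c' - c)) (r + t * (r' - r)) z)
    (f' := fun t => kernelDeriv c (c' - c) r (r' - r) t z)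
    (C := C * (ρ ^ (n + 1))⁻¹ * (dist c' c + |r' - r|))
    (fun t ht => (hasDerivAt_kernel c (c' - c) z r (r' - r) t
      (hρ.trans_le (hpos t ht))).hasDerivWithinAt)
    (fun t ht => by
      have h1 := hpos t ⟨ht.1, ht.2.le⟩
      refine (hC c (c' - c) z r (r' - r) t (hρ.trans_le h1)).trans ?_
      rw [dist_eq_norm]
      gcongr)
  simpa using key

/-- Since the kernels have mass one, only `g - g₀` on the large ball matters, and it is bounded by
`M`. The kernels differ by `O(ρ ^ (-n - 1))` times the displacement, on a set of volume `(2 * ρ) ^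
n`. Mere measurability of `g` is required because it will be the step function `f ∘ T`. -/
lemma exists_bumpAverage_lipschitz (n : ℕ) : ∃ C : ℝ, 0 < C ∧
    ∀ (g : (Fin n → ℝ) → ℝ) (g₀ M ρ : ℝ) (x₀ : Fin n → ℝ), 0 < ρ → 0 ≤ M →
      AEStronglyMeasurable g (volume.restrict (Metric.ball x₀ ρ)) →
      (∀ᵐ w ∂volume.restrict (Metric.ball x₀ ρ), |g w - g₀| ≤ M) →
      ∀ (x x' : Fin n → ℝ) (r r' : ℝ), ρ / 2 ≤ r → ρ / 2 ≤ r' →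
      r / 2 + dist x x₀ ≤ ρ → r' / 2 + dist x' x₀ ≤ ρ →
      |bumpAverage g x r - g₀| ≤ M ∧
      |bumpAverage g x' r' - bumpAverage g x r| ≤ C * (M / ρ) * (dist x' x + |r' - r|) := by
  obtain ⟨C, hC0, hC⟩ := exists_abs_kernel_sub_le n
  refine ⟨C * 2 ^ (n + 1) * 2 ^ n, by positivity, ?_⟩
  intro g g₀ M ρ x₀ hρ hM hgm hgM x x' r r' hr hr' hx hx'
  set B := Metric.ball x₀ ρ with hB
  set u : (Fin n → ℝ) → ℝ := B.indicator (fun w => g w - g₀) with hu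
  have hum : AEStronglyMeasurable u volume :=
    (aestronglyMeasurable_indicator_iff measurableSet_ball).2 (hgm.sub aestronglyMeasurable_const)
  have huM : ∀ᵐ w, ‖u w‖ ≤ M := by
    have := (ae_restrict_iff' measurableSet_ball).1 hgM
    filter_upwards [this] with w hw
    by_cases hwB : w ∈ B
    · rw [hu, Set.indicator_of_mem hwB]; exact hw hwB
    · rw [hu, Set.indicator_of_notMem hwB]; simpa using hM
  have hzero : ∀ (y : Fin n → ℝ) (s : ℝ), 0 < s → s / 2 + dist y x₀ ≤ ρ → ∀ w ∉ B,
      kernel y s w = 0 := by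
    intro y s hs hy w hw
    refine kernel_eq_zero hs ?_
    rw [hB, Metric.mem_ball, not_lt] at hw
    have := dist_triangle w y x₀
    linarith
  have hInt : ∀ (y : Fin n → ℝ) (s : ℝ), 0 < s → Integrable fun w => u w * kernel y s w :=
    fun y s hs => (integrable_kernel y hs).bdd_mul hum huM
  have havg : ∀ (y : Fin n → ℝ) (s : ℝ), 0 < s → s / 2 + dist y x₀ ≤ ρ →
      bumpAverage g y s = g₀ + ∫ w, u w * kernel y s w := by
    intro y s hs hy
    have e : ∀ w, g w * kernel y s w = g₀ * kernel y s w + u w * kernel y s w := by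
      intro w
      by_cases hwB : w ∈ B
      · rw [hu, Set.indicator_of_mem hwB]; ring
      · rw [hzero y s hs hy w hwB]; ring
    unfold bumpAverage
    rw [integral_congr_ae (Eventually.of_forall e),
      integral_add ((integrable_kernel y hs).const_mul g₀) (hInt y s hs), integral_const_mul,
      integral_kernel y hs, mul_one]
  have hr0 : 0 < r := by linarith
  have hr0' : 0 < r' := by linarith
  rw [havg x r hr0 hx, havg x' r' hr0' hx']
  constructor
  · rw [add_sub_cancel_left, ← Real.norm_eq_abs]
    calc _ ≤ ∫ w, M * kernel x r w := by
          refine norm_integral_le_of_norm_le ((integrable_kernel x hr0).const_mul M) ?_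
          filter_upwards [huM] with w hw
          rw [norm_mul, Real.norm_of_nonneg (kernel_nonneg x hr0 w)]
          exact mul_le_mul_of_nonneg_right hw (kernel_nonneg x hr0 w)
      _ = M := by rw [integral_const_mul, integral_kernel x hr0, mul_one]
  · rw [add_sub_add_left_eq_sub, ← integral_sub (hInt x' r' hr0') (hInt x r hr0),
      ← Real.norm_eq_abs]
    set A : ℝ := C * ((ρ / 2) ^ (n + 1))⁻¹ * (dist x' x + |r' - r|) with hA
    have hA0 : 0 ≤ A := by positivity
    have hbd : ∀ᵐ w, ‖u w * kernel x' r' w - u w * kernel x r w‖ ≤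
        B.indicator (fun _ => M * A) w := by
      filter_upwards [huM] with w hw
      by_cases hwB : w ∈ B
      · rw [Set.indicator_of_mem hwB, ← mul_sub, norm_mul]
        exact mul_le_mul hw (hC x x' w r r' (ρ / 2) (by linarith) hr hr') (norm_nonneg _) hM
      · rw [Set.indicator_of_notMem hwB, hzero x r hr0 hx w hwB, hzero x' r' hr0' hx' w hwB]
        simp
    have hfin : volume B ≠ ∞ := measure_ball_lt_top.ne
    refine (norm_integral_le_of_norm_le
      ((integrable_indicator_iff measurableSet_ball).2 (integrableOn_const hfin)) hbd).trans ?_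
    rw [integral_indicator measurableSet_ball, setIntegral_const, smul_eq_mul, Measure.real,
      Real.volume_pi_ball _ hρ, ENNReal.toReal_ofReal (by positivity), Fintype.card_fin, hA]
    refine le_of_eq ?_
    rw [mul_pow, div_pow, inv_div]
    field_simp
    ring

/-- A locally Lipschitz function has its pointwise gradient as weak gradient. -/
lemma isWeakGradient_of_locallyLipschitzOn {Ω : Set (Fin n → ℝ)} (hΩ : IsOpen Ω)
    {F : (Fin n → ℝ) → ℝ} (hF : LocallyLipschitzOn Ω F) :
    IsWeakGradient Ω F (fun x i => fderiv ℝ F x (Pi.single i 1)) := by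
  intro φ hφ hc hsupp i
  -- Only a neighbourhood of the support of `φ` matters. On a compact one `F` is Lipschitz and
  -- extends to a Lipschitz function on the whole space, for which integration by parts holds.
  obtain ⟨S, hS, hKS, hSΩ⟩ := exists_compact_between hc.isCompact hΩ hsupp
  obtain ⟨K, hK⟩ := (hF.mono hSΩ).exists_lipschitzOnWith_of_compact hS
  obtain ⟨g, hg, hgF⟩ := hK.extend_real
  obtain ⟨D, hD⟩ := (hφ.of_le (m := 1) (by exact_mod_cast le_top)).lipschitzWith_of_hasCompactSupport
    hc one_ne_zero
  have key := hg.integral_lineDeriv_mul_eq (μ := volume) hD hc (Pi.single i 1)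
  have e1 : ∫ x in Ω, F x * fderiv ℝ φ x (Pi.single i 1) =
      ∫ x, F x * fderiv ℝ φ x (Pi.single i 1) := by
    refine setIntegral_eq_integral_of_forall_compl_eq_zero fun x hx => ?_
    have : x ∉ tsupport (fderiv ℝ φ) := fun h' => hx (hsupp (tsupport_fderiv_subset ℝ h'))
    rw [image_eq_zero_of_notMem_tsupport this]
    simp
  have e2 : ∫ x in Ω, fderiv ℝ F x (Pi.single i 1) * φ x =
      ∫ x, fderiv ℝ F x (Pi.single i 1) * φ x := by
    refine setIntegral_eq_integral_of_forall_compl_eq_zero fun x hx => ?_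
    rw [image_eq_zero_of_notMem_tsupport fun h' => hx (hsupp h'), mul_zero]
  rw [e1, e2]
  have e3 : ∫ x, lineDeriv ℝ g x (Pi.single i 1) * φ x =
      ∫ x, fderiv ℝ F x (Pi.single i 1) * φ x := by
    refine integral_congr_ae ?_
    filter_upwards [hg.ae_differentiableAt (μ := volume)] with x hx
    by_cases hxs : x ∈ tsupport φ
    · rw [hx.lineDeriv_eq_fderiv]
      have : F =ᶠ[𝓝 x] g := by
        filter_upwards [isOpen_interior.mem_nhds (hKS hxs)] with y hy
        exact hgF (interior_subset hy)
      rw [this.fderiv_eq]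
    · rw [image_eq_zero_of_notMem_tsupport hxs, mul_zero, mul_zero]
  have e4 : ∫ x, lineDeriv ℝ φ x (-Pi.single i 1) * g x =
      - ∫ x, F x * fderiv ℝ φ x (Pi.single i 1) := by
    rw [← integral_neg]
    refine integral_congr_ae (Eventually.of_forall fun x => ?_)
    have hd : DifferentiableAt ℝ φ x := hφ.differentiable (by simp) x
    simp only [hd.lineDeriv_eq_fderiv, map_neg]
    by_cases hxs : x ∈ tsupport φ
    · rw [hgF (interior_subset (hKS hxs))]; ring
    · rw [image_eq_zero_of_notMem_tsupport fun h' => hxs (tsupport_fderiv_subset ℝ h')]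
      simp
  rw [← e3, key, e4, neg_neg]

end SobolevTrace

/-! ### Common visibility of neighbouring cubes and oscillation of `f ∘ T`. -/

namespace SobolevTrace

variable {n : ℕ} {Ω : Set (Fin n → ℝ)} {α θ : ℝ} {𝒬 : Set (Cube n)}

namespace IsWhitneyCovering

lemma infDist_le_of_mem (hW : IsWhitneyCovering Ω θ 𝒬) (h : IsProperDomain Ω α) {Q : Cube n}
    (hQ : Q ∈ 𝒬) {x : Fin n → ℝ} (hx : x ∈ Q.toSet) :
    Metric.infDist x (frontier Ω) ≤ 2 * Q.radius + setDist Q.toSet (frontier Ω) := by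
  obtain ⟨a, ha⟩ := exists_isNearestBoundaryPoint h.frontier_nonempty Q
  have h1 := Metric.infDist_le_dist_of_mem (x := x) ha.1
  have h2 := ha.dist_center h.isOpen (hW.1 _ hQ)
  have h3 := dist_triangle_right x a Q.center
  have h4 := Metric.mem_closedBall.1 hx
  linarith

lemma infDist_le_mul_radius (hW : IsWhitneyCovering Ω θ 𝒬) (h : IsProperDomain Ω α) (hn : 1 ≤ n)
    {Q : Cube n} (hQ : Q ∈ 𝒬) {x : Fin n → ℝ} (hx : x ∈ Q.toSet) :
    Metric.infDist x (frontier Ω) ≤ (1 + θ) * (2 * Q.radius) := by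
  have h1 := hW.infDist_le_of_mem h hQ hx
  have h2 := hW.setDist_le hn hQ
  linarith

lemma two_mul_radius_le_infDist (hW : IsWhitneyCovering Ω θ 𝒬) (h : IsProperDomain Ω α)
    (hn : 1 ≤ n) (hθ : 0 < θ) {Q : Cube n} (hQ : Q ∈ 𝒬) {x : Fin n → ℝ} (hx : x ∈ Q.toSet) :
    2 * Q.radius ≤ θ * Metric.infDist x (frontier Ω) :=
  (hW.two_mul_radius_le hn hθ hQ).trans
    (mul_le_mul_of_nonneg_left (setDist_le_infDist hx h.frontier_nonempty) hθ.le)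

lemma infDist_le_mul_infDist (hW : IsWhitneyCovering Ω θ 𝒬) (h : IsProperDomain Ω α)
    (hn : 1 ≤ n) (hθ : 0 < θ) {Q : Cube n} (hQ : Q ∈ 𝒬) {x y : Fin n → ℝ} (hx : x ∈ Q.toSet)
    (hy : y ∈ Q.toSet) :
    Metric.infDist y (frontier Ω) ≤ (1 + θ) * Metric.infDist x (frontier Ω) := by
  have h1 := hW.infDist_le_of_mem h hQ hy
  have h2 := hW.two_mul_radius_le_infDist h hn hθ hQ hx
  have h3 := setDist_le_infDist hx h.frontier_nonempty
  linarith

/-- Two nearby cubes of a Whitney covering are seen from a common cube inside the first one. -/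
lemma exists_common_cube (hW : IsWhitneyCovering Ω θ 𝒬) (h : IsProperDomain Ω α) (hn : 1 ≤ n)
    (hθ : 1 < θ) {η : ℝ} (hη : 22 * θ ^ 2 ≤ η)
    {T : (Fin n → ℝ) → alphaBoundary Ω α} (hT : IsBoundaryProjection Ω α 𝒬 T) {Q K : Cube n}
    (hQ : Q ∈ 𝒬) (hK : K ∈ 𝒬) {x w : Fin n → ℝ} (hx : x ∈ Q.toSet) (hw : w ∈ K.toSet)
    (hxw : dist x w ≤ Metric.infDist x (frontier Ω) / (50 * (1 + θ))) :
    ∃ P : Cube n, P.radius ≤ Q.radius ∧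
      P.toSet ⊆ Metric.ball Q.center Q.radius ∧
      (∀ y ∈ P.toSet, Metric.infDist y (frontier Ω) ≤ 2 * Metric.infDist x (frontier Ω)) ∧
      AlphaVisible Ω P (T Q.center) ∧ AlphaVisible Ω P (T K.center) ∧
      ell (T Q.center : Set (ℕ → Fin n → ℝ)) ∈ P.dilate η ∩ frontier Ω ∧
      ell (T K.center : Set (ℕ → Fin n → ℝ)) ∈ P.dilate η ∩ frontier Ω := by
  have hxΩ := hW.1 Q hQ hx
  have hd := h.infDist_pos hxΩ
  have hdr := hW.infDist_le_mul_radius h hn hQ hx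
  set d := Metric.infDist x (frontier Ω) with hddef
  have hr := Q.radius_pos
  have hθ0 : 0 < 1 + θ := by linarith
  -- A length that suits both cubes. The distance to the boundary is at most `(1 + θ) * (2 * r)` on
  -- `Q`, whence `e ≤ 2 * r`. It is also at most `1 + θ` times the distance of the cube from `∂Ω`,
  -- so that distance is at least `49 / 50 * e` for both cubes.
  set e : ℝ := d / (1 + θ) with he
  have he0 : 0 < e := by positivity
  have hde : d = (1 + θ) * e := by rw [he]; field_simp
  have hxw' : dist x w ≤ e / 50 := by
    refine hxw.trans (le_of_eq ?_)
    rw [he]; field_simp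
  have her : e ≤ 2 * Q.radius := by
    rw [hde] at hdr
    exact le_of_mul_le_mul_left hdr hθ0
  have hdw : |d - Metric.infDist w (frontier Ω)| ≤ e / 50 := by
    have h1 := Metric.infDist_le_infDist_add_dist (s := frontier Ω) (x := x) (y := w)
    have h2 := Metric.infDist_le_infDist_add_dist (s := frontier Ω) (x := w) (y := x)
    rw [dist_comm w x] at h2
    rw [abs_le]; constructor <;> linarith
  obtain ⟨hdw1, hdw2⟩ := abs_le.1 hdw
  -- Moving from `x` towards the centre by at most `e / 2` gains a margin of `e / 2` to the surface
  -- of `Q`, even if `x` lies on it.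
  set z : Fin n → ℝ := AffineMap.lineMap x Q.center (e / 2 / Q.radius) with hz
  have ht0 : 0 ≤ e / 2 / Q.radius := by positivity
  have ht1 : e / 2 / Q.radius ≤ 1 := by rw [div_le_one hr]; linarith
  have hxc := Metric.mem_closedBall.1 hx
  have hzx : dist z x ≤ e / 2 := by
    rw [hz, dist_lineMap_left, Real.norm_of_nonneg ht0]
    calc _ ≤ e / 2 / Q.radius * Q.radius := by gcongr
      _ = e / 2 := by field_simp
  have hzc : dist z Q.center ≤ Q.radius - e / 2 := by
    rw [hz, dist_lineMap_right, Real.norm_of_nonneg (by linarith)]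
    calc _ ≤ (1 - e / 2 / Q.radius) * Q.radius := by
          have : 0 ≤ 1 - e / 2 / Q.radius := by linarith
          gcongr
      _ = _ := by field_simp
  -- The radius is less than `e / 2`, so `P` lies in the interior of `Q`, and `2 / 5 + 26 / 50 < 49
  -- / 50`, so `P` lies in the enlarged cubes that see both nearest points. It is still large enough
  -- for `η * P` to contain both of them.
  set P : Cube n := ⟨z, 2 / 5 * e, by positivity⟩ with hP
  have hPz : ∀ y ∈ P.toSet, dist y z ≤ 2 / 5 * e := fun y hy => Metric.mem_closedBall.1 hy
  have hPQ : P.toSet ⊆ Metric.ball Q.center Q.radius := by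
    intro y hy
    have := dist_triangle y z Q.center
    have := hPz y hy
    rw [Metric.mem_ball]
    linarith
  have hnear : ∀ L ∈ 𝒬, ∀ v ∈ L.toSet, dist x v ≤ e / 50 →
      d - e / 50 ≤ Metric.infDist v (frontier Ω) → Metric.infDist v (frontier Ω) ≤ d + e / 50 →
      AlphaVisible Ω P (T L.center) ∧
      ell (T L.center : Set (ℕ → Fin n → ℝ)) ∈ P.dilate η ∩ frontier Ω := by
    intro L hL v hv hxv hv1 hv2
    obtain ⟨a, ha, hTa⟩ := hT.exists_nearest hL
    have hLs := setDist_le_infDist hv h.frontier_nonempty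
    have hLr := hW.two_mul_radius_le hn (by linarith) hL
    have hLd := hW.infDist_le_of_mem h hL hv
    have hvc := Metric.mem_closedBall.1 hv
    set s := setDist L.toSet (frontier Ω) with hs
    have hse : 49 / 50 * e ≤ s := by
      have : (1 + θ) * (49 / 50 * e) ≤ (1 + θ) * s := by nlinarith
      exact le_of_mul_le_mul_left this hθ0
    have hzv : dist z v ≤ e / 2 + e / 50 := by
      have := dist_triangle z x v
      linarith
    rw [hTa]
    refine ⟨h.alphaVisible_visibleElement (hW.1 _ hL) ha ?_, ?_, ?_⟩
    · intro y hy
      have h1 := hPz y hy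
      have h2 := dist_triangle y z L.center
      have h3 := dist_triangle z v L.center
      rw [Metric.mem_ball]
      linarith
    · rw [h.ell_visibleElement (hW.1 _ hL) ha]
      have h1 := ha.dist_center h.isOpen (hW.1 _ hL)
      have h2 := dist_triangle_right a v L.center
      have h3 := dist_triangle_right a z v
      have h4 : dist a z ≤ (1 + θ) * ((1 + θ) * e + e / 50) + (e / 2 + e / 50) := by
        have : (1 + θ) * Metric.infDist v (frontier Ω) ≤ (1 + θ) * ((1 + θ) * e + e / 50) := by
          gcongr; linarith
        nlinarith
      refine Metric.mem_closedBall.2 (h4.trans ?_)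
      -- The nearest point is within `((1 + θ) ^ 2 + (1 + θ) / 50 + 26 / 50) * e` of the centre of
      -- `P`; the assumed size of `η` ensures that this is covered.
      have h5 : 22 * θ ^ 2 * (2 / 5 * e) ≤ η * (2 / 5 * e) := by gcongr
      refine le_trans ?_ h5
      have : (1 + θ) * (1 + θ) + (1 + θ) / 50 + 26 / 50 ≤ 22 * θ ^ 2 * (2 / 5) := by nlinarith
      nlinarith
    · rw [h.ell_visibleElement (hW.1 _ hL) ha]
      exact ha.1
  obtain ⟨v1, e1⟩ := hnear Q hQ x hx (by rw [dist_self]; positivity) (by linarith) (by linarith)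
  obtain ⟨v2, e2⟩ := hnear K hK w hw hxw' (by linarith) (by linarith)
  refine ⟨P, ?_, hPQ, ?_, v1, v2, e1, e2⟩
  · change 2 / 5 * e ≤ Q.radius
    linarith
  · intro y hy
    have h1 := hPz y hy
    have h2 := dist_triangle y z x
    have h3 := Metric.infDist_le_infDist_add_dist (s := frontier Ω) (x := y) (y := x)
    have : e ≤ d := by nlinarith
    linarith

end IsWhitneyCovering

/-- The variational bound controls the oscillation of `f ∘ T` over neighbouring cubes. -/
lemma VariationalBound.exists_oscillation {p ε η lam : ℝ} {f : SobolevBoundary Ω p → ℝ}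
    (hv : VariationalBound Ω p ε η f lam) (hW : IsWhitneyCovering Ω θ 𝒬)
    (h : IsProperDomain Ω (sobolevExponent n p)) (hn : 1 ≤ n) (hp : (n : ℝ) < p)
    (hθ : 1 < θ) (hη : 22 * θ ^ 2 ≤ η) {T : (Fin n → ℝ) → SobolevBoundary Ω p}
    (hT : IsBoundaryProjection Ω (sobolevExponent n p) 𝒬 T) :
    ∃ M : Cube n → ℝ, (∀ Q, 0 ≤ M Q) ∧
      (∀ Q ∈ 𝒬, ∀ K ∈ 𝒬, ∀ x ∈ Q.toSet, ∀ w ∈ K.toSet,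
        dist x w ≤ Metric.infDist x (frontier Ω) / (50 * (1 + θ)) →
        Metric.infDist x (frontier Ω) < ε / 2 → |f (T Q.center) - f (T K.center)| ≤ M Q) ∧
      ∀ s : Finset (Cube n), ↑s ⊆ 𝒬 →
        ∑ Q ∈ s, M Q ^ p * (2 * Q.radius) ^ (n - p) ≤ 2 ^ p * lam := by
  have hn1 : (1 : ℝ) ≤ n := by exact_mod_cast hn
  have hp0 : 0 < p := by linarith
  set Nbr : Cube n → Cube n → Prop := fun Q K => Q ∈ 𝒬 ∧ K ∈ 𝒬 ∧ ∃ x ∈ Q.toSet, ∃ w ∈ K.toSet,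
    dist x w ≤ Metric.infDist x (frontier Ω) / (50 * (1 + θ)) ∧
    Metric.infDist x (frontier Ω) < ε / 2 with hNbr
  have hcube : ∀ Q K, Nbr Q K → ∃ P : Cube n, P.radius ≤ Q.radius ∧
      P.toSet ⊆ Metric.ball Q.center Q.radius ∧ P.toSet ⊆ boundaryNhd Ω ε ∧
      (AlphaVisible Ω P (T Q.center) ∧ AlphaVisible Ω P (T K.center)) ∧
      ell (T Q.center : Set (ℕ → Fin n → ℝ)) ∈ P.dilate η ∩ frontier Ω ∧
      ell (T K.center : Set (ℕ → Fin n → ℝ)) ∈ P.dilate η ∩ frontier Ω := by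
    rintro Q K ⟨hQ, hK, x, hx, w, hw, hxw, hxε⟩
    obtain ⟨P, h1, h2, h3, h4, h5, h6, h7⟩ :=
      hW.exists_common_cube h hn hθ hη hT hQ hK hx hw hxw
    refine ⟨P, h1, h2, fun y hy => ⟨hW.1 _ hQ (Q.ball_subset_toSet (h2 hy)), ?_⟩, ⟨h4, h5⟩, h6, h7⟩
    linarith [h3 y hy]
  have hterm : ∀ (Q P : Cube n) (t : ℝ), P.radius ≤ Q.radius →
      |t| ^ p * (2 * Q.radius) ^ (n - p) ≤ |t| ^ p / P.diam ^ (p - n) := by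
    intro Q P t hPQ
    rw [Cube.diam_eq hn, div_eq_mul_inv, ← Real.rpow_neg (by linarith [P.radius_pos]), neg_sub]
    refine mul_le_mul_of_nonneg_left ?_ (by positivity)
    exact Real.rpow_le_rpow_of_nonpos (by linarith [P.radius_pos]) (by linarith) (by linarith)
  have hfam : ∀ (s : Finset (Cube n)) (K : Cube n → Cube n), (∀ Q ∈ s, Nbr Q (K Q)) →
      ∑ Q ∈ s, |f (T Q.center) - f (T (K Q).center)| ^ p * (2 * Q.radius) ^ (n - p) ≤ lam := by
    intro s K hK
    -- One neighbour is selected for each `Q`, and the common cube lies in the interior of `Q`. The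
    -- family is therefore pairwise disjoint and admissible in the variational bound. Replacing `P`
    -- by the larger `Q` in the denominator costs nothing because `n - p < 0`.
    choose! P h1 h2 h3 h4 h5 using fun Q (hQ : Q ∈ s) => hcube Q (K Q) (hK Q hQ)
    have key := hv s.card (fun i => P (s.equivFin.symm i))
      (fun i => T (s.equivFin.symm i : Cube n).center)
      (fun i => T (K (s.equivFin.symm i)).center)
      (fun i => h3 _ (s.equivFin.symm i).2)
      (fun i j hij => by
        have hne : (s.equivFin.symm i : Cube n) ≠ s.equivFin.symm j := fun e =>
          hij (s.equivFin.symm.injective (Subtype.ext e))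
        have hd := hW.disjoint_ball (i := ⟨_, (hK _ (s.equivFin.symm i).2).1⟩)
          (j := ⟨_, (hK _ (s.equivFin.symm j).2).1⟩) (fun e => hne (congrArg (fun q : 𝒬 => q.1) e))
        exact hd.mono (h2 _ (s.equivFin.symm i).2) (h2 _ (s.equivFin.symm j).2))
      (fun i => h4 _ (s.equivFin.symm i).2)
      (fun i => h5 _ (s.equivFin.symm i).2)
    rw [Equiv.sum_comp s.equivFin.symm (fun Q : s => |f (T (Q : Cube n).center) -
      f (T (K Q).center)| ^ p / (P Q).diam ^ (p - n))] at key
    rw [← Finset.sum_coe_sort s]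
    exact (Finset.sum_le_sum fun (Q : s) _ => hterm Q (P Q) _ (h1 Q Q.2)).trans key
  have hM : ∀ Q : Cube n, ∃ M : ℝ, 0 ≤ M ∧
      (∀ K, Nbr Q K → |f (T Q.center) - f (T K.center)| ≤ M) ∧
      (M = 0 ∨ ∃ K, Nbr Q K ∧ M = 2 * |f (T Q.center) - f (T K.center)|) := by
    intro Q
    set S : Set ℝ := {t | ∃ K, Nbr Q K ∧ t = |f (T Q.center) - f (T K.center)|} with hS
    -- The variational bound for a family of one cube makes the oscillation finite before a supremum
    -- is taken.
    have hbdd : BddAbove S := by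
      refine ⟨(lam * (2 * Q.radius) ^ (p - n)) ^ (1 / p), ?_⟩
      rintro t ⟨K, hK, rfl⟩
      have h1 := hfam {Q} (fun _ => K) (by simpa using hK)
      rw [Finset.sum_singleton] at h1
      have hr : 0 < 2 * Q.radius := by linarith [Q.radius_pos]
      have h2 : |f (T Q.center) - f (T K.center)| ^ p ≤ lam * (2 * Q.radius) ^ (p - n) := by
        rw [show (n : ℝ) - p = -(p - n) by ring, Real.rpow_neg hr.le, ← div_eq_mul_inv,
          div_le_iff₀ (Real.rpow_pos_of_pos hr _)] at h1
        exact h1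
      have h3 := Real.rpow_le_rpow (by positivity) h2 (by positivity : 0 ≤ 1 / p)
      rwa [← Real.rpow_mul (abs_nonneg _), mul_one_div_cancel hp0.ne', Real.rpow_one] at h3
    by_cases hpos : ∃ t ∈ S, 0 < t
    · obtain ⟨t, htS, ht⟩ := hpos
      have hsup : 0 < sSup S := ht.trans_le (le_csSup hbdd htS)
      -- The supremum need not be attained, so a neighbour with more than half of it is chosen and
      -- `M` is twice its difference. The loss is the factor `2 ^ p`.
      obtain ⟨t', ⟨K, hK, rfl⟩, ht'⟩ := exists_lt_of_lt_csSup ⟨t, htS⟩ (half_lt_self hsup)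
      refine ⟨_, by positivity, fun K' hK' => ?_, Or.inr ⟨K, hK, rfl⟩⟩
      have := le_csSup hbdd ⟨K', hK', rfl⟩
      linarith
    · push Not at hpos
      exact ⟨0, le_rfl, fun K hK => hpos _ ⟨K, hK, rfl⟩, Or.inl rfl⟩
  choose M hM0 hMle hMeq using hM
  refine ⟨M, hM0, fun Q hQ K hK x hx w hw hxw hxε =>
    hMle Q K ⟨hQ, hK, x, hx, w, hw, hxw, hxε⟩, fun s hs => ?_⟩
  classical
  choose! K hK using fun Q (hQ : M Q ≠ 0) => (hMeq Q).resolve_left hQ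
  have hzero : ∀ Q ∈ s, Q ∉ s.filter (fun Q => M Q ≠ 0) →
      M Q ^ p * (2 * Q.radius) ^ (n - p) = 0 := by
    intro Q hQ hQ'
    have : M Q = 0 := by
      by_contra hne
      exact hQ' (Finset.mem_filter.2 ⟨hQ, hne⟩)
    rw [this, Real.zero_rpow hp0.ne', zero_mul]
  rw [← Finset.sum_subset (Finset.filter_subset (fun Q => M Q ≠ 0) s) hzero]
  have h1 := hfam (s.filter fun Q => M Q ≠ 0) K fun Q hQ => (hK Q (Finset.mem_filter.1 hQ).2).1
  calc _ = ∑ Q ∈ s.filter fun Q => M Q ≠ 0, 2 ^ p *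
        (|f (T Q.center) - f (T (K Q).center)| ^ p * (2 * Q.radius) ^ (n - p)) := by
        refine Finset.sum_congr rfl fun Q hQ => ?_
        rw [(hK Q (Finset.mem_filter.1 hQ).2).2, Real.mul_rpow (by norm_num) (abs_nonneg _),
          mul_assoc]
    _ ≤ _ := by
        rw [← Finset.mul_sum]
        gcongr

end SobolevTrace

/-! ### The extension and its pointwise and integral bounds. -/

namespace SobolevTrace

variable {n : ℕ} {Ω : Set (Fin n → ℝ)} {α θ : ℝ} {𝒬 : Set (Cube n)}

/-- A piecewise linear function equal to `1` for `t ≤ τ / 2` and to `0` for `t ≥ τ`. -/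
noncomputable def cutoff (τ t : ℝ) : ℝ := max 0 (min 1 (2 - 2 / τ * t))

lemma cutoff_nonneg (τ t : ℝ) : 0 ≤ cutoff τ t := le_max_left _ _

lemma cutoff_le_one (τ t : ℝ) : cutoff τ t ≤ 1 := max_le zero_le_one (min_le_left _ _)

lemma cutoff_eq_zero {τ t : ℝ} (hτ : 0 < τ) (ht : τ ≤ t) : cutoff τ t = 0 := by
  refine max_eq_left ((min_le_right _ _).trans ?_)
  rw [sub_nonpos, div_mul_eq_mul_div, le_div_iff₀ hτ]
  linarith

lemma cutoff_eq_one {τ t : ℝ} (hτ : 0 < τ) (ht : t ≤ τ / 2) : cutoff τ t = 1 := by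
  unfold cutoff
  rw [min_eq_left, max_eq_right zero_le_one]
  have : 2 / τ * t ≤ 1 := by
    rw [div_mul_eq_mul_div, div_le_iff₀ hτ]
    linarith
  linarith

lemma abs_cutoff_sub_le {τ : ℝ} (hτ : 0 < τ) (s t : ℝ) :
    |cutoff τ s - cutoff τ t| ≤ 2 / τ * |s - t| := by
  have h1 := abs_max_sub_max_le_max 0 (min 1 (2 - 2 / τ * s)) 0 (min 1 (2 - 2 / τ * t))
  have h2 := abs_min_sub_min_le_max 1 (2 - 2 / τ * s) 1 (2 - 2 / τ * t)
  have h3 : |2 - 2 / τ * s - (2 - 2 / τ * t)| = 2 / τ * |s - t| := by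
    rw [show 2 - 2 / τ * s - (2 - 2 / τ * t) = 2 / τ * (t - s) by ring, abs_mul,
      abs_of_pos (by positivity), abs_sub_comm]
  have h4 : 0 ≤ 2 / τ * |s - t| := by positivity
  rw [h3] at h2
  simp only [sub_self, abs_zero, max_eq_right h4] at h1 h2
  exact h1.trans (max_le h4 h2)

/-- The averages of `c` over cubes of size comparable to the distance to the boundary, cut off
at distance `τ` from the boundary. -/
noncomputable def whitneyExtension (Ω : Set (Fin n → ℝ)) (θ τ : ℝ) (c : (Fin n → ℝ) → ℝ)
    (x : Fin n → ℝ) : ℝ :=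
  cutoff τ (Metric.infDist x (frontier Ω)) *
    bumpAverage c x (Metric.infDist x (frontier Ω) / (50 * (1 + θ)))

lemma IsWhitneyCovering.aestronglyMeasurable (hW : IsWhitneyCovering Ω θ 𝒬)
    {c : (Fin n → ℝ) → ℝ}
    (hc : ∀ Q ∈ 𝒬, ∀ w ∈ Metric.ball Q.center Q.radius, c w = c Q.center) :
    AEStronglyMeasurable c (volume.restrict Ω) := by
  have := hW.countable
  rw [Measure.restrict_congr_set hW.ae_eq_iUnion_ball, aestronglyMeasurable_iUnion_iff]
  intro Q
  refine (aestronglyMeasurable_const (b := c Q.1.center)).congr ?_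
  filter_upwards [ae_restrict_mem measurableSet_ball] with x hx
  exact (hc Q Q.2 x hx).symm

/-- Let `ρ` be the averaging radius at `x₀`. Within `ρ / 8` of `x₀` the averaging radius varies
between `ρ / 2` and `3 * ρ / 2`, and the supports, half as large, stay in the ball of radius `ρ`.
There `c` differs from `c Q.center` by at most `M` almost everywhere, so
`exists_bumpAverage_lipschitz` applies. -/
lemma exists_whitneyAverage_lipschitz (n : ℕ) {θ : ℝ} (hθ : 1 < θ) : ∃ C : ℝ, 0 < C ∧
    ∀ (Ω : Set (Fin n → ℝ)) (α : ℝ), IsProperDomain Ω α →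
    ∀ 𝒬 : Set (Cube n), IsWhitneyCovering Ω θ 𝒬 →
    ∀ c : (Fin n → ℝ) → ℝ, (∀ Q ∈ 𝒬, ∀ w ∈ Metric.ball Q.center Q.radius, c w = c Q.center) →
    ∀ (Q : Cube n) (x₀ : Fin n → ℝ) (M d : ℝ), x₀ ∈ Ω → 0 ≤ M →
    d = Metric.infDist x₀ (frontier Ω) →
    (∀ K ∈ 𝒬, ∀ w ∈ K.toSet, dist x₀ w ≤ d / (50 * (1 + θ)) → |c Q.center - c K.center| ≤ M) →
    ∀ x ∈ Metric.ball x₀ (d / (400 * (1 + θ))), ∀ x' ∈ Metric.ball x₀ (d / (400 * (1 + θ))),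
    |bumpAverage c x (Metric.infDist x (frontier Ω) / (50 * (1 + θ))) - c Q.center| ≤ M ∧
    |bumpAverage c x' (Metric.infDist x' (frontier Ω) / (50 * (1 + θ))) -
      bumpAverage c x (Metric.infDist x (frontier Ω) / (50 * (1 + θ)))| ≤
      C * (M / d) * dist x' x := by
  obtain ⟨C, hC0, hC⟩ := exists_bumpAverage_lipschitz n
  have hθ0 : 0 < 50 * (1 + θ) := by linarith
  refine ⟨C * (50 * (1 + θ)) * 2, by positivity, ?_⟩
  intro Ω α h 𝒬 hW c hc Q x₀ M d hx₀ hM hd hosc x hx x' hx'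
  have hd0 : 0 < d := hd ▸ h.infDist_pos hx₀
  set ρ := d / (50 * (1 + θ)) with hρ
  have hρ0 : 0 < ρ := by positivity
  have hρd : ρ * 100 ≤ d := by
    rw [hρ, div_mul_eq_mul_div, div_le_iff₀ hθ0]
    nlinarith
  have hρ8 : d / (400 * (1 + θ)) = ρ / 8 := by
    rw [hρ, div_div]; congr 1; ring
  have hball : Metric.ball x₀ ρ ⊆ Ω := fun w hw =>
    h.mem_of_dist_lt hx₀ (by rw [← hd]; linarith [Metric.mem_ball.1 hw])
  have hmeas : AEStronglyMeasurable c (volume.restrict (Metric.ball x₀ ρ)) :=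
    (hW.aestronglyMeasurable hc).mono_measure (Measure.restrict_mono hball le_rfl)
  have hae : ∀ᵐ w ∂volume.restrict (Metric.ball x₀ ρ), |c w - c Q.center| ≤ M := by
    rw [ae_restrict_iff' measurableSet_ball]
    filter_upwards [hW.ae_eq_iUnion_ball.mem_iff] with w hw hwb
    obtain ⟨K, hK⟩ := Set.mem_iUnion.1 (hw.1 (hball hwb))
    rw [hc K K.2 w hK, abs_sub_comm]
    refine hosc K K.2 w (K.1.ball_subset_toSet hK) ?_
    rw [dist_comm]
    exact (Metric.mem_ball.1 hwb).le
  rw [hρ8] at hx hx'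
  have hrad : ∀ y ∈ Metric.ball x₀ (ρ / 8),
      ρ / 2 ≤ Metric.infDist y (frontier Ω) / (50 * (1 + θ)) ∧
      Metric.infDist y (frontier Ω) / (50 * (1 + θ)) / 2 + dist y x₀ ≤ ρ := by
    intro y hy
    have hy' := Metric.mem_ball.1 hy
    have h1 := Metric.infDist_le_infDist_add_dist (s := frontier Ω) (x := y) (y := x₀)
    have h2 := Metric.infDist_le_infDist_add_dist (s := frontier Ω) (x := x₀) (y := y)
    rw [dist_comm x₀ y] at h2
    rw [← hd] at h1 h2
    have h3 : ρ / 2 ≤ Metric.infDist y (frontier Ω) / (50 * (1 + θ)) := by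
      rw [hρ, div_div, mul_comm, ← div_div]
      gcongr
      linarith
    have h4 : Metric.infDist y (frontier Ω) / (50 * (1 + θ)) ≤ 3 / 2 * ρ := by
      rw [hρ, ← mul_div_assoc]
      gcongr
      linarith
    exact ⟨h3, by linarith⟩
  obtain ⟨k1, k2⟩ := hC c (c Q.center) M ρ x₀ hρ0 hM hmeas hae x x' _ _ (hrad x hx).1 (hrad x' hx').1
    (hrad x hx).2 (hrad x' hx').2
  refine ⟨k1, k2.trans ?_⟩
  have h5 : |Metric.infDist x' (frontier Ω) / (50 * (1 + θ)) -
      Metric.infDist x (frontier Ω) / (50 * (1 + θ))| ≤ dist x' x := by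
    rw [← sub_div, abs_div, abs_of_pos hθ0, div_le_iff₀ hθ0]
    have h6 := (Metric.lipschitz_infDist_pt (frontier Ω)).dist_le_mul x' x
    rw [Real.dist_eq, NNReal.coe_one, one_mul] at h6
    have := dist_nonneg (x := x') (y := x)
    nlinarith
  have h7 : M / ρ = 50 * (1 + θ) * (M / d) := by rw [hρ]; field_simp
  rw [h7]
  calc _ ≤ C * (50 * (1 + θ) * (M / d)) * (dist x' x + dist x' x) := by gcongr
    _ = _ := by ring

/-- The product rule in Lipschitz form: the average contributes `M Q / d`, comparable to `M Q / r`,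
and the cutoff contributes `(|c Q.center| + M Q) / τ`. Because `τ < ε / 2`, the oscillation
hypothesis is available wherever the extension does not vanish. -/
theorem exists_whitneyExtension_bounds (n : ℕ) (hn : 1 ≤ n) {ε θ : ℝ} (hε : 0 < ε) (hθ : 1 < θ) :
    ∃ A : ℝ, 0 < A ∧ ∀ (Ω : Set (Fin n → ℝ)) (α : ℝ), IsProperDomain Ω α →
    ∀ 𝒬 : Set (Cube n), IsWhitneyCovering Ω θ 𝒬 →
    ∀ c : (Fin n → ℝ) → ℝ, (∀ Q ∈ 𝒬, ∀ w ∈ Metric.ball Q.center Q.radius, c w = c Q.center) →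
    ∀ M : Cube n → ℝ, (∀ Q, 0 ≤ M Q) →
    (∀ Q ∈ 𝒬, ∀ K ∈ 𝒬, ∀ x ∈ Q.toSet, ∀ w ∈ K.toSet,
      dist x w ≤ Metric.infDist x (frontier Ω) / (50 * (1 + θ)) →
      Metric.infDist x (frontier Ω) < ε / 2 → |c Q.center - c K.center| ≤ M Q) →
    ∀ (τ : ℝ) (F : (Fin n → ℝ) → ℝ), τ = ε / (2 * (1 + θ)) → F = whitneyExtension Ω θ τ c →
    LocallyLipschitzOn Ω F ∧ ∀ Q ∈ 𝒬, ∀ x ∈ Q.toSet,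
      |F x| ≤ A * (M Q / (2 * Q.radius) + |c Q.center|) ∧
      ‖fderiv ℝ F x‖ ≤ A * (M Q / (2 * Q.radius) + |c Q.center|) ∧
      (τ < Metric.infDist x (frontier Ω) → F x = 0 ∧ fderiv ℝ F x = 0) ∧
      (Metric.infDist x (frontier Ω) ≤ τ / 2 → |F x - c Q.center| ≤ M Q) := by
  obtain ⟨C, hC0, hC⟩ := exists_whitneyAverage_lipschitz n hθ
  have hθ0 : 0 < θ := by linarith
  set τ₀ : ℝ := ε / (2 * (1 + θ)) with hτ₀
  have hτ0 : 0 < τ₀ := by positivity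
  -- The three summands come from the slope of the average, the slope of the cutoff and the size of
  -- the extension.
  refine ⟨C * θ + 2 / τ₀ * (1 + θ * ε) + (1 + θ * ε), by positivity, ?_⟩
  intro Ω α h 𝒬 hW c hc M hM0 hM τ F hτ hF
  subst hτ
  have hτε : τ₀ < ε / 2 := by
    rw [hτ₀, div_lt_div_iff₀ (by positivity) (by norm_num)]
    nlinarith
  have hFx : ∀ x, F x = cutoff τ₀ (Metric.infDist x (frontier Ω)) *
    bumpAverage c x (Metric.infDist x (frontier Ω) / (50 * (1 + θ))) := fun x => by rw [hF]; rfl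
  have hfar : ∀ x, τ₀ < Metric.infDist x (frontier Ω) → F =ᶠ[𝓝 x] fun _ => 0 := by
    intro x hx
    have : IsOpen {y | τ₀ < Metric.infDist y (frontier Ω)} :=
      isOpen_lt continuous_const (Metric.continuous_infDist_pt _)
    filter_upwards [this.mem_nhds hx] with y hy
    rw [hFx, cutoff_eq_zero hτ0 (le_of_lt hy), zero_mul]
  have hloc : ∀ Q ∈ 𝒬, ∀ x₀ ∈ Q.toSet, Metric.infDist x₀ (frontier Ω) < ε / 2 →
      |bumpAverage c x₀ (Metric.infDist x₀ (frontier Ω) / (50 * (1 + θ))) - c Q.center| ≤ M Q ∧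
      ∃ s ∈ 𝓝 x₀, LipschitzOnWith (Real.toNNReal (C * (M Q / Metric.infDist x₀ (frontier Ω)) +
        2 / τ₀ * (|c Q.center| + M Q))) F s := by
    intro Q hQ x₀ hx₀ hxε
    have hxΩ := hW.1 Q hQ hx₀
    have hd0 := h.infDist_pos hxΩ
    set d := Metric.infDist x₀ (frontier Ω) with hd
    have key := hC Ω α h 𝒬 hW c hc Q x₀ (M Q) d hxΩ (hM0 Q) hd
      (fun K hK w hw hxw => hM Q hQ K hK x₀ hx₀ w hw hxw hxε)
    have hr : 0 < d / (400 * (1 + θ)) := by positivity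
    refine ⟨(key x₀ (Metric.mem_ball_self hr) x₀ (Metric.mem_ball_self hr)).1,
      Metric.ball x₀ (d / (400 * (1 + θ))), Metric.ball_mem_nhds _ hr, ?_⟩
    have hMQ := hM0 Q
    refine LipschitzOnWith.of_dist_le_mul fun x' hx' x hx => ?_
    rw [Real.coe_toNNReal _ (by positivity), Real.dist_eq, hFx, hFx]
    obtain ⟨k1, k2⟩ := key x hx x' hx'
    set E' := bumpAverage c x' (Metric.infDist x' (frontier Ω) / (50 * (1 + θ)))
    set E := bumpAverage c x (Metric.infDist x (frontier Ω) / (50 * (1 + θ)))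
    set χ' := cutoff τ₀ (Metric.infDist x' (frontier Ω)) with hχ'
    set χ := cutoff τ₀ (Metric.infDist x (frontier Ω)) with hχ
    have k3 : |E| ≤ |c Q.center| + M Q := by
      have := abs_add_le (E - c Q.center) (c Q.center)
      rw [sub_add_cancel] at this
      linarith
    have k4 : |χ' - χ| ≤ 2 / τ₀ * dist x' x := by
      refine (abs_cutoff_sub_le hτ0 _ _).trans ?_
      have h6 := (Metric.lipschitz_infDist_pt (frontier Ω)).dist_le_mul x' x
      rw [Real.dist_eq, NNReal.coe_one, one_mul] at h6
      gcongr
    have k5 : |χ'| ≤ 1 := by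
      rw [abs_of_nonneg (cutoff_nonneg _ _)]; exact cutoff_le_one _ _
    calc |χ' * E' - χ * E| = |χ' * (E' - E) + (χ' - χ) * E| := by congr 1; ring
      _ ≤ |χ'| * |E' - E| + |χ' - χ| * |E| := by
          rw [← abs_mul, ← abs_mul]; exact abs_add_le _ _
      _ ≤ 1 * (C * (M Q / d) * dist x' x) + 2 / τ₀ * dist x' x * (|c Q.center| + M Q) := by gcongr
      _ = _ := by ring
  refine ⟨?_, ?_⟩
  · intro x hx
    obtain ⟨Q, hQ, hxQ⟩ := Set.mem_iUnion₂.1 (hW.2.1 hx)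
    by_cases hxε : Metric.infDist x (frontier Ω) < ε / 2
    · obtain ⟨s, hs, hL⟩ := (hloc Q hQ x hxQ hxε).2
      exact ⟨_, s, mem_nhdsWithin_of_mem_nhds hs, hL⟩
    · have hev := hfar x (hτε.trans_le (not_lt.1 hxε))
      refine ⟨0, {y | F y = 0}, mem_nhdsWithin_of_mem_nhds hev, ?_⟩
      refine LipschitzOnWith.of_dist_le_mul fun y hy z hz => ?_
      rw [show F y = 0 from hy, show F z = 0 from hz]
      simp
  · intro Q hQ x hx
    have hMQ := hM0 Q
    have hr := Q.radius_pos
    have hrd := hW.two_mul_radius_le_infDist h hn hθ0 hQ hx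
    have hd0 := h.infDist_pos (hW.1 Q hQ hx)
    set d := Metric.infDist x (frontier Ω) with hd
    have hB0 : 0 ≤ M Q / (2 * Q.radius) + |c Q.center| := by positivity
    have hzero : τ₀ < d → F x = 0 ∧ fderiv ℝ F x = 0 := fun hlt => by
      refine ⟨(hfar x hlt).self_of_nhds, ?_⟩
      rw [(hfar x hlt).fderiv_eq]
      simp
    -- Where the cutoff acts the cubes have bounded size, so `M Q` itself is absorbed by `M Q / r`.
    have hMr : d ≤ τ₀ → M Q ≤ θ * ε * (M Q / (2 * Q.radius)) := by
      intro hle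
      rw [mul_div_assoc', le_div_iff₀ (by positivity)]
      have : 2 * Q.radius ≤ θ * ε := hrd.trans (by gcongr; linarith)
      nlinarith
    have hsum : d ≤ τ₀ → |c Q.center| + M Q ≤
        (1 + θ * ε) * (M Q / (2 * Q.radius) + |c Q.center|) := by
      intro hle
      have h1 := hMr hle
      have h2 : 0 ≤ M Q / (2 * Q.radius) := by positivity
      have h3 : 0 ≤ θ * ε * |c Q.center| := by positivity
      nlinarith
    refine ⟨?_, ?_, hzero, ?_⟩
    · rcases lt_or_ge τ₀ d with hlt | hle
      · rw [(hzero hlt).1, abs_zero]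
        positivity
      · have k1 := (hloc Q hQ x hx (lt_of_le_of_lt hle hτε)).1
        rw [hFx, abs_mul, abs_of_nonneg (cutoff_nonneg _ _)]
        have k2 : |bumpAverage c x (d / (50 * (1 + θ)))| ≤ |c Q.center| + M Q := by
          have := abs_add_le (bumpAverage c x (d / (50 * (1 + θ))) - c Q.center) (c Q.center)
          rw [sub_add_cancel] at this
          linarith
        refine (mul_le_of_le_one_left (abs_nonneg _) (cutoff_le_one _ _)).trans
          (k2.trans ((hsum hle).trans (mul_le_mul_of_nonneg_right ?_ hB0)))
        have : 0 ≤ C * θ + 2 / τ₀ * (1 + θ * ε) := by positivity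
        linarith
    · rcases lt_or_ge τ₀ d with hlt | hle
      · rw [(hzero hlt).2, norm_zero]
        positivity
      · obtain ⟨s, hs, hL⟩ := (hloc Q hQ x hx (lt_of_le_of_lt hle hτε)).2
        refine (norm_fderiv_le_of_lipschitzOn ℝ hs hL).trans ?_
        rw [Real.coe_toNNReal _ (by positivity), ← hd]
        have k1 : M Q / d ≤ θ * (M Q / (2 * Q.radius)) := by
          rw [mul_div_assoc', div_le_div_iff₀ hd0 (by positivity)]
          nlinarith
        have k2 : M Q / (2 * Q.radius) ≤ M Q / (2 * Q.radius) + |c Q.center| := by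
          linarith [abs_nonneg (c Q.center)]
        calc _ ≤ C * (θ * (M Q / (2 * Q.radius) + |c Q.center|)) +
              2 / τ₀ * ((1 + θ * ε) * (M Q / (2 * Q.radius) + |c Q.center|)) := by
              have := hsum hle
              gcongr
              exact k1.trans (by gcongr)
          _ ≤ _ := by
              have : 0 ≤ (1 + θ * ε) * (M Q / (2 * Q.radius) + |c Q.center|) := by positivity
              nlinarith
    · intro hle
      have k1 := (hloc Q hQ x hx (by linarith)).1
      rwa [hFx, cutoff_eq_one hτ0 hle, one_mul]

/-- Summation over a Whitney covering of a pointwise bound on each cube. -/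
lemma IsWhitneyCovering.lintegral_rpow_le (hW : IsWhitneyCovering Ω θ 𝒬) (h : IsProperDomain Ω α)
    (hn : 1 ≤ n) (hθ : 0 < θ) {p ε τ A S : ℝ} (hp : 1 < p) (hτ : (1 + θ) * τ < ε) (hA : 0 < A)
    {c : (Fin n → ℝ) → ℝ}
    (hc : ∀ Q ∈ 𝒬, ∀ w ∈ Metric.ball Q.center Q.radius, c w = c Q.center)
    {M : Cube n → ℝ} (hM0 : ∀ Q, 0 ≤ M Q)
    (hS : ∀ s : Finset (Cube n), ↑s ⊆ 𝒬 → ∑ Q ∈ s, M Q ^ p * (2 * Q.radius) ^ (n - p) ≤ S)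
    {H : (Fin n → ℝ) → ℝ≥0∞} (hH : ∀ Q ∈ 𝒬, ∀ x ∈ Q.toSet,
      H x ≤ ENNReal.ofReal (A * (M Q / (2 * Q.radius) + |c Q.center|)) ∧
      (τ < Metric.infDist x (frontier Ω) → H x = 0)) :
    ∫⁻ x in Ω, H x ^ p ≤ ENNReal.ofReal (A ^ p * 2 ^ (p - 1)) *
      (ENNReal.ofReal S + ∫⁻ x in boundaryNhd Ω ε, ‖c x‖ₑ ^ p) := by
  have hp0 : 0 < p := by linarith
  rw [boundaryNhd_eq_inter, ← setLIntegral_indicator (isOpen_infDist_lt _ ε).measurableSet,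
    hW.setLIntegral_eq_tsum, hW.setLIntegral_eq_tsum]
  have hQ : ∀ Q : 𝒬, ∫⁻ x in Metric.ball Q.1.center Q.1.radius, H x ^ p ≤
      ENNReal.ofReal (A ^ p * 2 ^ (p - 1)) *
      (ENNReal.ofReal (M Q ^ p * (2 * Q.1.radius) ^ (n - p)) +
        ∫⁻ x in Metric.ball Q.1.center Q.1.radius,
        {x | Metric.infDist x (frontier Ω) < ε}.indicator (fun x => ‖c x‖ₑ ^ p) x) := by
    intro Q
    have hr := Q.1.radius_pos
    have hMQ := hM0 Q
    set r := Q.1.radius with hrdef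
    by_cases hmeet : ∃ x ∈ Metric.ball Q.1.center r, Metric.infDist x (frontier Ω) ≤ τ
    swap
    · push Not at hmeet
      refine le_trans (le_of_eq ?_) zero_le
      rw [setLIntegral_congr_fun measurableSet_ball (g := fun _ => 0)]
      · simp
      · intro x hx
        simp only
        rw [(hH Q Q.2 x (Q.1.ball_subset_toSet hx)).2 (hmeet x hx), ENNReal.zero_rpow_of_pos hp0]
    obtain ⟨x₀, hx₀, hx₀τ⟩ := hmeet
    -- A cube meeting the region where `H` may be nonzero lies entirely in the `ε`-neighbourhood,
    -- since `(1 + θ) * τ < ε`. The constant value of `c` on it is thus paid for by the full volume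
    -- of the cube in the integral of condition 2.
    have hsub : ∀ x ∈ Metric.ball Q.1.center r, Metric.infDist x (frontier Ω) < ε := by
      intro x hx
      refine (hW.infDist_le_mul_infDist h hn hθ Q.2 (Q.1.ball_subset_toSet hx₀)
        (Q.1.ball_subset_toSet hx)).trans_lt (lt_of_le_of_lt ?_ hτ)
      gcongr
    have e1 : ∫⁻ x in Metric.ball Q.1.center r,
        {x | Metric.infDist x (frontier Ω) < ε}.indicator (fun x => ‖c x‖ₑ ^ p) x =
        ‖c Q.1.center‖ₑ ^ p * ENNReal.ofReal ((2 * r) ^ n) := by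
      rw [← volume_ball, ← setLIntegral_const]
      refine setLIntegral_congr_fun measurableSet_ball fun x hx => ?_
      have hx' : x ∈ {x | Metric.infDist x (frontier Ω) < ε} := hsub x hx
      rw [Set.indicator_of_mem hx', hc Q Q.2 x hx]
    have e2 : ∀ x ∈ Metric.ball Q.1.center r, H x ^ p ≤
        ENNReal.ofReal (A ^ p * 2 ^ (p - 1)) *
          (ENNReal.ofReal (M Q / (2 * r)) ^ p + ‖c Q.1.center‖ₑ ^ p) := by
      intro x hx
      have k := (hH Q Q.2 x (Q.1.ball_subset_toSet hx)).1
      rw [ENNReal.ofReal_mul hA.le, ENNReal.ofReal_add (by positivity) (abs_nonneg _),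
        ← Real.norm_eq_abs, ofReal_norm] at k
      refine (ENNReal.rpow_le_rpow k hp0.le).trans ?_
      rw [ENNReal.mul_rpow_of_nonneg _ _ hp0.le, ENNReal.ofReal_mul (by positivity), mul_assoc,
        ENNReal.ofReal_rpow_of_pos hA]
      gcongr
      exact add_rpow_le_ofReal _ _ hp.le
    refine (setLIntegral_mono' measurableSet_ball e2).trans ?_
    rw [setLIntegral_const, volume_ball, ← hrdef, e1, mul_assoc, add_mul,
      ENNReal.ofReal_rpow_of_nonneg (by positivity) hp0.le, ← ENNReal.ofReal_mul (by positivity)]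
    refine le_of_eq ?_
    congr 3
    rw [Real.div_rpow hMQ (by positivity), Real.rpow_sub (by positivity), Real.rpow_natCast]
    ring
  refine (ENNReal.tsum_le_tsum hQ).trans ?_
  rw [ENNReal.tsum_mul_left, ENNReal.tsum_add]
  gcongr
  rw [ENNReal.tsum_eq_iSup_sum]
  refine iSup_le fun s => ?_
  have key := hS (s.map (Function.Embedding.subtype _)) (by simp)
  rw [Finset.sum_map] at key
  rw [← ENNReal.ofReal_sum_of_nonneg]
  · exact ENNReal.ofReal_le_ofReal key
  · intro Q _
    have := hM0 Q
    have := Q.1.radius_pos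
    positivity

end SobolevTrace

/-! ### The trace of the extension and sufficiency. -/

namespace SobolevTrace

variable {n : ℕ} {Ω : Set (Fin n → ℝ)} {α θ : ℝ} {𝒬 : Set (Cube n)}

/-- The cube and the segment from `a` to its centre both lie in the cone with vertex `a` over the
enlarged cube, with margin equal to the distance of the cube from the boundary. The cone estimate at
level `1` gives a bound of order `d ^ α`, uniform along the segment. -/
lemma IsWhitneyCovering.subhypDist_le (hW : IsWhitneyCovering Ω θ 𝒬) (h : IsProperDomain Ω α)
    (hn : 1 ≤ n) (hθ : 0 < θ) {Q : Cube n} (hQ : Q ∈ 𝒬) {a : Fin n → ℝ}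
    (ha : IsNearestBoundaryPoint Ω Q a) {y : Fin n → ℝ} (hy : y ∈ Q.toSet) {s : ℝ}
    (hs : s ∈ Set.Ioc (0 : ℝ) 1) :
    subhypDist Ω α y (AffineMap.lineMap a Q.center s) ≤
      2 * (Real.sqrt n / α * ((θ + 2) * Metric.infDist y (frontier Ω) ^ α)) := by
  have hα := h.pos
  have hr := Q.radius_pos
  have hrS := hW.two_mul_radius_le hn hθ hQ
  have hSd := setDist_le_infDist hy h.frontier_nonempty
  have hdc := ha.dist_center h.isOpen (hW.1 Q hQ)
  have hst := ha.isStarBall h.isOpen (hW.1 Q hQ)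
  have hyc := Metric.mem_closedBall.1 hy
  set S := setDist Q.toSet (frontier Ω) with hS
  have hS0 : 0 < S := by
    by_contra! hle
    nlinarith
  have key := h.subhypDist_cone_le (y := y) (z := Q.center) (s := 1) (t := s)
    (L := 2 * (Q.radius + S)) hst hS0 (by linarith) (by rw [dist_self]; linarith) (by linarith)
    (by linarith) ⟨one_pos, le_rfl⟩ hs
  rw [AffineMap.lineMap_apply_one, max_eq_left hs.2, Real.one_rpow, mul_one] at key
  refine key.trans ?_
  have h1 : 2 * (Q.radius + S) * S ^ (α - 1) ≤
      (θ + 2) * Metric.infDist y (frontier Ω) ^ α := by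
    have e : S ^ α = S * S ^ (α - 1) := by
      rw [← Real.rpow_one_add' hS0.le (by linarith)]; congr 1; ring
    calc 2 * (Q.radius + S) * S ^ (α - 1) ≤ ((θ + 2) * S) * S ^ (α - 1) := by
          refine mul_le_mul_of_nonneg_right ?_ (Real.rpow_nonneg hS0.le _)
          linarith
      _ = (θ + 2) * S ^ α := by rw [e]; ring
      _ ≤ _ := by gcongr
  gcongr

/-- The projection of a cube containing `y i` is within `O(d(y i) ^ α)` of `y i`, and `y i` is close
to `ω` by the Cauchy property. The projections therefore converge to `ω` in the extended metric, and
continuity of `f` applies. -/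
lemma IsWhitneyCovering.tendsto_projection (hW : IsWhitneyCovering Ω θ 𝒬) (h : IsProperDomain Ω α)
    (hn : 1 ≤ n) (hθ : 0 < θ) {T : (Fin n → ℝ) → alphaBoundary Ω α}
    (hT : IsBoundaryProjection Ω α 𝒬 T) {f : alphaBoundary Ω α → ℝ}
    (hf : ContinuousForClosureDist Ω α f) (ω : alphaBoundary Ω α) {y : ℕ → Fin n → ℝ}
    (hy : y ∈ (ω : Set (ℕ → Fin n → ℝ))) {Q : ℕ → Cube n} (hQ : ∀ i, Q i ∈ 𝒬)
    (hyQ : ∀ i, y i ∈ (Q i).toSet) :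
    Tendsto (fun i => f (T (Q i).center)) atTop (𝓝 (f ω)) := by
  have hα := h.pos
  rw [Metric.tendsto_atTop]
  intro τ hτ
  obtain ⟨δ, hδ, hfδ⟩ := hf ω τ hτ
  have hc := mem_cauchySeqs ω.2.1 hy
  have h1 : ∀ᶠ ij : ℕ × ℕ in atTop, deltaDist Ω α (y ij.1) (y ij.2) < δ / 4 :=
    hc.2.eventually_lt_const (by positivity)
  obtain ⟨N₁, hN₁⟩ := eventually_atTop_prod_self'.1 h1
  have h2 : Tendsto (fun i => 2 * (Real.sqrt n / α * ((θ + 2) *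
      Metric.infDist (y i) (frontier Ω) ^ α))) atTop (𝓝 0) := by
    have := (h.tendsto_infDist_of_mem ω.2 hy).rpow_const (p := α) (Or.inr hα.le)
    rw [Real.zero_rpow hα.ne'] at this
    simpa using ((this.const_mul (θ + 2)).const_mul (Real.sqrt n / α)).const_mul 2
  obtain ⟨N₂, hN₂⟩ := eventually_atTop.1 (h2.eventually_lt_const (by positivity : 0 < δ / 4))
  refine ⟨max N₁ N₂, fun i hi => ?_⟩
  rw [Real.dist_eq]
  refine hfδ _ ?_
  obtain ⟨a, ha, hTa⟩ := hT.exists_nearest (hQ i)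
  have hr := (Q i).radius_pos
  have hz := h.cone_mem_visibleElement (hW.1 _ (hQ i)) ha (z := (Q i).center) (by
    rw [dist_self]
    linarith [setDist_nonneg (Q i).toSet (frontier Ω)])
  rw [← hTa] at hz
  have hlim := h.tendsto_closureDist ω.2.1 (T (Q i).center).2.1 hy hz
  have hle : closureDist Ω α ω (T (Q i).center) ≤ δ / 4 + δ / 4 := by
    refine le_of_tendsto hlim ?_
    filter_upwards [eventually_ge_atTop N₁] with j hj
    have hzΩ := (mem_cauchySeqs (T (Q i).center).2.1 hz).1 j
    refine (h.subhypDist_triangle (hc.1 j) (hc.1 i) hzΩ).trans (add_le_add ?_ ?_)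
    · exact (subhypDist_le_deltaDist _ _).trans (hN₁ j hj i (le_of_max_le_left hi)).le
    · exact (hW.subhypDist_le h hn hθ (hQ i) ha (hyQ i) (one_div_succ_mem_Ioc j)).trans
        (hN₂ i (le_of_max_le_right hi)).le
  linarith

/-- The bound on each single term of the oscillation sum gives `M Q = O(r ^ ((p - n) / p))`, which
tends to zero at the boundary since `p > n`. So `F` is asymptotic to the projected values, whose
limit is given by `tendsto_projection`. -/
lemma IsWhitneyCovering.isTrace (hW : IsWhitneyCovering Ω θ 𝒬) (h : IsProperDomain Ω α)
    (hn : 1 ≤ n) (hθ : 0 < θ) {p : ℝ} (hp : (n : ℝ) < p) {T : (Fin n → ℝ) → alphaBoundary Ω α}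
    (hT : IsBoundaryProjection Ω α 𝒬 T) {f : alphaBoundary Ω α → ℝ}
    (hf : ContinuousForClosureDist Ω α f) {M : Cube n → ℝ} (hM0 : ∀ Q, 0 ≤ M Q) {S : ℝ}
    (hM : ∀ Q ∈ 𝒬, M Q ^ p * (2 * Q.radius) ^ (n - p) ≤ S) {F : (Fin n → ℝ) → ℝ} {τ : ℝ}
    (hτ : 0 < τ) (hF : ∀ Q ∈ 𝒬, ∀ x ∈ Q.toSet, Metric.infDist x (frontier Ω) ≤ τ →
      |F x - f (T Q.center)| ≤ M Q) : IsTrace Ω α F f := by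
  intro ω y hy
  have hp0 : 0 < p := lt_of_le_of_lt (Nat.cast_nonneg n) hp
  have hyΩ := (mem_cauchySeqs ω.2.1 hy).1
  choose Q hQ hyQ using fun i => Set.mem_iUnion₂.1 (hW.2.1 (hyΩ i))
  have hd := h.tendsto_infDist_of_mem ω.2 hy
  have h1 := hW.tendsto_projection h hn hθ hT hf ω hy hQ hyQ
  have hS0 : 0 ≤ S := by
    refine le_trans ?_ (hM _ (hQ 0))
    have := hM0 (Q 0)
    have := (Q 0).radius_pos
    positivity
  have hbd : ∀ i, M (Q i) ≤ (S * (θ * Metric.infDist (y i) (frontier Ω)) ^ (p - n)) ^ (1 / p) := by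
    intro i
    have hr : 0 < 2 * (Q i).radius := by linarith [(Q i).radius_pos]
    have k1 := hM _ (hQ i)
    rw [show (n : ℝ) - p = -(p - n) by ring, Real.rpow_neg hr.le, ← div_eq_mul_inv,
      div_le_iff₀ (Real.rpow_pos_of_pos hr _)] at k1
    have k2 := hW.two_mul_radius_le_infDist h hn hθ (hQ i) (hyQ i)
    have k3 : M (Q i) ^ p ≤ S * (θ * Metric.infDist (y i) (frontier Ω)) ^ (p - n) :=
      k1.trans (mul_le_mul_of_nonneg_left (Real.rpow_le_rpow hr.le k2 (by linarith)) hS0)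
    have k4 := Real.rpow_le_rpow (Real.rpow_nonneg (hM0 _) _) k3 (by positivity : 0 ≤ 1 / p)
    rwa [← Real.rpow_mul (hM0 _), mul_one_div_cancel hp0.ne', Real.rpow_one] at k4
  have h2 : Tendsto (fun i => M (Q i)) atTop (𝓝 0) := by
    refine squeeze_zero (fun i => hM0 _) hbd ?_
    have k1 := (hd.const_mul θ).rpow_const (p := p - n) (Or.inr (by linarith))
    rw [mul_zero, Real.zero_rpow (by linarith)] at k1
    have k2 := (k1.const_mul S).rpow_const (p := 1 / p) (Or.inr (by positivity))
    rwa [mul_zero, Real.zero_rpow (by positivity)] at k2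
  have h3 : Tendsto (fun i => F (y i) - f (T (Q i).center)) atTop (𝓝 0) := by
    rw [tendsto_zero_iff_abs_tendsto_zero]
    refine squeeze_zero' (Eventually.of_forall fun i => abs_nonneg _) ?_ h2
    filter_upwards [hd.eventually_lt_const hτ] with i hi
    exact hF _ (hQ i) _ (hyQ i) hi.le
  simpa using h3.add h1

lemma lintegral_rpow_enorm_eq {X E : Type*} [MeasurableSpace X] [NormedAddCommGroup E]
    (μ : Measure X) {p : ℝ} (hp : 0 < p) (f : X → E) :
    ∫⁻ x, ‖f x‖ₑ ^ p ∂μ = eLpNorm f (ENNReal.ofReal p) μ ^ p := by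
  rw [eLpNorm_eq_lintegral_rpow_enorm_toReal (by simpa using hp) ENNReal.ofReal_ne_top,
    ENNReal.toReal_ofReal hp.le, ← ENNReal.rpow_mul, one_div_mul_cancel hp.ne', ENNReal.rpow_one]

lemma memLp_ofReal_of_lintegral_ne_top {X E : Type*} [MeasurableSpace X] [NormedAddCommGroup E]
    {μ : Measure X} {p : ℝ} (hp : 0 < p) {f : X → E} (hf : AEStronglyMeasurable f μ)
    (h : ∫⁻ x, ‖f x‖ₑ ^ p ∂μ ≠ ∞) : MemLp f (ENNReal.ofReal p) μ := by
  refine ⟨hf, lt_top_iff_ne_top.2 fun e => h ?_⟩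
  rw [lintegral_rpow_enorm_eq μ hp, e, ENNReal.top_rpow_of_pos hp]

/-- The Whitney extension of `f ∘ T`. The oscillation bound and the integral of condition 2 are
summed over the covering, once for the function and once for its pointwise gradient. -/
theorem exists_extension (n : ℕ) {p : ℝ} (hn : 1 ≤ n) (hp : (n : ℝ) < p) {ε θ η : ℝ}
    (hε : 0 < ε) (hθ : 1 < θ) (hη : 22 * θ ^ 2 ≤ η) : ∃ C : ℝ, 0 < C ∧
    ∀ (Ω : Set (Fin n → ℝ)), IsProperDomain Ω (sobolevExponent n p) →
    ∀ 𝒬 : Set (Cube n), IsWhitneyCovering Ω θ 𝒬 →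
    ∀ T : (Fin n → ℝ) → SobolevBoundary Ω p,
      IsBoundaryProjection Ω (sobolevExponent n p) 𝒬 T →
    ∀ f : SobolevBoundary Ω p → ℝ, ContinuousForClosureDist Ω (sobolevExponent n p) f →
    ∫⁻ x in boundaryNhd Ω ε, ‖f (T x)‖ₑ ^ p ≠ ∞ →
    ∀ lam : ℝ, 0 < lam → VariationalBound Ω p ε η f lam →
    ∃ F G, IsSobolev Ω p F G ∧ IsTrace Ω (sobolevExponent n p) F f ∧
      ∫⁻ x in Ω, ‖F x‖ₑ ^ p ≤
        ENNReal.ofReal C * (ENNReal.ofReal lam + ∫⁻ x in boundaryNhd Ω ε, ‖f (T x)‖ₑ ^ p) ∧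
      ∫⁻ x in Ω, ‖G x‖ₑ ^ p ≤
        ENNReal.ofReal C * (ENNReal.ofReal lam + ∫⁻ x in boundaryNhd Ω ε, ‖f (T x)‖ₑ ^ p) := by
  have hn1 : (1 : ℝ) ≤ n := by exact_mod_cast hn
  have hp1 : 1 < p := by linarith
  have hp0 : 0 < p := by linarith
  have hθ0 : 0 < θ := by linarith
  obtain ⟨A, hA0, hA⟩ := exists_whitneyExtension_bounds n hn hε hθ
  refine ⟨A ^ p * 2 ^ (p - 1) * 2 ^ p, by positivity, ?_⟩
  intro Ω h 𝒬 hW T hT f hf hfin lam hlam hv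
  obtain ⟨M, hM0, hM, hsum⟩ := hv.exists_oscillation hW h hn hp hθ hη hT
  set c : (Fin n → ℝ) → ℝ := fun x => f (T x) with hc
  have hcQ : ∀ Q ∈ 𝒬, ∀ w ∈ Metric.ball Q.center Q.radius, c w = c Q.center :=
    fun Q hQ w hw => by simp only [hc, hT.eq_center hQ hw]
  set τ : ℝ := ε / (2 * (1 + θ)) with hτ
  have hτ0 : 0 < τ := by positivity
  have hτε : (1 + θ) * τ < ε := by
    have : (1 + θ) * τ = ε / 2 := by rw [hτ]; field_simp
    linarith
  set F := whitneyExtension Ω θ τ c with hF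
  set G : (Fin n → ℝ) → Fin n → ℝ := fun x i => fderiv ℝ F x (Pi.single i 1) with hG
  obtain ⟨hlip, hbd⟩ := hA Ω _ h 𝒬 hW c hcQ M hM0 hM τ F hτ hF
  have hGle : ∀ x, ‖G x‖ ≤ ‖fderiv ℝ F x‖ := by
    intro x
    refine (pi_norm_le_iff_of_nonneg (norm_nonneg _)).2 fun i => ?_
    refine ((fderiv ℝ F x).le_opNorm _).trans (le_of_eq ?_)
    rw [Pi.norm_single, norm_one, mul_one]
  set I := ∫⁻ x in boundaryNhd Ω ε, ‖c x‖ₑ ^ p with hI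
  have hconst : ENNReal.ofReal (A ^ p * 2 ^ (p - 1)) * (ENNReal.ofReal (2 ^ p * lam) + I) ≤
      ENNReal.ofReal (A ^ p * 2 ^ (p - 1) * 2 ^ p) * (ENNReal.ofReal lam + I) := by
    rw [ENNReal.ofReal_mul (by positivity : (0 : ℝ) ≤ A ^ p * 2 ^ (p - 1)), mul_assoc,
      mul_add (ENNReal.ofReal (2 ^ p)), ENNReal.ofReal_mul (by positivity : (0 : ℝ) ≤ 2 ^ p)]
    gcongr
    refine le_mul_of_one_le_left zero_le ?_
    rw [ENNReal.one_le_ofReal]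
    exact Real.one_le_rpow (by norm_num) hp0.le
  have hFi : ∫⁻ x in Ω, ‖F x‖ₑ ^ p ≤
      ENNReal.ofReal (A ^ p * 2 ^ (p - 1) * 2 ^ p) * (ENNReal.ofReal lam + I) := by
    refine (hW.lintegral_rpow_le h hn hθ0 hp1 hτε hA0 hcQ hM0 hsum fun Q hQ x hx => ?_).trans hconst
    obtain ⟨b1, -, b3, -⟩ := hbd Q hQ x hx
    refine ⟨?_, fun hlt => by rw [(b3 hlt).1, enorm_zero]⟩
    rw [← ofReal_norm, Real.norm_eq_abs]
    exact ENNReal.ofReal_le_ofReal b1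
  have hGi : ∫⁻ x in Ω, ‖G x‖ₑ ^ p ≤
      ENNReal.ofReal (A ^ p * 2 ^ (p - 1) * 2 ^ p) * (ENNReal.ofReal lam + I) := by
    refine (hW.lintegral_rpow_le h hn hθ0 hp1 hτε hA0 hcQ hM0 hsum fun Q hQ x hx => ?_).trans hconst
    obtain ⟨-, b2, b3, -⟩ := hbd Q hQ x hx
    refine ⟨?_, fun hlt => ?_⟩
    · rw [← ofReal_norm]
      exact ENNReal.ofReal_le_ofReal ((hGle x).trans b2)
    · have := hGle x
      rw [(b3 hlt).2, norm_zero] at this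
      rw [norm_le_zero_iff.1 this, enorm_zero]
  have hRfin : ENNReal.ofReal (A ^ p * 2 ^ (p - 1) * 2 ^ p) * (ENNReal.ofReal lam + I) ≠ ∞ :=
    ENNReal.mul_ne_top ENNReal.ofReal_ne_top (ENNReal.add_ne_top.2 ⟨ENNReal.ofReal_ne_top, hfin⟩)
  have hGm : Measurable G := measurable_pi_iff.2 fun i =>
    measurable_fderiv_apply_const ℝ F (Pi.single i 1)
  refine ⟨F, G, ⟨hlip.continuousOn, ?_, ?_, isWeakGradient_of_locallyLipschitzOn h.isOpen hlip⟩,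
    ?_, hFi, hGi⟩
  · exact memLp_ofReal_of_lintegral_ne_top hp0
      (hlip.continuousOn.aestronglyMeasurable h.isOpen.measurableSet) (ne_top_of_le_ne_top hRfin hFi)
  · exact memLp_ofReal_of_lintegral_ne_top hp0 hGm.aestronglyMeasurable
      (ne_top_of_le_ne_top hRfin hGi)
  -- Half of `τ`, because the cutoff equals one only up to there.
  · refine hW.isTrace h hn hθ0 hp hT hf hM0 (S := 2 ^ p * lam) (τ := τ / 2) ?_ (by positivity) ?_
    · intro Q hQ
      simpa using hsum {Q} (by simpa using hQ)
    · intro Q hQ x hx hle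
      exact (hbd Q hQ x hx).2.2.2 hle

end SobolevTrace

/-! ### Assembly. -/

namespace SobolevTrace

variable {n : ℕ} {Ω : Set (Fin n → ℝ)} {θ : ℝ} {𝒬 : Set (Cube n)}

/-- The covering itself excludes an empty frontier: `setDist` would then be the infimum of the empty
set, `0` by convention, against the positive lower bound on the distance of a cube from the
boundary. -/
lemma IsWhitneyCovering.isProperDomain (hW : IsWhitneyCovering Ω θ 𝒬) (hΩ : IsOpen Ω)
    (hc : IsConnected Ω) (hn : 1 ≤ n) (hθ : 0 < θ) {p : ℝ} (hp : (n : ℝ) < p) :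
    IsProperDomain Ω (sobolevExponent n p) := by
  have hn1 : (1 : ℝ) ≤ n := by exact_mod_cast hn
  refine ⟨hΩ, hc, ?_, div_pos (by linarith) (by linarith), ?_⟩
  · obtain ⟨x, hx⟩ := hc.nonempty
    obtain ⟨Q, hQ, -⟩ := Set.mem_iUnion₂.1 (hW.2.1 hx)
    by_contra hne
    rw [Set.not_nonempty_iff_eq_empty] at hne
    have h1 := hW.two_mul_radius_le hn hθ hQ
    rw [hne, setDist, Set.image2_empty_right, Real.sInf_empty, mul_zero] at h1
    linarith [Q.radius_pos]
  · unfold sobolevExponent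
    rw [div_le_one (by linarith)]
    linarith

lemma IsWhitneyCovering.exists_isBoundaryProjection {α : ℝ} (hW : IsWhitneyCovering Ω θ 𝒬)
    (h : IsProperDomain Ω α) :
    ∃ T : (Fin n → ℝ) → alphaBoundary Ω α, IsBoundaryProjection Ω α 𝒬 T := by
  classical
  choose a ha using fun Q : Cube n => exists_isNearestBoundaryPoint h.frontier_nonempty Q
  obtain ⟨x₀, hx₀⟩ := h.isConnected.nonempty
  obtain ⟨Q₀, hQ₀, -⟩ := Set.mem_iUnion₂.1 (hW.2.1 hx₀)
  set ω : 𝒬 → alphaBoundary Ω α := fun Q =>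
    ⟨visibleElement Ω α Q (a Q), h.visibleElement_mem (hW.1 Q Q.2) (ha Q)⟩ with hω
  -- Off the interiors the value is arbitrary, but the boundary must be nonempty to supply one; some
  -- covering cube `Q₀` provides it.
  refine ⟨fun x => if hx : ∃ Q : 𝒬, x ∈ interior Q.1.toSet then ω hx.choose else ω ⟨Q₀, hQ₀⟩,
    fun Q hQ => ⟨a Q, ha Q, fun x hx => ?_⟩⟩
  have hex : ∃ Q : 𝒬, x ∈ interior Q.1.toSet := ⟨⟨Q, hQ⟩, hx⟩
  have heq : (hex.choose : Cube n) = Q := by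
    by_contra hne
    exact Set.disjoint_left.1 (hW.2.2.1 hex.choose.2 hQ hne) hex.choose_spec hx
  simp only [dif_pos hex, hω]
  rw [heq]

lemma le_mul_rpow_of_rpow_le {a b : ℝ≥0∞} {C p : ℝ} (hC : 0 < C) (hp : 0 < p)
    (h : a ^ p ≤ ENNReal.ofReal C * b) :
    a ≤ ENNReal.ofReal (C ^ (1 / p)) * b ^ (1 / p) := by
  have := ENNReal.rpow_le_rpow h (by positivity : 0 ≤ 1 / p)
  rwa [← ENNReal.rpow_mul, mul_one_div_cancel hp.ne', ENNReal.rpow_one,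
    ENNReal.mul_rpow_of_nonneg _ _ (by positivity), ENNReal.ofReal_rpow_of_pos hC] at this

end SobolevTrace

theorem theorem5p6 (n : ℕ) (hn : 1 ≤ n) (p : ℝ) (hp : (n : ℝ) < p) (ε θ η : ℝ)
    (hε : 0 < ε) (hθ : 1 < θ) (hη : 22 * θ ^ 2 ≤ η) :
    ∃ C : ℝ, 1 ≤ C ∧ ∀ (Ω : Set (Fin n → ℝ)), IsOpen Ω → IsConnected Ω →
      ∀ 𝒬 : Set (SobolevTrace.Cube n), SobolevTrace.IsWhitneyCovering Ω θ 𝒬 →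
      -- each `ω_{Q,α}` is an element of the boundary, and a mapping `T_𝒬` exists
      (∀ Q ∈ 𝒬, ∀ a, SobolevTrace.IsNearestBoundaryPoint Ω Q a →
        SobolevTrace.visibleElement Ω (SobolevTrace.sobolevExponent n p) Q a ∈
          SobolevTrace.alphaBoundary Ω (SobolevTrace.sobolevExponent n p)) ∧
      (∃ T : (Fin n → ℝ) → SobolevTrace.SobolevBoundary Ω p,
        SobolevTrace.IsBoundaryProjection Ω (SobolevTrace.sobolevExponent n p) 𝒬 T) ∧
      -- and for every such mapping the criterion holds
      ∀ T : (Fin n → ℝ) → SobolevTrace.SobolevBoundary Ω p,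
        SobolevTrace.IsBoundaryProjection Ω (SobolevTrace.sobolevExponent n p) 𝒬 T →
      ∀ f : SobolevTrace.SobolevBoundary Ω p → ℝ,
        (SobolevTrace.MemTraceSpace Ω p f ↔
          SobolevTrace.ContinuousForClosureDist Ω (SobolevTrace.sobolevExponent n p) f ∧
          MemLp (fun x => f (T x)) (ENNReal.ofReal p)
            (volume.restrict (SobolevTrace.boundaryNhd Ω ε)) ∧
          ∃ lam : ℝ, 0 < lam ∧ SobolevTrace.VariationalBound Ω p ε η f lam) ∧
        (SobolevTrace.MemTraceSpace Ω p f →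
          SobolevTrace.traceNorm Ω p f ≤ ENNReal.ofReal C *
            (eLpNorm (fun x => f (T x)) (ENNReal.ofReal p)
                (volume.restrict (SobolevTrace.boundaryNhd Ω ε)) +
              SobolevTrace.variationalNorm Ω p ε η f) ∧
          eLpNorm (fun x => f (T x)) (ENNReal.ofReal p)
                (volume.restrict (SobolevTrace.boundaryNhd Ω ε)) +
              SobolevTrace.variationalNorm Ω p ε η f ≤
            ENNReal.ofReal C * SobolevTrace.traceNorm Ω p f) := by
  have hn1 : (1 : ℝ) ≤ n := by exact_mod_cast hn
  have hp1 : 1 < p := by linarith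
  have hp0 : 0 < p := by linarith
  have hθ0 : 0 < θ := by linarith
  have hη0 : 0 < η := by nlinarith
  obtain ⟨C₁, hC₁, hproj⟩ := SobolevTrace.exists_projection_estimate n hn hp hε hθ
  obtain ⟨C₂, hC₂, hvar⟩ := SobolevTrace.exists_variational_estimate n hn hp hη0
  obtain ⟨C₃, hC₃, hext⟩ := SobolevTrace.exists_extension n hn hp hε hθ hη
  set B₁ : ℝ := C₁ ^ (1 / p) with hB₁
  set B₂ : ℝ := C₂ ^ (1 / p) with hB₂
  set B₃ : ℝ := C₃ ^ (1 / p) with hB₃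
  have hB₁0 : 0 < B₁ := by positivity
  have hB₂0 : 0 < B₂ := by positivity
  have hB₃0 : 0 < B₃ := by positivity
  -- `B₁ + B₂` serves the bound by the trace norm and `2 * B₃` the bound of the trace norm, one `B₃`
  -- each for the function and its gradient. The `1` gives `1 ≤ C`.
  set C : ℝ := 1 + (B₁ + B₂) + 2 * B₃ with hC
  have hC1 : 1 ≤ C := by rw [hC]; linarith
  have hCne : ENNReal.ofReal C ≠ 0 := by
    rw [Ne, ENNReal.ofReal_eq_zero, not_le]; linarith
  refine ⟨C, hC1, ?_⟩
  intro Ω hΩ hΩc 𝒬 hW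
  have h := hW.isProperDomain hΩ hΩc hn hθ0 hp
  have hα : SobolevTrace.sobolevExponent n p * (p - 1) = p - n := by
    unfold SobolevTrace.sobolevExponent
    exact div_mul_cancel₀ _ (by linarith)
  refine ⟨fun Q hQ a ha => h.visibleElement_mem (hW.1 Q hQ) ha,
    hW.exists_isBoundaryProjection h, ?_⟩
  intro T hT f
  set c : (Fin n → ℝ) → ℝ := fun x => f (T x) with hc
  set X := eLpNorm c (ENNReal.ofReal p) (volume.restrict (SobolevTrace.boundaryNhd Ω ε)) with hX
  have hcm : AEStronglyMeasurable c (volume.restrict (SobolevTrace.boundaryNhd Ω ε)) :=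
    (hW.aestronglyMeasurable fun Q hQ w hw => by simp only [hc, hT.eq_center hQ hw]).mono_measure
      (Measure.restrict_mono (fun x hx => hx.1) le_rfl)
  have hnec₁ : ∀ F G, SobolevTrace.IsSobolev Ω p F G →
      SobolevTrace.IsTrace Ω (SobolevTrace.sobolevExponent n p) F f →
      X ≤ ENNReal.ofReal B₁ * (eLpNorm F (ENNReal.ofReal p) (volume.restrict Ω) +
        eLpNorm G (ENNReal.ofReal p) (volume.restrict Ω)) := by
    intro F G hS hf
    have key := hproj Ω _ h 𝒬 hW T hT F G hS f hf
    rw [SobolevTrace.lintegral_rpow_enorm_eq _ hp0, SobolevTrace.lintegral_rpow_enorm_eq _ hp0,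
      SobolevTrace.lintegral_rpow_enorm_eq _ hp0] at key
    refine (SobolevTrace.le_mul_rpow_of_rpow_le hC₁ hp0 key).trans ?_
    gcongr
    exact ENNReal.rpow_add_rpow_le_add _ _ hp1.le
  have hnec₂ : ∀ F G, SobolevTrace.IsSobolev Ω p F G →
      SobolevTrace.IsTrace Ω (SobolevTrace.sobolevExponent n p) F f → ∀ δ : ℝ, 0 < δ →
      ∃ lam, (0 < lam ∧ SobolevTrace.VariationalBound Ω p ε η f lam) ∧
        ENNReal.ofReal (lam ^ (1 / p)) ≤ ENNReal.ofReal B₂ *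
          eLpNorm G (ENNReal.ofReal p) (volume.restrict Ω) + ENNReal.ofReal δ := by
    intro F G hS hf δ hδ
    have hGfin := hS.2.2.1.2.ne
    set g := (eLpNorm G (ENNReal.ofReal p) (volume.restrict Ω)).toReal with hg
    have hg0 : 0 ≤ g := ENNReal.toReal_nonneg
    have hgG : eLpNorm G (ENNReal.ofReal p) (volume.restrict Ω) = ENNReal.ofReal g :=
      (ENNReal.ofReal_toReal hGfin).symm
    -- The infimum runs over strictly positive constants, and the gradient may vanish; the
    -- arbitrarily small `δ` keeps the constant admissible.
    have hs0 : 0 < B₂ * g + δ := by positivity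
    refine ⟨(B₂ * g + δ) ^ p, ⟨by positivity, ?_⟩, ?_⟩
    · refine hvar Ω h F G hS f hf ε _ ?_ (by positivity)
      rw [SobolevTrace.lintegral_rpow_enorm_eq _ hp0, hgG,
        ENNReal.ofReal_rpow_of_nonneg hg0 hp0.le, ← ENNReal.ofReal_mul hC₂.le]
      refine ENNReal.ofReal_le_ofReal ?_
      have : C₂ * g ^ p = (B₂ * g) ^ p := by
        rw [Real.mul_rpow hB₂0.le hg0, hB₂, ← Real.rpow_mul hC₂.le, one_div_mul_cancel hp0.ne',
          Real.rpow_one]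
      rw [this]
      exact Real.rpow_le_rpow (by positivity) (by linarith) hp0.le
    · rw [← Real.rpow_mul hs0.le, mul_one_div_cancel hp0.ne', Real.rpow_one, hgG,
        ← ENNReal.ofReal_mul hB₂0.le, ← ENNReal.ofReal_add (by positivity) hδ.le]
  have hsuf : SobolevTrace.ContinuousForClosureDist Ω (SobolevTrace.sobolevExponent n p) f →
      X ≠ ∞ → ∀ lam, 0 < lam → SobolevTrace.VariationalBound Ω p ε η f lam →
      ∃ F G, (SobolevTrace.IsSobolev Ω p F G ∧
        SobolevTrace.IsTrace Ω (SobolevTrace.sobolevExponent n p) F f) ∧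
        eLpNorm F (ENNReal.ofReal p) (volume.restrict Ω) +
          eLpNorm G (ENNReal.ofReal p) (volume.restrict Ω) ≤
          ENNReal.ofReal (2 * B₃) * (X + ENNReal.ofReal (lam ^ (1 / p))) := by
    intro hf hXfin lam hlam hv
    have hfin : ∫⁻ x in SobolevTrace.boundaryNhd Ω ε, ‖f (T x)‖ₑ ^ p ≠ ∞ := by
      rw [SobolevTrace.lintegral_rpow_enorm_eq _ hp0]
      exact ENNReal.rpow_ne_top_of_nonneg hp0.le hXfin
    obtain ⟨F, G, hS, htr, hFi, hGi⟩ := hext Ω h 𝒬 hW T hT f hf hfin lam hlam hv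
    refine ⟨F, G, ⟨hS, htr⟩, ?_⟩
    rw [SobolevTrace.lintegral_rpow_enorm_eq _ hp0,
      SobolevTrace.lintegral_rpow_enorm_eq _ hp0] at hFi hGi
    -- Subadditivity of the power `1 / p ≤ 1`, which turns the bound on `p`-th powers into one on
    -- norms without a further constant.
    have hroot : (ENNReal.ofReal lam + X ^ p) ^ (1 / p) ≤ X + ENNReal.ofReal (lam ^ (1 / p)) := by
      refine (ENNReal.rpow_add_le_add_rpow _ _ (by positivity)
        ((div_le_one hp0).2 hp1.le)).trans (le_of_eq ?_)
      rw [← ENNReal.rpow_mul, mul_one_div_cancel hp0.ne', ENNReal.rpow_one,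
        ENNReal.ofReal_rpow_of_pos hlam, add_comm]
    have h2 : ENNReal.ofReal (2 * B₃) = ENNReal.ofReal B₃ + ENNReal.ofReal B₃ := by
      rw [two_mul, ENNReal.ofReal_add hB₃0.le hB₃0.le]
    rw [h2, add_mul]
    exact add_le_add
      ((SobolevTrace.le_mul_rpow_of_rpow_le hC₃ hp0 hFi).trans (mul_le_mul_right hroot _))
      ((SobolevTrace.le_mul_rpow_of_rpow_le hC₃ hp0 hGi).trans (mul_le_mul_right hroot _))
  have hiff : SobolevTrace.MemTraceSpace Ω p f →
      SobolevTrace.ContinuousForClosureDist Ω (SobolevTrace.sobolevExponent n p) f ∧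
      MemLp c (ENNReal.ofReal p) (volume.restrict (SobolevTrace.boundaryNhd Ω ε)) ∧
      ∃ lam : ℝ, 0 < lam ∧ SobolevTrace.VariationalBound Ω p ε η f lam := by
    rintro ⟨F, G, hS, hf⟩
    refine ⟨hf.continuousForClosureDist h hp1 hα hS, ⟨hcm, ?_⟩, ?_⟩
    · refine (hnec₁ F G hS hf).trans_lt (lt_top_iff_ne_top.2 ?_)
      exact ENNReal.mul_ne_top ENNReal.ofReal_ne_top
        (ENNReal.add_ne_top.2 ⟨hS.2.1.2.ne, hS.2.2.1.2.ne⟩)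
    · obtain ⟨lam, hlam, -⟩ := hnec₂ F G hS hf 1 one_pos
      exact ⟨lam, hlam⟩
  refine ⟨⟨hiff, ?_⟩, fun hmem => ⟨?_, ?_⟩⟩
  · rintro ⟨hf, hL, lam, hlam, hv⟩
    obtain ⟨F, G, hFG, -⟩ := hsuf hf hL.2.ne lam hlam hv
    exact ⟨F, G, hFG⟩
  · obtain ⟨hf, hL, -⟩ := hiff hmem
    unfold SobolevTrace.variationalNorm
    rw [ENNReal.add_iInf₂, ENNReal.mul_iInf_of_ne hCne ENNReal.ofReal_ne_top]
    refine le_iInf fun lam => ?_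
    rw [ENNReal.mul_iInf_of_ne hCne ENNReal.ofReal_ne_top]
    refine le_iInf fun hlam => ?_
    obtain ⟨F, G, hFG, hle⟩ := hsuf hf hL.2.ne lam hlam.1 hlam.2
    have htr : SobolevTrace.traceNorm Ω p f ≤
        ENNReal.ofReal (2 * B₃) * (X + ENNReal.ofReal (lam ^ (1 / p))) := by
      unfold SobolevTrace.traceNorm
      exact iInf_le_of_le F (iInf_le_of_le G (iInf_le_of_le hFG hle))
    refine htr.trans ?_
    refine mul_le_mul_left (ENNReal.ofReal_le_ofReal ?_) _
    rw [hC]; linarith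
  · unfold SobolevTrace.traceNorm
    rw [ENNReal.mul_iInf_of_ne hCne ENNReal.ofReal_ne_top]
    refine le_iInf fun F => ?_
    rw [ENNReal.mul_iInf_of_ne hCne ENNReal.ofReal_ne_top]
    refine le_iInf fun G => ?_
    rw [ENNReal.mul_iInf_of_ne hCne ENNReal.ofReal_ne_top]
    refine le_iInf fun hFG => ?_
    have hV : SobolevTrace.variationalNorm Ω p ε η f ≤
        ENNReal.ofReal B₂ * eLpNorm G (ENNReal.ofReal p) (volume.restrict Ω) := by
      refine ENNReal.le_of_forall_pos_le_add fun δ hδ _ => ?_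
      obtain ⟨lam, hlam, hle⟩ := hnec₂ F G hFG.1 hFG.2 δ hδ
      rw [ENNReal.ofReal_coe_nnreal] at hle
      exact (iInf_le_of_le lam (iInf_le _ hlam)).trans hle
    calc _ ≤ ENNReal.ofReal B₁ * (eLpNorm F (ENNReal.ofReal p) (volume.restrict Ω) +
          eLpNorm G (ENNReal.ofReal p) (volume.restrict Ω)) +
          ENNReal.ofReal B₂ * (eLpNorm F (ENNReal.ofReal p) (volume.restrict Ω) +
          eLpNorm G (ENNReal.ofReal p) (volume.restrict Ω)) := by
          refine add_le_add (hnec₁ F G hFG.1 hFG.2) (hV.trans ?_)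
          gcongr
          exact le_add_self
      _ ≤ _ := by
          rw [← add_mul, ← ENNReal.ofReal_add hB₁0.le hB₂0.le]
          gcongr
          rw [hC]; linarith
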